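/- Let $(M^3,g,k)$ be a smooth initial data set, i.e. a smooth 3-manifold (without boundary) with a smooth Riemannian metric $g$ and a smooth symmetric 2-tensor field $k$. Let $\mu=\frac12\big(R+(\operatorname{tr}_gk)^2-|k|^2\big)$ and $J=\operatorname{div}(k-(\operatorname{tr}_gk)g)$, where $R$ is the scalar curvature of $g$. For positive functions $u,v$ on $M$ with nowhere vanishing gradients put $\nu_u=\frac{\nabla u}{|\nabla u|}$, $\nu_v=\frac{\nabla v}{|\nabla v|}$, $$(\overline\nabla^2_+)_{ij}u=\nabla_{ij}u+k_{ij}|\nabla u|-\frac{|\nabla u||\nabla v|+\langle\nabla u,\nabla v\rangle}{u+v}g_{ij}+\frac{\nabla_iu\nabla_jv+\nabla_ju\nabla_iv}{u+v},$$ $$(\overline\nabla^2_-)_{ij}v=\nabla_{ij}v-k_{ij}|\nabla v|-\frac{|\nabla u||\nabla v|+\langle\nabla u,\nabla v\rangle}{u+v}g_{ij}+\frac{\nabla_iu\nabla_jv+\nabla_ju\nabla_iv}{u+v},$$ and $\overline\Delta_\pm=\operatorname{tr}_g\overline\nabla^2_\pm$. Let $a\in[0,1]$ and $\alpha\in(0,1)$,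 and suppose that $u,v\in C^{2,\alpha}(M)$ are positive, satisfy $|\nabla u|,|\nabla v|\neq0$ everywhere, and solve $$\overline\Delta_+u=a(\overline\nabla^2_+)_{\nu_u\nu_u}u,\qquad \overline\Delta_-v=a(\overline\nabla^2_-)_{\nu_v\nu_v}v.$$ Let $K_u,K_v$ be the Gaussian curvatures of the level sets of $u,v$; that is, $K_u(p)$ is the Gaussian curvature at $p$ of the level set of $u$ through $p$ with its induced metric. (The level sets are only of class $C^{2}$; their curvature is understood in the sense of distributions on the level sets, and part of the claim is that it is given by continuous functions $K_u,K_v$ on $M$.) Then the continuous vector field $$Y=2\nabla(|\nabla u|+|\nabla v|)+2k(\nabla(u-v),\cdot)+\frac{4(|\nabla u|\nabla v+|\nabla v|\nabla u)}{u+v}-2\Delta u\frac{\nabla u}{|\nabla u|}-2\Delta v\frac{\nabla v}{|\nabla v|}-2\operatorname{tr}_g(k)\nabla(u-v)$$ satisfies $$\operatorname{div}Y=\frac{|\overline\nabla_+^2u|^2-(a(\overline\nabla_+^2)_{\nu_u\nu_u}u)^2}{|\nabla u|}+\frac{|\overline\nabla_-^2v|^2-(a(\overline\nabla_-^2)_{\nu_v\nu_v}v)^2}{|\nabla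 v|}+2\mu(|\nabla u|+|\nabla v|)+2\langle J,\nabla u-\nabla v\rangle-2K_u|\nabla u|-2K_v|\nabla v|$$ in the sense of distributions on $M$, and pointwise on every open set on which $Y$ is of class $C^1$. The sum of the first two terms on the right-hand side is nonnegative. -/

import Mathlib

open scoped Manifold ContDiff NNReal
open MeasureTheory

noncomputable section

namespace SpacetimeIMCF

/-- Euclidean `n`-space: the model space of charts (`n = 3`) and the parameter domain of surface
pieces (`n = 2`). -/
abbrev EucSp (n : ℕ) : Type := EuclideanSpace ℝ (Fin n)

/-- The tangent space of a 3-manifold at a point. -/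
abbrev TSp {M : Type*} [TopologicalSpace M] [ChartedSpace (EucSp 3) M] (p : M) : Type :=
  TangentSpace 𝓘(ℝ, EucSp 3) p

/-! ### Tensor calculus in local coordinates

`G : EucSp n → Matrix (Fin n) (Fin n) ℝ` is the matrix `(g_ij)` of a Riemannian metric in local
coordinates. Covariant indices are lower, contravariant indices are upper, as usual. -/

section Coordinates

variable {n : ℕ}

/-- The partial derivative `∂_i f`. -/
def pd (i : Fin n) (f : EucSp n → ℝ) (y : EucSp n) : ℝ :=
  fderiv ℝ f y (EuclideanSpace.single i (1 : ℝ))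

/-- The Christoffel symbols `Γ^m_ij = ½ ∑_l g^ml (∂_i g_jl + ∂_j g_il - ∂_l g_ij)`. -/
def christoffel (G : EucSp n → Matrix (Fin n) (Fin n) ℝ) (m i j : Fin n) (y : EucSp n) : ℝ :=
  1 / 2 * ∑ l, (G y)⁻¹ m l *
    (pd i (fun z => G z j l) y + pd j (fun z => G z i l) y - pd l (fun z => G z i j) y)

/-- The density `√(det g)` of the Riemannian volume. -/
def volDensity (G : EucSp n → Matrix (Fin n) (Fin n) ℝ) (y : EucSp n) : ℝ :=
  √((G y).det)

/-- The gradient `∇^i f = ∑_j g^ij ∂_j f`. -/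
def grad (G : EucSp n → Matrix (Fin n) (Fin n) ℝ) (f : EucSp n → ℝ) (y : EucSp n) : Fin n → ℝ :=
  fun i => ∑ j, (G y)⁻¹ i j * pd j f y

/-- The inner product `⟨X, Z⟩ = ∑ g_ij X^i Z^j` of two vectors. -/
def ip (A : Matrix (Fin n) (Fin n) ℝ) (X Z : Fin n → ℝ) : ℝ :=
  ∑ i, ∑ j, A i j * X i * Z j

/-- The length `|X|` of a vector. -/
def len (A : Matrix (Fin n) (Fin n) ℝ) (X : Fin n → ℝ) : ℝ :=
  √(ip A X X)

/-- `|∇f|`. -/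
def gradLen (G : EucSp n → Matrix (Fin n) (Fin n) ℝ) (f : EucSp n → ℝ) (y : EucSp n) : ℝ :=
  len (G y) (grad G f y)

/-- The unit normal `ν_f = ∇f / |∇f|` of the level sets of `f`. -/
def unitNormal (G : EucSp n → Matrix (Fin n) (Fin n) ℝ) (f : EucSp n → ℝ) (y : EucSp n) :
    Fin n → ℝ :=
  fun i => grad G f y i / gradLen G f y

/-- The Hessian `∇_ij f = ∂_i ∂_j f - ∑_m Γ^m_ij ∂_m f`. -/
def hess (G : EucSp n → Matrix (Fin n) (Fin n) ℝ) (f : EucSp n → ℝ) (y : EucSp n) :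
    Matrix (Fin n) (Fin n) ℝ :=
  Matrix.of fun i j => pd i (pd j f) y - ∑ m, christoffel G m i j y * pd m f y

/-- The trace `tr_g T = ∑ g^ij T_ij` of a covariant 2-tensor. -/
def tr (A T : Matrix (Fin n) (Fin n) ℝ) : ℝ :=
  ∑ i, ∑ j, A⁻¹ i j * T i j

/-- The squared norm `|T|² = ∑ g^ia g^jb T_ij T_ab` of a covariant 2-tensor. -/
def normSq (A T : Matrix (Fin n) (Fin n) ℝ) : ℝ :=
  ∑ i, ∑ j, ∑ a, ∑ b, A⁻¹ i a * A⁻¹ j b * T i j * T a b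

/-- The value `T(X, Z) = ∑ T_ij X^i Z^j`. -/
def eval₂ (T : Matrix (Fin n) (Fin n) ℝ) (X Z : Fin n → ℝ) : ℝ :=
  ∑ i, ∑ j, T i j * X i * Z j

/-- The Laplacian `Δf = tr_g ∇²f`. -/
def lap (G : EucSp n → Matrix (Fin n) (Fin n) ℝ) (f : EucSp n → ℝ) (y : EucSp n) : ℝ :=
  tr (G y) (hess G f y)

/-- The vector field `T(X, ·)` with its index raised: `∑ g^ij T_jl X^l`. -/
def contract (A T : Matrix (Fin n) (Fin n) ℝ) (X : Fin n → ℝ) : Fin n → ℝ :=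
  fun i => ∑ j, ∑ l, A⁻¹ i j * T j l * X l

/-- The classical divergence `div Y = ∑_i (∂_i Y^i + ∑_j Γ^i_ij Y^j)` of a vector field. -/
def divergence (G : EucSp n → Matrix (Fin n) (Fin n) ℝ) (Y : EucSp n → Fin n → ℝ)
    (y : EucSp n) : ℝ :=
  ∑ i, (pd i (fun z => Y z i) y + ∑ j, christoffel G i i j y * Y y j)

/-- `div Y = f` on the open set `Ω` in the sense of distributions, for a continuous vector field
`Y` and a continuous function `f`:  `∫ ⟨Y, ∇φ⟩ dV = - ∫ f φ dV` for all test functions `φ`. -/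
def IsWeakDivergenceOn (G : EucSp n → Matrix (Fin n) (Fin n) ℝ) (Ω : Set (EucSp n))
    (Y : EucSp n → Fin n → ℝ) (f : EucSp n → ℝ) : Prop :=
  ContinuousOn Y Ω ∧ ContinuousOn f Ω ∧
  ∀ φ : EucSp n → ℝ, ContDiff ℝ ∞ φ → HasCompactSupport φ → tsupport φ ⊆ Ω →
    ∫ y, (∑ i, Y y i * pd i φ y) * volDensity G y = - ∫ y, f y * φ y * volDensity G y

/-- The Ricci tensor
`R_jl = ∑_i (∂_i Γ^i_jl - ∂_j Γ^i_il) + ∑_{i,m} (Γ^i_im Γ^m_jl - Γ^i_jm Γ^m_il)`. -/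
def ricci (G : EucSp n → Matrix (Fin n) (Fin n) ℝ) (y : EucSp n) : Matrix (Fin n) (Fin n) ℝ :=
  Matrix.of fun j l =>
    ∑ i, (pd i (christoffel G i j l) y - pd j (christoffel G i i l) y) +
    ∑ i, ∑ m, (christoffel G i i m y * christoffel G m j l y -
      christoffel G i j m y * christoffel G m i l y)

/-- The scalar curvature `R = tr_g Ric`. -/
def scalarCurv (G : EucSp n → Matrix (Fin n) (Fin n) ℝ) (y : EucSp n) : ℝ :=
  tr (G y) (ricci G y)

/-- The covariant derivative `∇_l T_ij = ∂_l T_ij - ∑_m (Γ^m_li T_mj + Γ^m_lj T_im)` of a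
covariant 2-tensor field. -/
def covDeriv₂ (G T : EucSp n → Matrix (Fin n) (Fin n) ℝ) (l i j : Fin n) (y : EucSp n) : ℝ :=
  pd l (fun z => T z i j) y -
    ∑ m, (christoffel G m l i y * T y m j + christoffel G m l j y * T y i m)

/-- The energy density `μ = ½ (R + (tr_g k)² - |k|²)`. -/
def energyDensity (G k : EucSp n → Matrix (Fin n) (Fin n) ℝ) (y : EucSp n) : ℝ :=
  1 / 2 * (scalarCurv G y + (tr (G y) (k y)) ^ 2 - normSq (G y) (k y))

/-- The momentum density `J = div (k - (tr_g k) g)`, as a 1-form: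
`J_j = ∑ g^li ∇_l (k - (tr_g k) g)_ij`. -/
def momentumDensity (G k : EucSp n → Matrix (Fin n) (Fin n) ℝ) (y : EucSp n) : Fin n → ℝ :=
  fun j => ∑ l, ∑ i, (G y)⁻¹ l i * covDeriv₂ G (fun z => k z - tr (G z) (k z) • G z) l i j y

/-! ### The spacetime Hessians, the vector field `Y`, and the right-hand side -/

/-- The terms common to both spacetime Hessians:
`- (|∇u||∇v| + ⟨∇u,∇v⟩)/(u+v) g_ij + (∇_i u ∇_j v + ∇_j u ∇_i v)/(u+v)`. -/
def couplingTerm (G : EucSp n → Matrix (Fin n) (Fin n) ℝ) (u v : EucSp n → ℝ) (y : EucSp n) :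
    Matrix (Fin n) (Fin n) ℝ :=
  Matrix.of fun i j =>
    -((gradLen G u y * gradLen G v y + ip (G y) (grad G u y) (grad G v y)) / (u y + v y)) * G y i j
      + (pd i u y * pd j v y + pd j u y * pd i v y) / (u y + v y)

/-- `(∇̄²₊) u = ∇²u + k |∇u| + coupling term`. -/
def hessPlus (G k : EucSp n → Matrix (Fin n) (Fin n) ℝ) (u v : EucSp n → ℝ) (y : EucSp n) :
    Matrix (Fin n) (Fin n) ℝ :=
  hess G u y + gradLen G u y • k y + couplingTerm G u v y

/-- `(∇̄²₋) v = ∇²v - k |∇v| + coupling term`. -/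
def hessMinus (G k : EucSp n → Matrix (Fin n) (Fin n) ℝ) (u v : EucSp n → ℝ) (y : EucSp n) :
    Matrix (Fin n) (Fin n) ℝ :=
  hess G v y - gradLen G v y • k y + couplingTerm G u v y

/-- `(∇̄²₊)_{ν_u ν_u} u`. -/
def hessPlusNormal (G k : EucSp n → Matrix (Fin n) (Fin n) ℝ) (u v : EucSp n → ℝ)
    (y : EucSp n) : ℝ :=
  eval₂ (hessPlus G k u v y) (unitNormal G u y) (unitNormal G u y)

/-- `(∇̄²₋)_{ν_v ν_v} v`. -/
def hessMinusNormal (G k : EucSp n → Matrix (Fin n) (Fin n) ℝ) (u v : EucSp n → ℝ)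
    (y : EucSp n) : ℝ :=
  eval₂ (hessMinus G k u v y) (unitNormal G v y) (unitNormal G v y)

/-- The vector field
`Y = 2∇(|∇u| + |∇v|) + 2k(∇(u-v),·) + 4(|∇u|∇v + |∇v|∇u)/(u+v)
  - 2Δu ∇u/|∇u| - 2Δv ∇v/|∇v| - 2 tr_g(k) ∇(u-v)`. -/
def fieldY (G k : EucSp n → Matrix (Fin n) (Fin n) ℝ) (u v : EucSp n → ℝ) (y : EucSp n) :
    Fin n → ℝ :=
  fun i =>
    2 * grad G (fun z => gradLen G u z + gradLen G v z) y i
    + 2 * contract (G y) (k y) (grad G (fun z => u z - v z) y) i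
    + 4 * ((gradLen G u y * grad G v y i + gradLen G v y * grad G u y i) * (1 / (u y + v y)))
    - 2 * lap G u y * (grad G u y i / gradLen G u y)
    - 2 * lap G v y * (grad G v y i / gradLen G v y)
    - 2 * tr (G y) (k y) * grad G (fun z => u z - v z) y i

/-- The Hessian terms
`(|∇̄²₊u|² - (a(∇̄²₊)_{ν_uν_u}u)²)/|∇u| + (|∇̄²₋v|² - (a(∇̄²₋)_{ν_vν_v}v)²)/|∇v|`. -/
def hessTerms (G k : EucSp n → Matrix (Fin n) (Fin n) ℝ) (a : ℝ) (u v : EucSp n → ℝ)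
    (y : EucSp n) : ℝ :=
  (normSq (G y) (hessPlus G k u v y) - (a * hessPlusNormal G k u v y) ^ 2) / gradLen G u y
  + (normSq (G y) (hessMinus G k u v y) - (a * hessMinusNormal G k u v y) ^ 2) / gradLen G v y

/-- The matter terms `2μ(|∇u| + |∇v|) + 2⟨J, ∇u - ∇v⟩`. -/
def matterTerms (G k : EucSp n → Matrix (Fin n) (Fin n) ℝ) (u v : EucSp n → ℝ)
    (y : EucSp n) : ℝ :=
  2 * energyDensity G k y * (gradLen G u y + gradLen G v y)
  + 2 * ∑ j, momentumDensity G k y j * (grad G u y j - grad G v y j)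

/-- The right-hand side of the divergence identity:
Hessian terms + matter terms `- 2 K_u |∇u| - 2 K_v |∇v|`. -/
def divRhs (G k : EucSp n → Matrix (Fin n) (Fin n) ℝ) (a : ℝ) (u v Ku Kv : EucSp n → ℝ)
    (y : EucSp n) : ℝ :=
  hessTerms G k a u v y + matterTerms G k u v y
    + (-2 * Ku y * gradLen G u y - 2 * Kv y * gradLen G v y)

/-! ### Gaussian curvature of a surface -/

/-- `K` is the Gaussian curvature of the Riemannian metric `h` on the open set `U` of the plane.
With `ω_b = (√(det h) / h_11) Γ²_1b` (the connection form of the orthonormal frame obtained from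
`∂_1, ∂_2` by the Gram-Schmidt process), the classical formula is
`K √(det h) = ∂_2 ω_1 - ∂_1 ω_2`.
This is required in the sense of distributions and with continuous `K`; it makes sense for metrics
that are only `C¹`, as is the induced metric of a `C²` surface. For `C²` metrics it is equivalent
to the classical formula. (The indices 1, 2 are `0, 1 : Fin 2` below.) -/
def IsGaussCurvatureOn (h : EucSp 2 → Matrix (Fin 2) (Fin 2) ℝ) (U : Set (EucSp 2))
    (K : EucSp 2 → ℝ) : Prop :=
  ContinuousOn K U ∧
  ∀ φ : EucSp 2 → ℝ, ContDiff ℝ ∞ φ → HasCompactSupport φ → tsupport φ ⊆ U →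
    ∫ x, K x * φ x * volDensity h x =
      ∫ x, volDensity h x / h x 0 0 *
        (christoffel h 1 0 1 x * pd 0 φ x - christoffel h 1 0 0 x * pd 1 φ x)

end Coordinates

/-! ### Initial data sets -/

section Manifold

variable {M : Type*} [TopologicalSpace M] [ChartedSpace (EucSp 3) M]

/-- A smooth 3-dimensional initial data set `(M, g, k)`: a smooth Riemannian metric `g` and a
smooth symmetric 2-tensor field `k` on `M`. -/
structure InitialDataSet (M : Type*) [TopologicalSpace M] [ChartedSpace (EucSp 3) M]
    [IsManifold 𝓘(ℝ, EucSp 3) ∞ M] where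
  /-- the Riemannian metric -/
  g : Bundle.ContMDiffRiemannianMetric 𝓘(ℝ, EucSp 3) ∞ (EucSp 3) (fun p : M => TSp p)
  /-- the second fundamental form -/
  k : ∀ p : M, TSp p →L[ℝ] TSp p →L[ℝ] ℝ
  k_symm : ∀ (p : M) (X Z : TSp p), k p X Z = k p Z X
  k_smooth : ContMDiff 𝓘(ℝ, EucSp 3)
    (𝓘(ℝ, EucSp 3).prod 𝓘(ℝ, EucSp 3 →L[ℝ] EucSp 3 →L[ℝ] ℝ)) ∞
    (fun p : M => Bundle.TotalSpace.mk' (EucSp 3 →L[ℝ] EucSp 3 →L[ℝ] ℝ)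
      (E := fun p : M => TSp p →L[ℝ] TSp p →L[ℝ] ℝ) p (k p))

/-- The vector `∂_i F` at `F(x)`, for a map `F` from Euclidean `n`-space to `M`. -/
def coordVec {n : ℕ} (F : EucSp n → M) (x : EucSp n) (i : Fin n) : TSp (F x) :=
  mfderiv 𝓘(ℝ, EucSp n) 𝓘(ℝ, EucSp 3) F x
    (show TangentSpace 𝓘(ℝ, EucSp n) x from EuclideanSpace.single i (1 : ℝ))

/-- The components `b(∂_i F, ∂_j F)` of a 2-tensor field `b` on `M` with respect to a map `F`.
For the inverse `F` of a chart these are the components of `b` in that chart; for a parametrized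
surface `F` and `b = g` they are the components of the induced metric. -/
def components {n : ℕ} (b : ∀ p : M, TSp p →L[ℝ] TSp p →L[ℝ] ℝ) (F : EucSp n → M)
    (x : EucSp n) : Matrix (Fin n) (Fin n) ℝ :=
  Matrix.of fun i j => b (F x) (coordVec F x i) (coordVec F x j)

/-- `u` is of class `C^{2,α}` on `M`: it is `C²`, and in every smooth chart its second partial
derivatives are `α`-Hölder on compact sets. -/
def IsC2Holder (α : ℝ≥0) (u : M → ℝ) : Prop :=
  ContMDiff 𝓘(ℝ, EucSp 3) 𝓘(ℝ, ℝ) 2 u ∧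
  ∀ e ∈ IsManifold.maximalAtlas 𝓘(ℝ, EucSp 3) ∞ M, ∀ C ⊆ e.target, IsCompact C →
    ∀ i j : Fin 3, ∃ L : ℝ≥0, HolderOnWith L α (pd i (pd j (u ∘ e.symm))) C

variable [IsManifold 𝓘(ℝ, EucSp 3) ∞ M]

/-- The components `g_ij` of the metric in the chart `e`. -/
def InitialDataSet.gIn (D : InitialDataSet M) (e : OpenPartialHomeomorph M (EucSp 3)) :
    EucSp 3 → Matrix (Fin 3) (Fin 3) ℝ :=
  components D.g.inner e.symm

/-- The components `k_ij` of the second fundamental form in the chart `e`. -/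
def InitialDataSet.kIn (D : InitialDataSet M) (e : OpenPartialHomeomorph M (EucSp 3)) :
    EucSp 3 → Matrix (Fin 3) (Fin 3) ℝ :=
  components D.k e.symm

/-- The gradient of `u` vanishes nowhere. -/
def HasNonvanishingGradient (D : InitialDataSet M) (u : M → ℝ) : Prop :=
  ∀ e ∈ IsManifold.maximalAtlas 𝓘(ℝ, EucSp 3) ∞ M, ∀ y ∈ e.target,
    gradLen (D.gIn e) (u ∘ e.symm) y ≠ 0

/-- The system `Δ̄₊u = a(∇̄²₊)_{ν_uν_u}u`, `Δ̄₋v = a(∇̄²₋)_{ν_vν_v}v`, where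
`Δ̄_± = tr_g ∇̄²_±`. -/
def SolvesSystem (D : InitialDataSet M) (a : ℝ) (u v : M → ℝ) : Prop :=
  ∀ e ∈ IsManifold.maximalAtlas 𝓘(ℝ, EucSp 3) ∞ M, ∀ y ∈ e.target,
    tr (D.gIn e y) (hessPlus (D.gIn e) (D.kIn e) (u ∘ e.symm) (v ∘ e.symm) y)
      = a * hessPlusNormal (D.gIn e) (D.kIn e) (u ∘ e.symm) (v ∘ e.symm) y ∧
    tr (D.gIn e y) (hessMinus (D.gIn e) (D.kIn e) (u ∘ e.symm) (v ∘ e.symm) y)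
      = a * hessMinusNormal (D.gIn e) (D.kIn e) (u ∘ e.symm) (v ∘ e.symm) y

/-- `K p` is the Gaussian curvature at `p` of the level set of `u` through `p`: `K` is continuous,
and for every regular `C²` parametrization `X : U → M` of a piece of a level set of `u`, the
function `K ∘ X` is the Gaussian curvature of the induced metric. If `u` is `C²` with nonvanishing
gradient, every point lies on such a piece, so that `K` is uniquely determined. -/
def IsLevelSetGaussCurvature (D : InitialDataSet M) (u K : M → ℝ) : Prop :=
  Continuous K ∧
  ∀ (U : Set (EucSp 2)) (X : EucSp 2 → M) (c : ℝ), IsOpen U →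
    ContMDiffOn 𝓘(ℝ, EucSp 2) 𝓘(ℝ, EucSp 3) 2 X U →
    (∀ x ∈ U, Function.Injective (mfderiv 𝓘(ℝ, EucSp 2) 𝓘(ℝ, EucSp 3) X x)) →
    (∀ x ∈ U, u (X x) = c) →
    IsGaussCurvatureOn (components D.g.inner X) U (K ∘ X)

end Manifold

end SpacetimeIMCF

end

/-! The core is a Bochner formula involving the curvature of the level sets. With ν = ∇u/|∇u| and U
= ∇u, the field ∇|∇u| - Δu ν equals ∇_ν U - (div U) ν. In its divergence the second derivatives of U
occur only antisymmetrized, that is, as curvature, and the result is tr(∇ν ∇U) - div ν div U +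
Ric(ν, U). For C¹ fields this survives in the sense of distributions, because second derivatives
commute weakly (`integral_pd_mul_pd_comm`, `integral_mul_wedge`,
`IsMetricOn.isWeakDivergenceOn_covDeriv`). Inserting U = |∇u| ν and the Gauss expression K = R/2 -
Ric(ν,ν) + (H² - |A|²)/2 turns it into |∇u| (R/2 - K) + (|∇²u|² - (Δu)²)/(2|∇u|), which is
`IsMetricOn.isWeakDivergenceOn_bochner`.

The remaining terms of Y, built from k(∇(u-v),·) - tr(k) ∇(u-v) and from the coupling of u and v,
are C¹ and have classical divergences (`IsMetricOn.divergence_momentum`,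
`IsMetricOn.divergence_coupling`). The expansion of |∇̄²|² - (tr ∇̄²)² in
`IsMetricOn.normSq_sub_tr_sq` shows that everything adds up to these differences divided by the
gradient lengths, plus matter and curvature terms. The equations serve only to replace each trace by
a times the normal component. The sign of the Hessian terms is Cauchy-Schwarz, |T(ν,ν)| ≤ |T|,
together with a² ≤ 1.

It remains to see that K, defined by the Gauss expression, is the distributional Gaussian curvature
of the level sets, whose induced metric is only C¹. The connection form ⟨∇E, Z⟩ of a tangential
frame can be written as p_a dE^a + q_c dX^c with C¹ coefficients, so its weak exterior derivative
involves first derivatives only. It is computed by `IsMetricOn.structure_equation` and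
`IsMetricOn.gauss_equation`. That K does not depend on the chart follows without any transformation
rule: through each point passes a C² piece of a level set, on which the expressions from two charts
are both the weak Gaussian curvature, and that is unique. Surfaces not contained in one chart are
treated by a partition of unity. -/

noncomputable section

namespace SpacetimeIMCF

/-! ### Partial derivatives on Euclidean space. -/

section PartialDerivatives

variable {n : ℕ} {f g : EucSp n → ℝ} {y : EucSp n} {Ω : Set (EucSp n)}

lemma pd_congr {i : Fin n} (h : f =ᶠ[nhds y] g) : pd i f y = pd i g y := by
  simp only [pd, h.fderiv_eq]

lemma pd_congr_of_eqOn {i : Fin n} (hΩ : IsOpen Ω) (hy : y ∈ Ω) (h : Set.EqOn f g Ω) :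
    pd i f y = pd i g y :=
  pd_congr (h.eventuallyEq_of_mem (hΩ.mem_nhds hy))

lemma pd_const (i : Fin n) (c : ℝ) : pd i (fun _ => c) y = 0 := by
  simp [pd]

lemma pd_add (i : Fin n) (hf : DifferentiableAt ℝ f y) (hg : DifferentiableAt ℝ g y) :
    pd i (fun z => f z + g z) y = pd i f y + pd i g y := by
  simp only [pd]
  rw [show (fun z => f z + g z) = f + g from rfl, fderiv_add hf hg]
  rfl

lemma pd_neg (i : Fin n) : pd i (fun z => -f z) y = -pd i f y := by
  simp only [pd]
  rw [show (fun z => -f z) = -f from rfl, fderiv_neg]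
  rfl

lemma pd_sub (i : Fin n) (hf : DifferentiableAt ℝ f y) (hg : DifferentiableAt ℝ g y) :
    pd i (fun z => f z - g z) y = pd i f y - pd i g y := by
  simp only [pd]
  rw [show (fun z => f z - g z) = f - g from rfl, fderiv_sub hf hg]
  rfl

lemma pd_mul (i : Fin n) (hf : DifferentiableAt ℝ f y) (hg : DifferentiableAt ℝ g y) :
    pd i (fun z => f z * g z) y = pd i f y * g y + f y * pd i g y := by
  simp only [pd]
  rw [show (fun z => f z * g z) = f * g from rfl, fderiv_mul hf hg]
  simp
  ring

lemma pd_const_mul (i : Fin n) (c : ℝ) (hf : DifferentiableAt ℝ f y) :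
    pd i (fun z => c * f z) y = c * pd i f y := by
  rw [pd_mul i (differentiableAt_const c) hf, pd_const]
  ring

lemma pd_sum {ι : Type*} (s : Finset ι) (i : Fin n) {F : ι → EucSp n → ℝ}
    (h : ∀ a ∈ s, DifferentiableAt ℝ (F a) y) :
    pd i (fun z => ∑ a ∈ s, F a z) y = ∑ a ∈ s, pd i (F a) y := by
  simp only [pd]
  rw [fderiv_fun_sum h]
  simp

/-- The chain rule for a function of one variable. -/
lemma pd_comp (i : Fin n) {φ : ℝ → ℝ} {φ' : ℝ} (hφ : HasDerivAt φ φ' (f y))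
    (hf : DifferentiableAt ℝ f y) : pd i (fun z => φ (f z)) y = φ' * pd i f y := by
  simp only [pd]
  have := (hφ.comp_hasFDerivAt y hf.hasFDerivAt).fderiv
  rw [show (fun z => φ (f z)) = φ ∘ f from rfl, this]
  simp

lemma pd_inv (i : Fin n) (hf : DifferentiableAt ℝ f y) (h0 : f y ≠ 0) :
    pd i (fun z => (f z)⁻¹) y = -pd i f y / f y ^ 2 := by
  rw [pd_comp i (hasDerivAt_inv h0) hf]
  ring

lemma pd_div (i : Fin n) (hf : DifferentiableAt ℝ f y) (hg : DifferentiableAt ℝ g y)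
    (h0 : g y ≠ 0) :
    pd i (fun z => f z / g z) y = pd i f y / g y - f y * pd i g y / g y ^ 2 := by
  simp only [div_eq_mul_inv]
  rw [pd_mul i hf (hg.fun_inv h0), pd_inv i hg h0]
  ring

lemma pd_sqrt (i : Fin n) (hf : DifferentiableAt ℝ f y) (h0 : f y ≠ 0) :
    pd i (fun z => √(f z)) y = pd i f y / (2 * √(f y)) := by
  rw [pd_comp i (Real.hasDerivAt_sqrt h0) hf]
  ring

lemma fderiv_apply_eq_sum_pd (f : EucSp n → ℝ) (y w : EucSp n) :
    fderiv ℝ f y w = ∑ i, pd i f y * w i := by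
  have hw : w = ∑ i, w i • EuclideanSpace.single i (1 : ℝ) := by
    ext j
    simp [Finset.sum_apply, Pi.single_apply]
  conv_lhs => rw [hw, map_sum]
  simp [pd, mul_comm]

/-- The chain rule for a map between Euclidean spaces. -/
lemma pd_comp_map {m : ℕ} (b : Fin m) {X : EucSp m → EucSp n} {x : EucSp m}
    (hf : DifferentiableAt ℝ f (X x)) (hX : DifferentiableAt ℝ X x) :
    pd b (fun z => f (X z)) x = ∑ c, pd c f (X x) * pd b (fun z => X z c) x := by
  have h1 : pd b (fun z => f (X z)) x = fderiv ℝ f (X x) (fderiv ℝ X x (EuclideanSpace.single b 1)) := by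
    simp only [pd]
    rw [show (fun z => f (X z)) = f ∘ X from rfl, fderiv_comp x hf hX]
    rfl
  rw [h1, fderiv_apply_eq_sum_pd]
  refine Finset.sum_congr rfl fun c _ => ?_
  congr 1
  simp only [pd]
  have : HasFDerivAt (fun z => X z c) ((EuclideanSpace.proj c).comp (fderiv ℝ X x)) x :=
    (EuclideanSpace.proj (𝕜 := ℝ) c).hasFDerivAt.comp x hX.hasFDerivAt
  rw [this.fderiv]
  rfl

lemma contDiffOn_pd {m k : WithTop ℕ∞} (i : Fin n) (hΩ : IsOpen Ω) (hf : ContDiffOn ℝ k f Ω)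
    (hmk : m + 1 ≤ k) : ContDiffOn ℝ m (pd i f) Ω :=
  ((hf.fderiv_of_isOpen hΩ hmk).clm_apply contDiffOn_const)

lemma contDiff_pd {m k : WithTop ℕ∞} (i : Fin n) (hf : ContDiff ℝ k f)
    (hmk : m + 1 ≤ k) : ContDiff ℝ m (pd i f) :=
  ((hf.fderiv_right hmk).clm_apply contDiff_const)

lemma pd_pd_comm (i j : Fin n) (hf : ContDiffAt ℝ 2 f y) :
    pd i (pd j f) y = pd j (pd i f) y := by
  have h := hf.isSymmSndFDerivAt (by simp)
  have hd : DifferentiableAt ℝ (fderiv ℝ f) y :=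
    (hf.fderiv_right (m := 1) (by norm_num)).differentiableAt (by norm_num)
  have key : ∀ a b : Fin n, pd a (pd b f) y =
      fderiv ℝ (fderiv ℝ f) y (EuclideanSpace.single a 1) (EuclideanSpace.single b 1) := by
    intro a b
    have := (hd.hasFDerivAt.clm_apply (hasFDerivAt_const (EuclideanSpace.single b (1 : ℝ)) y)).fderiv
    simp only [pd]
    erw [this]
    simp
  rw [key, key]
  exact h.eq _ _

lemma tsupport_pd_subset (i : Fin n) (f : EucSp n → ℝ) : tsupport (pd i f) ⊆ tsupport f :=
  tsupport_fderiv_apply_subset ℝ _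

end PartialDerivatives

/-! ### Distributional calculus for C¹ functions. -/

section WeakDerivatives

variable {n : ℕ} {f g : EucSp n → ℝ} {Ω : Set (EucSp n)}

/-- The product vanishes near every point outside the support of g, so regularity of f on Ω alone
suffices. This lets locally defined data be paired with test functions. -/
lemma contDiff_mul_of_tsupport_subset {k : WithTop ℕ∞} (hΩ : IsOpen Ω) (hf : ContDiffOn ℝ k f Ω)
    (hg : ContDiff ℝ k g) (hs : tsupport g ⊆ Ω) : ContDiff ℝ k (fun x => f x * g x) := by
  rw [contDiff_iff_contDiffAt]
  intro x
  by_cases hx : x ∈ tsupport g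
  · exact (hf.contDiffAt (hΩ.mem_nhds (hs hx))).mul hg.contDiffAt
  · have : (fun x => f x * g x) =ᶠ[nhds x] fun _ => 0 := by
      filter_upwards [notMem_tsupport_iff_eventuallyEq.mp hx] with z hz
      simp [hz]
    exact contDiffAt_const.congr_of_eventuallyEq this

lemma integrable_mul_of_tsupport_subset (hΩ : IsOpen Ω) (hf : ContinuousOn f Ω)
    (hg : Continuous g) (hc : HasCompactSupport g) (hs : tsupport g ⊆ Ω) :
    Integrable (fun x => f x * g x) := by
  have h := contDiff_mul_of_tsupport_subset (k := 0) hΩ (contDiffOn_zero.2 hf)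
    (contDiff_zero.2 hg) hs
  exact h.continuous.integrable_of_hasCompactSupport hc.mul_left

/-- Integration by parts. -/
lemma integral_mul_pd (i : Fin n) (hΩ : IsOpen Ω) (hf : ContDiffOn ℝ 1 f Ω) (hg : ContDiff ℝ 1 g)
    (hc : HasCompactSupport g) (hs : tsupport g ⊆ Ω) :
    ∫ x, f x * pd i g x = -∫ x, pd i f x * g x := by
  refine integral_mul_fderiv_eq_neg_fderiv_mul_of_integrable ?_ ?_ ?_ ?_ ?_
  · exact integrable_mul_of_tsupport_subset hΩ
      (contDiffOn_zero.1 (contDiffOn_pd i hΩ hf (by simp))) hg.continuous hc hs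
  · exact integrable_mul_of_tsupport_subset hΩ hf.continuousOn
      (contDiff_pd i hg (m := 0) (by simp)).continuous
      (hc.mono' ((subset_tsupport _).trans (tsupport_pd_subset i g)))
      ((tsupport_pd_subset i g).trans hs)
  · exact integrable_mul_of_tsupport_subset hΩ hf.continuousOn hg.continuous hc hs
  · exact fun x hx => (hf.contDiffAt (hΩ.mem_nhds (hs hx))).differentiableAt (by norm_num)
  · exact fun x _ => hg.differentiable (by norm_num) x

lemma pd_translate (j : Fin n) (v x : EucSp n) : pd j (fun z => g (z + v)) x = pd j g (x + v) := by
  simp only [pd]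
  rw [fderiv_comp_add_right]

/-- With second derivatives available, two integrations by parts would do. For C¹ functions ∂_i is
replaced by a difference quotient: it commutes with ∂_j, preserves C¹, and by translation invariance
its adjoint is the quotient with the opposite step. The claim is the limit as the step tends to 0.
-/
lemma integral_pd_mul_pd_comm_of_hasCompactSupport (i j : Fin n) (hf : ContDiff ℝ 1 f)
    (hfc : HasCompactSupport f) (hg : ContDiff ℝ 1 g) (hgc : HasCompactSupport g) :
    ∫ x, pd i f x * pd j g x = ∫ x, pd j f x * pd i g x := by
  obtain ⟨C, hC⟩ := ContDiff.lipschitzWith_of_hasCompactSupport hfc hf (by norm_num)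
  obtain ⟨D, hD⟩ := ContDiff.lipschitzWith_of_hasCompactSupport hgc hg (by norm_num)
  have hcont : ∀ {h : EucSp n → ℝ} (k : Fin n), ContDiff ℝ 1 h → Continuous (pd k h) :=
    fun k hh => (contDiff_pd (m := 0) k hh (by simp)).continuous
  have hcpt : ∀ {h : EucSp n → ℝ} (k : Fin n), HasCompactSupport h → HasCompactSupport (pd k h) :=
    fun k hh => hh.mono' ((subset_tsupport _).trans (tsupport_pd_subset k _))
  set e : EucSp n := EuclideanSpace.single i 1
  have hlim1 := LipschitzWith.integral_inv_smul_sub_mul_tendsto_integral_lineDeriv_mul (μ := volume) hD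
    ((hcont j hf).integrable_of_hasCompactSupport (hcpt j hfc)) e
  have hlim2 := LipschitzWith.integral_inv_smul_sub_mul_tendsto_integral_lineDeriv_mul (μ := volume) hC
    ((hcont j hg).integrable_of_hasCompactSupport (hcpt j hgc)) (-e)
  -- Integration by parts in direction j, followed by a translation by t • e. The translation
  -- reverses the step, which is why `hlim2` is taken in direction -e.
  have hquot : ∀ t : ℝ, ∫ x, (t⁻¹ • (g (x + t • e) - g x)) * pd j f x =
      -∫ x, (t⁻¹ • (f (x + t • (-e)) - f x)) * pd j g x := by
    intro t
    have hgt : ContDiff ℝ 1 (fun x => g (x + t • e)) := hg.comp (contDiff_id.add contDiff_const)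
    have hq : ContDiff ℝ 1 (fun x => t⁻¹ • (g (x + t • e) - g x)) :=
      (hgt.sub hg).const_smul t⁻¹
    rw [integral_mul_pd j isOpen_univ hq.contDiffOn hf hfc (Set.subset_univ _)]
    have hpdq : ∀ x, pd j (fun x => t⁻¹ • (g (x + t • e) - g x)) x =
        t⁻¹ * (pd j g (x + t • e) - pd j g x) := by
      intro x
      simp only [smul_eq_mul]
      rw [pd_const_mul j _ ((hgt.sub hg).differentiable (by norm_num) x),
        pd_sub j (hgt.differentiable (by norm_num) x) (hg.differentiable (by norm_num) x),
        pd_translate]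
    simp only [hpdq]
    congr 1
    have hI1 : Integrable (fun x => pd j g (x + t • e) * f x) :=
      ((((hcont j hg).comp (continuous_id.add continuous_const)).mul
        hf.continuous).integrable_of_hasCompactSupport hfc.mul_left)
    have hI2 : Integrable (fun x => pd j g x * f x) :=
      (((hcont j hg).mul hf.continuous).integrable_of_hasCompactSupport hfc.mul_left)
    have hI3 : Integrable (fun x => pd j g x * f (x + t • (-e))) :=
      (((hcont j hg).mul (hf.continuous.comp
        (continuous_id.add continuous_const))).integrable_of_hasCompactSupport
          (hcpt j hgc).mul_right)
    have hshift : ∫ x, pd j g (x + t • e) * f x = ∫ x, pd j g x * f (x + t • (-e)) := by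
      rw [← integral_add_right_eq_self (μ := (volume : Measure (EucSp n)))
        (fun x => pd j g x * f (x + t • (-e))) (t • e)]
      refine integral_congr_ae (Filter.Eventually.of_forall fun x => ?_)
      simp
    calc ∫ x, t⁻¹ * (pd j g (x + t • e) - pd j g x) * f x
        = ∫ x, t⁻¹ * (pd j g (x + t • e) * f x - pd j g x * f x) := by
          congr 1; ext x; ring
      _ = t⁻¹ * (∫ x, pd j g x * f (x + t • (-e)) - pd j g x * f x) := by
          rw [integral_const_mul, integral_sub hI1 hI2, hshift, integral_sub hI3 hI2]
      _ = ∫ x, (t⁻¹ • (f (x + t • (-e)) - f x)) * pd j g x := by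
          rw [← integral_const_mul]
          congr 1; ext x; simp only [smul_eq_mul]; ring
  simp only [hquot] at hlim1
  have huniq := tendsto_nhds_unique hlim1 hlim2.neg
  have hline : ∀ {h : EucSp n → ℝ} (x v : EucSp n), ContDiff ℝ 1 h →
      lineDeriv ℝ h x v = fderiv ℝ h x v := fun x v hh =>
    (hh.differentiable (by norm_num) x).lineDeriv_eq_fderiv
  simp only [hline _ _ hg, hline _ _ hf, map_neg, neg_mul, integral_neg, neg_neg] at huniq
  change ∫ x, pd i g x * pd j f x = ∫ x, pd i f x * pd j g x at huniq
  rw [← huniq]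
  simp only [mul_comm]

/-- χ is 1 on a neighbourhood of K, not only on K, so that multiplication by χ does not change
derivatives at points of K. -/
lemma exists_cutoff {K : Set (EucSp n)} (hK : IsCompact K) (hΩ : IsOpen Ω) (hKΩ : K ⊆ Ω) :
    ∃ χ : EucSp n → ℝ, ContDiff ℝ ∞ χ ∧ HasCompactSupport χ ∧ tsupport χ ⊆ Ω ∧
      ∀ᶠ x in nhdsSet K, χ x = 1 := by
  obtain ⟨L, hL, hKL, hLΩ⟩ := exists_compact_between hK hΩ hKΩ
  obtain ⟨χ, h1, h0, -⟩ := exists_contMDiffMap_one_nhds_of_subset_interior 𝓘(ℝ, EucSp n)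
    (n := ⊤) hK.isClosed hKL
  have hsub : tsupport χ ⊆ L :=
    closure_minimal (fun x hx => by by_contra hxL; exact hx (h0 x hxL)) hL.isClosed
  exact ⟨χ, χ.contMDiff.contDiff, hL.of_isClosed_subset (isClosed_tsupport _) hsub,
    hsub.trans hLΩ, h1⟩

/-- Second partial derivatives commute in the sense of distributions, for `C¹` functions. -/
lemma integral_pd_mul_pd_comm (i j : Fin n) (hΩ : IsOpen Ω) (hf : ContDiffOn ℝ 1 f Ω)
    (hg : ContDiff ℝ 1 g) (hc : HasCompactSupport g) (hs : tsupport g ⊆ Ω) :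
    ∫ x, pd i f x * pd j g x = ∫ x, pd j f x * pd i g x := by
  -- Cutting f off outside a neighbourhood of the support of g changes neither integrand and makes f
  -- globally C¹ with compact support.
  obtain ⟨χ, hχ, hχc, hχs, hχ1⟩ := exists_cutoff hc hΩ hs
  have hfχ := contDiff_mul_of_tsupport_subset hΩ hf (hχ.of_le (by simp)) hχs
  have key : ∀ (a b : Fin n) (x : EucSp n),
      pd a f x * pd b g x = pd a (fun z => f z * χ z) x * pd b g x := by
    intro a b x
    by_cases hx : x ∈ tsupport g
    · congr 1
      refine pd_congr ?_
      filter_upwards [hχ1.filter_mono (nhds_le_nhdsSet hx)] with z hz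
      simp [hz]
    · rw [image_eq_zero_of_notMem_tsupport fun h => hx (tsupport_pd_subset b g h)]
      simp
  rw [integral_congr_ae (Filter.Eventually.of_forall (key i j)),
    integral_congr_ae (Filter.Eventually.of_forall (key j i))]
  exact integral_pd_mul_pd_comm_of_hasCompactSupport i j hfχ hχc.mul_left hg hc

/-- The weak form of `d(p df) = dp ∧ df` for `C¹` functions `p` and `f`. -/
lemma integral_mul_wedge (i j : Fin n) (hΩ : IsOpen Ω) {p φ : EucSp n → ℝ}
    (hp : ContDiffOn ℝ 1 p Ω) (hf : ContDiffOn ℝ 1 f Ω) (hφ : ContDiff ℝ ∞ φ)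
    (hc : HasCompactSupport φ) (hs : tsupport φ ⊆ Ω) :
    ∫ x, p x * (pd j f x * pd i φ x - pd i f x * pd j φ x) =
      -∫ x, (pd j f x * pd i p x - pd i f x * pd j p x) * φ x := by
  have hφ1 : ContDiff ℝ 1 φ := hφ.of_le (by simp)
  have hpφ := contDiff_mul_of_tsupport_subset hΩ hp hφ1 hs
  have hpφc : HasCompactSupport (fun x => p x * φ x) := hc.mul_left
  have hpφs : tsupport (fun x => p x * φ x) ⊆ Ω := (tsupport_mul_subset_right).trans hs
  -- The commutation is tested against p φ, which is only C¹; the product rule then splits off the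
  -- terms with dp.
  have hcomm := integral_pd_mul_pd_comm j i hΩ hf hpφ hpφc hpφs
  have hcont : ∀ {h : EucSp n → ℝ} (k : Fin n), ContDiffOn ℝ 1 h Ω → ContinuousOn (pd k h) Ω :=
    fun k hh => contDiffOn_zero.1 (contDiffOn_pd k hΩ hh (by simp))
  have hmem : ∀ (a b : Fin n), Integrable (fun x => pd a f x * pd b (fun x => p x * φ x) x) :=
    fun a b => integrable_mul_of_tsupport_subset hΩ (hcont a hf)
      (contDiff_pd b hpφ (m := 0) (by simp)).continuous
      (hpφc.mono' ((subset_tsupport _).trans (tsupport_pd_subset b _)))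
      ((tsupport_pd_subset b _).trans hpφs)
  have hI2 : Integrable (fun x => (pd j f x * pd i p x - pd i f x * pd j p x) * φ x) :=
    integrable_mul_of_tsupport_subset hΩ
      (((hcont j hf).mul (hcont i hp)).sub ((hcont i hf).mul (hcont j hp)))
      hφ.continuous hc hs
  have hpt : ∀ x, p x * (pd j f x * pd i φ x - pd i f x * pd j φ x) =
      (pd j f x * pd i (fun x => p x * φ x) x - pd i f x * pd j (fun x => p x * φ x) x) -
        (pd j f x * pd i p x - pd i f x * pd j p x) * φ x := by
    intro x
    by_cases hx : x ∈ tsupport φ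
    · have hpx := (hp.contDiffAt (hΩ.mem_nhds (hs hx))).differentiableAt (by norm_num)
      have hφx := hφ1.differentiable (by norm_num) x
      rw [pd_mul i hpx hφx, pd_mul j hpx hφx]
      ring
    · have h1 : ∀ k, pd k φ x = 0 := fun k =>
        image_eq_zero_of_notMem_tsupport fun h => hx (tsupport_pd_subset k φ h)
      have h2 : ∀ k, pd k (fun x => p x * φ x) x = 0 := fun k =>
        image_eq_zero_of_notMem_tsupport fun h => hx
          (tsupport_mul_subset_right (tsupport_pd_subset k _ h))
      rw [h1, h1, h2, h2, image_eq_zero_of_notMem_tsupport hx]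
      ring
  rw [integral_congr_ae (Filter.Eventually.of_forall hpt),
    integral_sub (by exact (hmem j i).sub (hmem i j)) hI2, integral_sub (hmem j i) (hmem i j), hcomm]
  ring

/-- The fundamental lemma of the calculus of variations, for continuous functions. -/
lemma eqOn_of_integral_mul_eq (hΩ : IsOpen Ω) (hf : ContinuousOn f Ω) (hg : ContinuousOn g Ω)
    (h : ∀ φ : EucSp n → ℝ, ContDiff ℝ ∞ φ → HasCompactSupport φ → tsupport φ ⊆ Ω →
      ∫ x, f x * φ x = ∫ x, g x * φ x) : Set.EqOn f g Ω := by
  have hsub : ContinuousOn (fun x => f x - g x) Ω := hf.sub hg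
  have hae := hΩ.ae_eq_zero_of_integral_contDiff_smul_eq_zero (μ := volume)
    (hsub.locallyIntegrableOn hΩ.measurableSet) (by
      intro φ hφ hc hs
      have h1 := integrable_mul_of_tsupport_subset hΩ hf hφ.continuous hc hs
      have h2 := integrable_mul_of_tsupport_subset hΩ hg hφ.continuous hc hs
      have : ∀ x, φ x • (f x - g x) = f x * φ x - g x * φ x := fun x => by
        simp only [smul_eq_mul]; ring
      simp only [this]
      rw [integral_sub h1 h2, h φ hφ hc hs, sub_self])
  have hae' : (fun x => f x - g x) =ᵐ[volume.restrict Ω] fun _ => (0 : ℝ) :=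
    (ae_restrict_iff' hΩ.measurableSet).2 hae
  have := Measure.eqOn_open_of_ae_eq hae' hΩ hsub continuousOn_const
  exact fun x hx => sub_eq_zero.1 (this hx)

end WeakDerivatives

/-! ### Metrics in coordinates: Christoffel symbols and the Riemann tensor. -/

section Metric

variable {n : ℕ}

/-- `G` is the coordinate matrix of a Riemannian metric of class `C^m` on the set `Ω`. -/
structure IsMetricOn (m : WithTop ℕ∞) (G : EucSp n → Matrix (Fin n) (Fin n) ℝ)
    (Ω : Set (EucSp n)) : Prop where
  isOpen : IsOpen Ω
  contDiffOn : ∀ i j, ContDiffOn ℝ m (fun y => G y i j) Ω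
  posDef : ∀ y ∈ Ω, (G y).PosDef

variable {m : WithTop ℕ∞} {G : EucSp n → Matrix (Fin n) (Fin n) ℝ} {Ω : Set (EucSp n)}
  {y : EucSp n}

lemma differentiableAt_of_contDiffOn {f : EucSp n → ℝ} (hΩ : IsOpen Ω) (hf : ContDiffOn ℝ m f Ω)
    (hm : 1 ≤ m) (hy : y ∈ Ω) : DifferentiableAt ℝ f y :=
  (hf.contDiffAt (hΩ.mem_nhds hy)).differentiableAt (by
    rintro rfl
    simp at hm)

lemma contDiffOn_det {k : ℕ} {A : EucSp n → Matrix (Fin k) (Fin k) ℝ}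
    (hA : ∀ i j, ContDiffOn ℝ m (fun y => A y i j) Ω) : ContDiffOn ℝ m (fun y => (A y).det) Ω := by
  simp only [Matrix.det_apply]
  refine ContDiffOn.sum fun σ _ => ?_
  exact (contDiffOn_prod fun i _ => hA (σ i) i).const_smul _

lemma contDiffOn_adjugate {k : ℕ} {A : EucSp n → Matrix (Fin k) (Fin k) ℝ}
    (hA : ∀ i j, ContDiffOn ℝ m (fun y => A y i j) Ω) (i j : Fin k) :
    ContDiffOn ℝ m (fun y => (A y).adjugate i j) Ω := by
  simp only [Matrix.adjugate_apply]
  refine contDiffOn_det fun a b => ?_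
  by_cases h : a = j
  · subst h
    simpa using contDiffOn_const
  · simpa [Matrix.updateRow_apply, h] using hA a b

namespace IsMetricOn

variable (hG : IsMetricOn m G Ω)
include hG

lemma mono {Ω' : Set (EucSp n)} (h : Ω' ⊆ Ω) (ho : IsOpen Ω') : IsMetricOn m G Ω' :=
  ⟨ho, fun i j => (hG.contDiffOn i j).mono h, fun y hy => hG.posDef y (h hy)⟩

lemma symm (hy : y ∈ Ω) (i j : Fin n) : G y i j = G y j i := by
  simpa using (hG.posDef y hy).isHermitian.apply j i

lemma det_pos (hy : y ∈ Ω) : 0 < (G y).det := (hG.posDef y hy).det_pos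

lemma isUnit_det (hy : y ∈ Ω) : IsUnit (G y).det := (hG.det_pos hy).ne'.isUnit

lemma inv_symm (hy : y ∈ Ω) (i j : Fin n) : (G y)⁻¹ i j = (G y)⁻¹ j i := by
  simpa using (hG.posDef y hy).isHermitian.inv.apply j i

lemma inv_mul (hy : y ∈ Ω) : (G y)⁻¹ * G y = 1 := Matrix.nonsing_inv_mul _ (hG.isUnit_det hy)

lemma mul_inv (hy : y ∈ Ω) : G y * (G y)⁻¹ = 1 := Matrix.mul_nonsing_inv _ (hG.isUnit_det hy)

lemma volDensity_pos (hy : y ∈ Ω) : 0 < volDensity G y := Real.sqrt_pos.2 (hG.det_pos hy)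

lemma volDensity_sq (hy : y ∈ Ω) : volDensity G y ^ 2 = (G y).det :=
  Real.sq_sqrt (hG.det_pos hy).le

lemma contDiffOn_volDensity : ContDiffOn ℝ m (volDensity G) Ω :=
  (contDiffOn_det hG.contDiffOn).sqrt fun _ hy => (hG.det_pos hy).ne'

lemma contDiffOn_inv (i j : Fin n) : ContDiffOn ℝ m (fun y => (G y)⁻¹ i j) Ω := by
  have : ContDiffOn ℝ m (fun y => ((G y).det)⁻¹ * (G y).adjugate i j) Ω :=
    ((contDiffOn_det hG.contDiffOn).inv fun _ hy => (hG.det_pos hy).ne').mul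
      (contDiffOn_adjugate hG.contDiffOn i j)
  refine this.congr fun y _ => ?_
  simp [Matrix.inv_def]

lemma contDiffOn_christoffel {k : WithTop ℕ∞} (hk : k + 1 ≤ m) (a i j : Fin n) :
    ContDiffOn ℝ k (christoffel G a i j) Ω := by
  have hkm : k ≤ m := le_trans le_self_add hk
  have h : ∀ a b c, ContDiffOn ℝ k (pd a (fun z => G z b c)) Ω := fun a b c =>
    contDiffOn_pd a hG.isOpen (hG.contDiffOn b c) hk
  unfold christoffel
  refine contDiffOn_const.mul (ContDiffOn.sum fun l _ => ?_)
  exact ((hG.contDiffOn_inv a l).of_le hkm).mul (((h _ _ _).add (h _ _ _)).sub (h _ _ _))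

lemma pd_symm (hy : y ∈ Ω) (l i j : Fin n) :
    pd l (fun z => G z i j) y = pd l (fun z => G z j i) y :=
  pd_congr_of_eqOn hG.isOpen hy fun _ hz => hG.symm hz i j

lemma christoffel_symm (hy : y ∈ Ω) (a i j : Fin n) :
    christoffel G a i j y = christoffel G a j i y := by
  simp only [christoffel]
  congr 1
  refine Finset.sum_congr rfl fun l _ => ?_
  rw [hG.pd_symm hy l i j]
  ring

/-- Lowering the upper index cancels the inverse metric in the Christoffel symbols. Metric
compatibility is then the sum of two such expressions. -/
lemma sum_mul_christoffel (hy : y ∈ Ω) (a i j : Fin n) :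
    ∑ e, G y a e * christoffel G e i j y = 1 / 2 *
      (pd i (fun z => G z j a) y + pd j (fun z => G z i a) y - pd a (fun z => G z i j) y) := by
  simp only [christoffel, Finset.mul_sum]
  rw [Finset.sum_comm]
  have : ∀ l, ∑ e, G y a e * (1 / 2 * ((G y)⁻¹ e l *
      (pd i (fun z => G z j l) y + pd j (fun z => G z i l) y - pd l (fun z => G z i j) y))) =
      (G y * (G y)⁻¹) a l * (1 / 2 *
      (pd i (fun z => G z j l) y + pd j (fun z => G z i l) y - pd l (fun z => G z i j) y)) := by
    intro l
    rw [Matrix.mul_apply, Finset.sum_mul]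
    exact Finset.sum_congr rfl fun e _ => by ring
  simp only [this, hG.mul_inv hy, Matrix.one_apply, ite_mul, one_mul, zero_mul, Finset.sum_ite_eq,
    Finset.mem_univ, if_true]

/-- Compatibility of the Christoffel symbols with the metric. -/
lemma pd_metric (hy : y ∈ Ω) (l i j : Fin n) :
    pd l (fun z => G z i j) y =
      ∑ e, (christoffel G e l i y * G y e j + christoffel G e l j y * G y i e) := by
  have h1 := hG.sum_mul_christoffel hy j l i
  have h2 := hG.sum_mul_christoffel hy i l j
  rw [Finset.sum_add_distrib]
  have e1 : ∑ e, christoffel G e l i y * G y e j = ∑ e, G y j e * christoffel G e l i y :=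
    Finset.sum_congr rfl fun e _ => by rw [hG.symm hy e j]; ring
  have e2 : ∑ e, christoffel G e l j y * G y i e = ∑ e, G y i e * christoffel G e l j y :=
    Finset.sum_congr rfl fun e _ => by ring
  rw [e1, e2, h1, h2, hG.pd_symm hy l j i, hG.pd_symm hy i l j]
  ring

/-- This is ∇g⁻¹ = 0: differentiate g⁻¹ g = 1 and insert ∂g from `pd_metric`. -/
lemma pd_inv (hm : 1 ≤ m) (hy : y ∈ Ω) (c a b : Fin n) :
    pd c (fun z => (G z)⁻¹ a b) y =
      -∑ e, (christoffel G a c e y * (G y)⁻¹ e b + christoffel G b c e y * (G y)⁻¹ a e) := by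
  set A : Matrix (Fin n) (Fin n) ℝ := (G y)⁻¹ with hA
  set dA : Matrix (Fin n) (Fin n) ℝ := Matrix.of fun a b => pd c (fun z => (G z)⁻¹ a b) y with hdA
  set dG : Matrix (Fin n) (Fin n) ℝ := Matrix.of fun a b => pd c (fun z => G z a b) y with hdG
  set N : Matrix (Fin n) (Fin n) ℝ := Matrix.of fun e i => christoffel G e c i y with hN
  have hdGN : dG = N.transpose * G y + G y * N := by
    ext i j
    simp only [hdG, hN, Matrix.of_apply, hG.pd_metric hy, Matrix.add_apply, Matrix.mul_apply,
      Matrix.transpose_apply, ← Finset.sum_add_distrib]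
    exact Finset.sum_congr rfl fun e _ => by ring
  have hprod : dA * G y + A * dG = 0 := by
    ext i j
    have hd1 : ∀ e, DifferentiableAt ℝ (fun z => (G z)⁻¹ i e) y := fun e =>
      differentiableAt_of_contDiffOn hG.isOpen (hG.contDiffOn_inv i e) hm hy
    have hd2 : ∀ e, DifferentiableAt ℝ (fun z => G z e j) y := fun e =>
      differentiableAt_of_contDiffOn hG.isOpen (hG.contDiffOn e j) hm hy
    have h0 : pd c (fun z => ∑ e, (G z)⁻¹ i e * G z e j) y = 0 := by
      rw [pd_congr_of_eqOn (g := fun _ => (1 : Matrix (Fin n) (Fin n) ℝ) i j) hG.isOpen hy, pd_const]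
      intro z hz
      have := congrFun (congrFun (hG.inv_mul hz) i) j
      simpa [Matrix.mul_apply] using this
    rw [pd_sum _ _ fun e _ => (hd1 e).fun_mul (hd2 e)] at h0
    simp only [Matrix.add_apply, Matrix.mul_apply, Matrix.zero_apply, ← Finset.sum_add_distrib]
    rw [← h0]
    exact Finset.sum_congr rfl fun e _ => by rw [pd_mul _ (hd1 e) (hd2 e)]; rfl
  have key : dA = -(N * A + A * N.transpose) := by
    have h1 : dA = dA * G y * A := by
      rw [Matrix.mul_assoc, hG.mul_inv hy, Matrix.mul_one]
    have h2 : dA * G y = -(A * dG) := eq_neg_of_add_eq_zero_left hprod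
    rw [h1, h2, hdGN]
    simp only [Matrix.mul_add, Matrix.neg_mul, Matrix.add_mul]
    rw [Matrix.mul_assoc A (N.transpose * G y) A, Matrix.mul_assoc N.transpose, hG.mul_inv hy,
      ← Matrix.mul_assoc A (G y) N, hG.inv_mul hy]
    simp [add_comm]
  have := congrFun (congrFun key a) b
  simp only [hdA, hN, Matrix.of_apply, Matrix.neg_apply, Matrix.add_apply, Matrix.mul_apply,
    Matrix.transpose_apply, ← Finset.sum_add_distrib] at this
  rw [this]
  congr 1
  exact Finset.sum_congr rfl fun e _ => by ring

/-- Of the three derivatives in Γ^a_ai, two are exchanged by the symmetry of g^al in a and l, and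
cancel. -/
lemma sum_christoffel (hy : y ∈ Ω) (i : Fin n) :
    ∑ a, christoffel G a a i y = 1 / 2 * ∑ a, ∑ l, (G y)⁻¹ a l * pd i (fun z => G z a l) y := by
  simp only [christoffel, ← Finset.mul_sum]
  congr 1
  have h : ∑ a, ∑ l, (G y)⁻¹ a l * pd a (fun z => G z i l) y =
      ∑ a, ∑ l, (G y)⁻¹ a l * pd l (fun z => G z a i) y := by
    rw [Finset.sum_comm]
    refine Finset.sum_congr rfl fun a _ => Finset.sum_congr rfl fun l _ => ?_
    rw [hG.inv_symm hy, hG.pd_symm hy]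
  have e : ∀ a l, (G y)⁻¹ a l * (pd a (fun z => G z i l) y + pd i (fun z => G z a l) y -
      pd l (fun z => G z a i) y) = (G y)⁻¹ a l * pd a (fun z => G z i l) y +
      (G y)⁻¹ a l * pd i (fun z => G z a l) y - (G y)⁻¹ a l * pd l (fun z => G z a i) y :=
    fun a l => by ring
  simp only [e, Finset.sum_add_distrib, Finset.sum_sub_distrib, h]
  ring

end IsMetricOn

/-- The Riemann tensor `R^a_bcd`. -/
def riemann (G : EucSp n → Matrix (Fin n) (Fin n) ℝ) (a b c d : Fin n) (y : EucSp n) : ℝ :=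
  pd c (christoffel G a d b) y - pd d (christoffel G a c b) y +
    ∑ e, (christoffel G a c e y * christoffel G e d b y -
      christoffel G a d e y * christoffel G e c b y)

lemma ricci_eq_sum_riemann (G : EucSp n → Matrix (Fin n) (Fin n) ℝ) (y : EucSp n) (j l : Fin n) :
    ricci G y j l = ∑ i, riemann G i l i j y := by
  simp only [ricci, riemann, Matrix.of_apply, Finset.sum_add_distrib]

lemma riemann_antisymm_right (G : EucSp n → Matrix (Fin n) (Fin n) ℝ) (y : EucSp n)
    (a b c d : Fin n) : riemann G a b c d y = -riemann G a b d c y := by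
  simp only [riemann, Finset.sum_sub_distrib]
  ring

end Metric

/-! ### Volume density and curvature symmetry in dimension three. -/

section Dim3

variable {m : WithTop ℕ∞} {G : EucSp 3 → Matrix (Fin 3) (Fin 3) ℝ} {Ω : Set (EucSp 3)}
  {y : EucSp 3}

/-- Jacobi's formula for the derivative of a determinant, combined with `sum_christoffel`. -/
lemma IsMetricOn.pd_volDensity (hG : IsMetricOn m G Ω) (hm : 1 ≤ m) (hy : y ∈ Ω) (i : Fin 3) :
    pd i (volDensity G) y = volDensity G y * ∑ a, christoffel G a a i y := by
  have hd : ∀ a b, DifferentiableAt ℝ (fun z => G z a b) y := fun a b =>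
    differentiableAt_of_contDiffOn hG.isOpen (hG.contDiffOn a b) hm hy
  have hdet := differentiableAt_of_contDiffOn hG.isOpen (contDiffOn_det hG.contDiffOn) hm hy
  have h1 : pd i (volDensity G) y = pd i (fun z => (G z).det) y / (2 * volDensity G y) :=
    pd_sqrt i hdet (hG.det_pos hy).ne'
  have h2 : pd i (fun z => (G z).det) y =
      (G y).det * ∑ a, ∑ l, (G y)⁻¹ a l * pd i (fun z => G z a l) y := by
    have hinv : ∀ a l, (G y).det * (G y)⁻¹ a l = (G y).adjugate a l := fun a l => by
      rw [Matrix.inv_def, Ring.inverse_eq_inv', Matrix.smul_apply, smul_eq_mul,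
        mul_inv_cancel_left₀ (hG.det_pos hy).ne']
    -- Writing det · G⁻¹ as the adjugate makes both sides polynomials in the metric entries and
    -- their derivatives.
    simp only [Finset.mul_sum, ← mul_assoc, hinv]
    simp only [Matrix.det_fin_three]
    have hm2 : ∀ a b c d, pd i (fun z => G z a b * G z c d) y =
        pd i (fun z => G z a b) y * G y c d + G y a b * pd i (fun z => G z c d) y :=
      fun a b c d => pd_mul i (hd a b) (hd c d)
    have hm3 : ∀ a b c d e f, pd i (fun z => G z a b * G z c d * G z e f) y =
        (pd i (fun z => G z a b) y * G y c d + G y a b * pd i (fun z => G z c d) y) * G y e f +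
        G y a b * G y c d * pd i (fun z => G z e f) y :=
      fun a b c d e f => by rw [pd_mul i ((hd a b).fun_mul (hd c d)) (hd e f), hm2]
    have hd3 : ∀ a b c d e f, DifferentiableAt ℝ (fun z => G z a b * G z c d * G z e f) y :=
      fun a b c d e f => ((hd a b).mul (hd c d)).mul (hd e f)
    rw [pd_sub, pd_add, pd_add, pd_sub, pd_sub]
    · simp only [hm3, Fin.sum_univ_three, Matrix.adjugate_fin_three, Matrix.of_apply,
        Matrix.cons_val', Matrix.cons_val]
      rw [hG.pd_symm hy i 1 0, hG.pd_symm hy i 2 0, hG.pd_symm hy i 2 1,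
        hG.symm hy 1 0, hG.symm hy 2 0, hG.symm hy 2 1]
      ring
    all_goals fun_prop (disch := assumption)
  have hpos := hG.volDensity_pos hy
  rw [h1, h2, hG.sum_christoffel hy, ← hG.volDensity_sq hy]
  field_simp

/-- The second derivatives of g_ab commute. After inserting metric compatibility twice, their
commutator is the sum of the two lowered curvature terms, which must therefore vanish. -/
lemma IsMetricOn.riemann_antisymm_left (hG : IsMetricOn m G Ω) (hm : 2 ≤ m) (hy : y ∈ Ω)
    (a b c d : Fin 3) :
    ∑ e, G y a e * riemann G e b c d y = -∑ e, G y b e * riemann G e a c d y := by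
  have hm1 : (1 : WithTop ℕ∞) ≤ m := le_trans (by norm_num) hm
  have hd : ∀ a b, DifferentiableAt ℝ (fun z => G z a b) y := fun a b =>
    differentiableAt_of_contDiffOn hG.isOpen (hG.contDiffOn a b) hm1 hy
  have hΓ : ∀ e i j, DifferentiableAt ℝ (christoffel G e i j) y := fun e i j =>
    differentiableAt_of_contDiffOn hG.isOpen
      (hG.contDiffOn_christoffel (k := 1) (by norm_num; exact hm) e i j) le_rfl hy
  have hsnd : ∀ c d, pd c (pd d (fun z => G z a b)) y =
      ∑ e, ((pd c (christoffel G e d a) y * G y e b +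
        christoffel G e d a y * pd c (fun z => G z e b) y) +
        (pd c (christoffel G e d b) y * G y a e +
        christoffel G e d b y * pd c (fun z => G z a e) y)) := by
    intro c d
    rw [pd_congr_of_eqOn hG.isOpen hy fun z hz => hG.pd_metric hz d a b,
      pd_sum _ _ fun e _ => ((hΓ e d a).fun_mul (hd e b)).fun_add ((hΓ e d b).fun_mul (hd a e))]
    refine Finset.sum_congr rfl fun e _ => ?_
    rw [pd_add _ ((hΓ e d a).fun_mul (hd e b)) ((hΓ e d b).fun_mul (hd a e)), pd_mul _ (hΓ e d a) (hd e b),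
      pd_mul _ (hΓ e d b) (hd a e)]
  have hcomm := pd_pd_comm c d
    (((hG.contDiffOn a b).contDiffAt (hG.isOpen.mem_nhds hy)).of_le hm)
  rw [hsnd, hsnd] at hcomm
  simp only [hG.pd_metric hy] at hcomm
  simp only [riemann, Fin.sum_univ_three] at hcomm ⊢
  have hsb : ∀ e, G y e b = G y b e := fun e => hG.symm hy e b
  have s10 := hG.symm hy 1 0
  have s20 := hG.symm hy 2 0
  have s21 := hG.symm hy 2 1
  simp only [hsb, s10, s20, s21] at hcomm ⊢
  linear_combination hcomm

end Dim3

/-! ### Weak divergences: linearity and uniqueness. -/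

section WeakDivergence

variable {n : ℕ} {G : EucSp n → Matrix (Fin n) (Fin n) ℝ} {Ω : Set (EucSp n)}
  {Y Z : EucSp n → Fin n → ℝ} {f g : EucSp n → ℝ}

lemma IsWeakDivergenceOn.congr (h : IsWeakDivergenceOn G Ω Y f) (hY : Set.EqOn Y Z Ω)
    (hf : Set.EqOn f g Ω) : IsWeakDivergenceOn G Ω Z g := by
  refine ⟨h.1.congr hY.symm, h.2.1.congr hf.symm, fun φ hφ hc hs => ?_⟩
  have h1 : ∫ y, (∑ i, Z y i * pd i φ y) * volDensity G y =
      ∫ y, (∑ i, Y y i * pd i φ y) * volDensity G y := by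
    refine integral_congr_ae (Filter.Eventually.of_forall fun y => ?_)
    by_cases hy : y ∈ tsupport φ
    · simp only [hY (hs hy)]
    · have : ∀ k, pd k φ y = 0 := fun k =>
        image_eq_zero_of_notMem_tsupport fun h => hy (tsupport_pd_subset k φ h)
      simp [this]
  have h2 : ∫ y, g y * φ y * volDensity G y = ∫ y, f y * φ y * volDensity G y := by
    refine integral_congr_ae (Filter.Eventually.of_forall fun y => ?_)
    by_cases hy : y ∈ tsupport φ
    · simp only [hf (hs hy)]
    · simp [image_eq_zero_of_notMem_tsupport hy]
  rw [h1, h2, h.2.2 φ hφ hc hs]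

lemma integrable_flux (hΩ : IsOpen Ω) (hρ : ContinuousOn (volDensity G) Ω)
    (hY : ContinuousOn Y Ω) {φ : EucSp n → ℝ} (hφ : ContDiff ℝ ∞ φ) (hc : HasCompactSupport φ)
    (hs : tsupport φ ⊆ Ω) :
    Integrable fun y => (∑ i, Y y i * pd i φ y) * volDensity G y := by
  have : ∀ y, (∑ i, Y y i * pd i φ y) * volDensity G y =
      ∑ i, (Y y i * volDensity G y) * pd i φ y := fun y => by
    rw [Finset.sum_mul]
    exact Finset.sum_congr rfl fun i _ => by ring
  simp only [this]
  refine integrable_finsetSum _ fun i _ => integrable_mul_of_tsupport_subset hΩ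
    (((continuousOn_pi.1 hY) i).mul hρ) (contDiff_pd (m := 0) i hφ (by simp)).continuous
    (hc.mono' ((subset_tsupport _).trans (tsupport_pd_subset i _)))
    ((tsupport_pd_subset i _).trans hs)

lemma integrable_density (hΩ : IsOpen Ω) (hρ : ContinuousOn (volDensity G) Ω)
    (hf : ContinuousOn f Ω) {φ : EucSp n → ℝ} (hφ : ContDiff ℝ ∞ φ) (hc : HasCompactSupport φ)
    (hs : tsupport φ ⊆ Ω) : Integrable fun y => f y * φ y * volDensity G y := by
  have : ∀ y, f y * φ y * volDensity G y = (f y * volDensity G y) * φ y := fun y => by ring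
  simp only [this]
  exact integrable_mul_of_tsupport_subset hΩ (hf.mul hρ) hφ.continuous hc hs

lemma IsWeakDivergenceOn.add (hΩ : IsOpen Ω) (hρ : ContinuousOn (volDensity G) Ω)
    (h1 : IsWeakDivergenceOn G Ω Y f) (h2 : IsWeakDivergenceOn G Ω Z g) :
    IsWeakDivergenceOn G Ω (fun y i => Y y i + Z y i) (fun y => f y + g y) := by
  refine ⟨h1.1.add h2.1, h1.2.1.add h2.2.1, fun φ hφ hc hs => ?_⟩
  simp only [add_mul, Finset.sum_add_distrib]
  rw [integral_add (integrable_flux hΩ hρ h1.1 hφ hc hs) (integrable_flux hΩ hρ h2.1 hφ hc hs),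
    integral_add (integrable_density hΩ hρ h1.2.1 hφ hc hs)
      (integrable_density hΩ hρ h2.2.1 hφ hc hs), h1.2.2 φ hφ hc hs, h2.2.2 φ hφ hc hs]
  ring

lemma IsWeakDivergenceOn.const_mul (c : ℝ) (h : IsWeakDivergenceOn G Ω Y f) :
    IsWeakDivergenceOn G Ω (fun y i => c * Y y i) (fun y => c * f y) := by
  refine ⟨continuousOn_pi.2 fun i => continuousOn_const.mul (continuousOn_pi.1 h.1 i),
    continuousOn_const.mul h.2.1, fun φ hφ hc hs => ?_⟩
  have := h.2.2 φ hφ hc hs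
  simp only [mul_assoc, ← Finset.mul_sum, integral_const_mul] at this ⊢
  rw [this]
  ring

/-- Uniqueness of the weak divergence. -/
lemma IsWeakDivergenceOn.unique {Ω' : Set (EucSp n)} (h : IsWeakDivergenceOn G Ω Y f)
    (h' : IsWeakDivergenceOn G Ω' Y g) (hΩ' : Ω' ⊆ Ω) (ho : IsOpen Ω')
    (hρ : ContinuousOn (volDensity G) Ω') (hpos : ∀ y ∈ Ω', 0 < volDensity G y) :
    Set.EqOn g f Ω' := by
  have key : Set.EqOn (fun y => g y * volDensity G y) (fun y => f y * volDensity G y) Ω' := by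
    refine eqOn_of_integral_mul_eq ho (h'.2.1.mul hρ) ((h.2.1.mono hΩ').mul hρ)
      fun φ hφ hc hs => ?_
    have e1 := h.2.2 φ hφ hc (hs.trans hΩ')
    have e2 := h'.2.2 φ hφ hc hs
    rw [e1] at e2
    simp only [mul_right_comm _ (volDensity G _)]
    linarith
  exact fun y hy => mul_right_cancel₀ (hpos y hy).ne' (key hy)

end WeakDivergence

/-! ### Weak divergences of fields built from C¹ fields; the Weitzenböck identity. -/

section Dim3

variable {m : WithTop ℕ∞} {G : EucSp 3 → Matrix (Fin 3) (Fin 3) ℝ} {Ω : Set (EucSp 3)}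
  {y : EucSp 3}

/-- The covariant derivative `∇_i U^j` of a vector field. -/
def covDeriv (G : EucSp 3 → Matrix (Fin 3) (Fin 3) ℝ) (U : EucSp 3 → Fin 3 → ℝ) (i j : Fin 3)
    (y : EucSp 3) : ℝ :=
  pd i (fun z => U z j) y + ∑ k, christoffel G j i k y * U y k

lemma continuousOn_pd {f : EucSp 3 → ℝ} (hΩ : IsOpen Ω) (hf : ContDiffOn ℝ 1 f Ω) (i : Fin 3) :
    ContinuousOn (pd i f) Ω :=
  contDiffOn_zero.1 (contDiffOn_pd i hΩ hf (by simp))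

/-- A vector field of class `C¹` has its classical divergence as weak divergence. -/
lemma IsMetricOn.isWeakDivergenceOn_divergence (hG : IsMetricOn m G Ω) (hm : 1 ≤ m)
    {V : EucSp 3 → Fin 3 → ℝ} (hV : ∀ i, ContDiffOn ℝ 1 (fun z => V z i) Ω) :
    IsWeakDivergenceOn G Ω V (divergence G V) := by
  have hρ : ContDiffOn ℝ 1 (volDensity G) Ω := hG.contDiffOn_volDensity.of_le hm
  have hVc : ∀ i, ContinuousOn (fun z => V z i) Ω := fun i => (hV i).continuousOn
  have hΓ : ∀ i j k, ContinuousOn (christoffel G i j k) Ω := fun i j k =>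
    (hG.contDiffOn_christoffel (k := 0) (by simpa using hm) i j k).continuousOn
  have hρV : ∀ i, ContDiffOn ℝ 1 (fun z => V z i * volDensity G z) Ω := fun i => (hV i).mul hρ
  refine ⟨continuousOn_pi.2 hVc, ?_, fun φ hφ hc hs => ?_⟩
  · unfold divergence
    exact continuousOn_finsetSum _ fun i _ => (continuousOn_pd hG.isOpen (hV i) i).add
      (continuousOn_finsetSum _ fun j _ => (hΓ i i j).mul (hVc j))
  have hφ1 : ContDiff ℝ 1 φ := hφ.of_le (by simp)
  have e1 : ∀ y, (∑ i, V y i * pd i φ y) * volDensity G y =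
      ∑ i, (V y i * volDensity G y) * pd i φ y := fun y => by
    rw [Finset.sum_mul]
    exact Finset.sum_congr rfl fun i _ => by ring
  have hint : ∀ i, Integrable fun y => (V y i * volDensity G y) * pd i φ y := fun i =>
    integrable_mul_of_tsupport_subset hG.isOpen (hρV i).continuousOn
      (contDiff_pd (m := 0) i hφ (by simp)).continuous
      (hc.mono' ((subset_tsupport _).trans (tsupport_pd_subset i _)))
      ((tsupport_pd_subset i _).trans hs)
  have hint' : ∀ i, Integrable fun y => pd i (fun z => V z i * volDensity G z) y * φ y := fun i =>
    integrable_mul_of_tsupport_subset hG.isOpen (continuousOn_pd hG.isOpen (hρV i) i)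
      hφ.continuous hc hs
  simp only [e1]
  rw [integral_finsetSum _ fun i _ => hint i]
  simp only [integral_mul_pd _ hG.isOpen (hρV _) hφ1 hc hs]
  rw [Finset.sum_neg_distrib, ← integral_finsetSum _ fun i _ => hint' i]
  congr 1
  refine integral_congr_ae (Filter.Eventually.of_forall fun y => ?_)
  by_cases hy : y ∈ tsupport φ
  · have hyΩ := hs hy
    have hVd : ∀ i, DifferentiableAt ℝ (fun z => V z i) y := fun i =>
      differentiableAt_of_contDiffOn hG.isOpen (hV i) le_rfl hyΩ
    have hρd := differentiableAt_of_contDiffOn hG.isOpen hρ le_rfl hyΩ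
    simp only [fun i => pd_mul i (hVd i) hρd, hG.pd_volDensity hm hyΩ, divergence,
      Fin.sum_univ_three]
    ring
  · simp [image_eq_zero_of_notMem_tsupport hy]

/-- The weak divergence of `ν^j ∂_j U^i - ν^i ∂_j U^j`, for vector fields of class `C¹`. -/
lemma IsMetricOn.isWeakDivergenceOn_wedge (hG : IsMetricOn m G Ω) (hm : 1 ≤ m)
    {ν U : EucSp 3 → Fin 3 → ℝ} (hν : ∀ i, ContDiffOn ℝ 1 (fun z => ν z i) Ω)
    (hU : ∀ i, ContDiffOn ℝ 1 (fun z => U z i) Ω) :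
    IsWeakDivergenceOn G Ω
      (fun y i => ∑ j, (ν y j * pd j (fun z => U z i) y - ν y i * pd j (fun z => U z j) y))
      (fun y => ∑ i, ∑ j, (pd j (fun z => U z i) y *
          (pd i (fun z => ν z j) y + ν y j * ∑ a, christoffel G a a i y) -
        pd i (fun z => U z i) y *
          (pd j (fun z => ν z j) y + ν y j * ∑ a, christoffel G a a j y))) := by
  have hρ : ContDiffOn ℝ 1 (volDensity G) Ω := hG.contDiffOn_volDensity.of_le hm
  have hνc : ∀ i, ContinuousOn (fun z => ν z i) Ω := fun i => (hν i).continuousOn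
  have hΓ : ∀ i j k, ContinuousOn (christoffel G i j k) Ω := fun i j k =>
    (hG.contDiffOn_christoffel (k := 0) (by simpa using hm) i j k).continuousOn
  have hpU : ∀ i j, ContinuousOn (pd i (fun z => U z j)) Ω := fun i j =>
    continuousOn_pd hG.isOpen (hU j) i
  have hpν : ∀ i j, ContinuousOn (pd i (fun z => ν z j)) Ω := fun i j =>
    continuousOn_pd hG.isOpen (hν j) i
  have hρν : ∀ i, ContDiffOn ℝ 1 (fun z => ν z i * volDensity G z) Ω := fun i => (hν i).mul hρ
  refine ⟨continuousOn_pi.2 fun i => continuousOn_finsetSum _ fun j _ =>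
    ((hνc j).mul (hpU j i)).sub ((hνc i).mul (hpU j j)), ?_, fun φ hφ hc hs => ?_⟩
  · have hΓs : ∀ i, ContinuousOn (fun y => ∑ a, christoffel G a a i y) Ω := fun i =>
      continuousOn_finsetSum _ fun a _ => hΓ a a i
    exact continuousOn_finsetSum _ fun i _ => continuousOn_finsetSum _ fun j _ =>
      ((hpU j i).mul ((hpν i j).add ((hνc j).mul (hΓs i)))).sub
        ((hpU i i).mul ((hpν j j).add ((hνc j).mul (hΓs j))))
  have hpφ : ∀ i, Continuous (pd i φ) := fun i =>
    (contDiff_pd (m := 0) i hφ (by simp)).continuous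
  have hint0 : ∀ i j k l, Integrable fun y =>
      (ν y j * volDensity G y) * pd k (fun z => U z i) y * pd l φ y := fun i j k l =>
    integrable_mul_of_tsupport_subset hG.isOpen ((hρν j).continuousOn.mul (hpU k i)) (hpφ l)
      (hc.mono' ((subset_tsupport _).trans (tsupport_pd_subset l _)))
      ((tsupport_pd_subset l _).trans hs)
  have hint : ∀ i j, Integrable fun y => (ν y j * volDensity G y) *
      (pd j (fun z => U z i) y * pd i φ y - pd i (fun z => U z i) y * pd j φ y) := fun i j => by
    have := (hint0 i j j i).sub (hint0 i j i j)
    refine this.congr (Filter.Eventually.of_forall fun y => ?_)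
    simp only [Pi.sub_apply]
    ring
  have hint' : ∀ i j, Integrable fun y => (pd j (fun z => U z i) y *
      pd i (fun z => ν z j * volDensity G z) y -
      pd i (fun z => U z i) y * pd j (fun z => ν z j * volDensity G z) y) * φ y := fun i j =>
    integrable_mul_of_tsupport_subset hG.isOpen
      (((hpU j i).mul (continuousOn_pd hG.isOpen (hρν j) i)).sub
        ((hpU i i).mul (continuousOn_pd hG.isOpen (hρν j) j))) hφ.continuous hc hs
  -- Exchanging the names i and j in the second term exhibits each summand as a coefficient of dU^i
  -- ∧ dφ times the C¹ function ν^j √(det g), so that `integral_mul_wedge` applies.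
  have e1 : ∀ y, (∑ i, (∑ j, (ν y j * pd j (fun z => U z i) y -
      ν y i * pd j (fun z => U z j) y)) * pd i φ y) * volDensity G y =
      ∑ i, ∑ j, (ν y j * volDensity G y) *
        (pd j (fun z => U z i) y * pd i φ y - pd i (fun z => U z i) y * pd j φ y) := fun y => by
    simp only [Fin.sum_univ_three]
    ring
  simp only [e1]
  rw [integral_finsetSum _ fun i _ => integrable_finsetSum _ fun j _ => hint i j]
  simp only [integral_finsetSum _ fun j _ => hint _ j,
    integral_mul_wedge _ _ hG.isOpen (hρν _) (hU _) hφ hc hs, Finset.sum_neg_distrib]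
  simp only [← integral_finsetSum _ fun j _ => hint' _ j]
  rw [← integral_finsetSum _ fun i _ => integrable_finsetSum _ fun j _ => hint' i j]
  congr 1
  refine integral_congr_ae (Filter.Eventually.of_forall fun y => ?_)
  by_cases hy : y ∈ tsupport φ
  · have hyΩ := hs hy
    have hνd : ∀ i, DifferentiableAt ℝ (fun z => ν z i) y := fun i =>
      differentiableAt_of_contDiffOn hG.isOpen (hν i) le_rfl hyΩ
    have hρd := differentiableAt_of_contDiffOn hG.isOpen hρ le_rfl hyΩ
    simp only [fun i j => pd_mul i (hνd j) hρd, hG.pd_volDensity hm hyΩ, Finset.sum_mul]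
    refine Finset.sum_congr rfl fun i _ => Finset.sum_congr rfl fun j _ => ?_
    simp only [Fin.sum_univ_three]
    ring
  · simp [image_eq_zero_of_notMem_tsupport hy]

/-- The weak Weitzenböck identity: for vector fields `ν`, `U` of class `C¹`, the divergence of
`∇_ν U - (div U) ν` involves only first derivatives. -/
lemma IsMetricOn.isWeakDivergenceOn_covDeriv (hG : IsMetricOn m G Ω) (hm : 2 ≤ m)
    {ν U : EucSp 3 → Fin 3 → ℝ} (hν : ∀ i, ContDiffOn ℝ 1 (fun z => ν z i) Ω)
    (hU : ∀ i, ContDiffOn ℝ 1 (fun z => U z i) Ω) :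
    IsWeakDivergenceOn G Ω
      (fun y i => ∑ j, (ν y j * covDeriv G U j i y - ν y i * covDeriv G U j j y))
      (fun y => ∑ i, ∑ j, (covDeriv G ν i j y * covDeriv G U j i y -
        covDeriv G ν i i y * covDeriv G U j j y + ricci G y i j * ν y i * U y j)) := by
  have hm1 : (1 : WithTop ℕ∞) ≤ m := le_trans (by norm_num) hm
  have hΓ : ∀ i j k, ContDiffOn ℝ 1 (christoffel G i j k) Ω := fun i j k =>
    hG.contDiffOn_christoffel (k := 1) (by norm_num; exact hm) i j k
  -- The Christoffel part of the field is itself C¹ and has a classical divergence. Only the part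
  -- containing derivatives of U needs the wedge identity.
  set V : EucSp 3 → Fin 3 → ℝ := fun y i => ∑ j, ∑ k, (ν y j * christoffel G i j k y * U y k -
    ν y i * christoffel G j j k y * U y k) with hVdef
  have hV : ∀ i, ContDiffOn ℝ 1 (fun z => V z i) Ω := fun i => by
    simp only [hVdef]
    exact ContDiffOn.sum fun j _ => ContDiffOn.sum fun k _ =>
      (((hν j).mul (hΓ i j k)).mul (hU k)).sub (((hν i).mul (hΓ j j k)).mul (hU k))
  have h := (hG.isWeakDivergenceOn_wedge hm1 hν hU).add hG.isOpen
    hG.contDiffOn_volDensity.continuousOn (hG.isWeakDivergenceOn_divergence hm1 hV)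
  refine h.congr (fun y _ => ?_) (fun y hy => ?_)
  · funext i
    simp only [hVdef, covDeriv, Fin.sum_univ_three]
    ring
  · have hνd : ∀ i, DifferentiableAt ℝ (fun z => ν z i) y := fun i =>
      differentiableAt_of_contDiffOn hG.isOpen (hν i) le_rfl hy
    have hUd : ∀ i, DifferentiableAt ℝ (fun z => U z i) y := fun i =>
      differentiableAt_of_contDiffOn hG.isOpen (hU i) le_rfl hy
    have hΓd : ∀ i j k, DifferentiableAt ℝ (christoffel G i j k) y := fun i j k =>
      differentiableAt_of_contDiffOn hG.isOpen (hΓ i j k) le_rfl hy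
    have hprod : ∀ a b c d e (l : Fin 3),
        pd l (fun z => ν z a * christoffel G b c d z * U z e) y =
        pd l (fun z => ν z a) y * christoffel G b c d y * U y e +
        ν y a * pd l (christoffel G b c d) y * U y e +
        ν y a * christoffel G b c d y * pd l (fun z => U z e) y := fun a b c d e l => by
      rw [pd_mul l ((hνd a).fun_mul (hΓd b c d)) (hUd e), pd_mul l (hνd a) (hΓd b c d)]
      ring
    have hdiff : ∀ a b c d e,
        DifferentiableAt ℝ (fun z => ν z a * christoffel G b c d z * U z e) y :=
      fun a b c d e => ((hνd a).fun_mul (hΓd b c d)).fun_mul (hUd e)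
    have hVd : ∀ i l, pd l (fun z => V z i) y = ∑ j, ∑ k,
        (pd l (fun z => ν z j * christoffel G i j k z * U z k) y -
          pd l (fun z => ν z i * christoffel G j j k z * U z k) y) := fun i l => by
      simp only [hVdef]
      rw [pd_sum _ _ fun j _ => DifferentiableAt.fun_sum fun k _ =>
        (hdiff j i j k k).fun_sub (hdiff i j j k k)]
      refine Finset.sum_congr rfl fun j _ => ?_
      rw [pd_sum _ _ fun k _ => (hdiff j i j k k).fun_sub (hdiff i j j k k)]
      exact Finset.sum_congr rfl fun k _ => pd_sub _ (hdiff j i j k k) (hdiff i j j k k)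
    have hs : ∀ a (i j : Fin 3), christoffel G a i j y = christoffel G a j i y :=
      fun a i j => hG.christoffel_symm hy a i j
    have hsp : ∀ l a (i j : Fin 3), pd l (christoffel G a i j) y = pd l (christoffel G a j i) y :=
      fun l a i j => pd_congr_of_eqOn hG.isOpen hy fun z hz => hG.christoffel_symm hz a i j
    simp only [divergence, hVd, hprod, covDeriv, ricci, Matrix.of_apply]
    simp only [hVdef, Fin.sum_univ_three]
    -- A normal form for the lower indices, after which the identity with the Ricci term is
    -- polynomial.
    simp only [hs _ 1 0, hs _ 2 0, hs _ 2 1, hsp _ _ 1 0, hsp _ _ 2 0, hsp _ _ 2 1]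
    ring

end Dim3

/-! ### Linear algebra of covariant 2-tensors. -/

section LinearAlgebra

variable {n : ℕ}

/-- The inner product `⟨S, T⟩ = ∑ g^ia g^jb S_ij T_ab` of two covariant 2-tensors. -/
def ipT (A S T : Matrix (Fin n) (Fin n) ℝ) : ℝ :=
  ∑ i, ∑ j, ∑ a, ∑ b, A⁻¹ i a * A⁻¹ j b * S i j * T a b

lemma normSq_eq_ipT (A T : Matrix (Fin n) (Fin n) ℝ) : normSq A T = ipT A T T := rfl

lemma ipT_add_left (A S S' T : Matrix (Fin n) (Fin n) ℝ) :
    ipT A (S + S') T = ipT A S T + ipT A S' T := by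
  simp only [ipT, ← Finset.sum_add_distrib]
  refine Finset.sum_congr rfl fun i _ => Finset.sum_congr rfl fun j _ =>
    Finset.sum_congr rfl fun a _ => Finset.sum_congr rfl fun b _ => ?_
  simp only [Matrix.add_apply]
  ring

lemma ipT_smul_left (A S T : Matrix (Fin n) (Fin n) ℝ) (c : ℝ) :
    ipT A (c • S) T = c * ipT A S T := by
  simp only [ipT, Finset.mul_sum]
  refine Finset.sum_congr rfl fun i _ => Finset.sum_congr rfl fun j _ =>
    Finset.sum_congr rfl fun a _ => Finset.sum_congr rfl fun b _ => ?_
  simp only [Matrix.smul_apply, smul_eq_mul]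
  ring

lemma sum_comm_pairs (F : Fin n → Fin n → Fin n → Fin n → ℝ) :
    ∑ i, ∑ j, ∑ a, ∑ b, F i j a b = ∑ a, ∑ b, ∑ i, ∑ j, F i j a b := by
  have h1 : ∀ i, ∑ j, ∑ a, ∑ b, F i j a b = ∑ a, ∑ b, ∑ j, F i j a b := fun i => by
    rw [Finset.sum_comm]
    exact Finset.sum_congr rfl fun a _ => Finset.sum_comm
  simp only [h1]
  rw [Finset.sum_comm]
  exact Finset.sum_congr rfl fun a _ => Finset.sum_comm

lemma ipT_comm {A : Matrix (Fin n) (Fin n) ℝ} (hA : ∀ i j, A⁻¹ i j = A⁻¹ j i)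
    (S T : Matrix (Fin n) (Fin n) ℝ) : ipT A S T = ipT A T S := by
  unfold ipT
  rw [sum_comm_pairs]
  refine Finset.sum_congr rfl fun i _ => Finset.sum_congr rfl fun j _ =>
    Finset.sum_congr rfl fun a _ => Finset.sum_congr rfl fun b _ => ?_
  rw [hA a i, hA b j]
  ring

lemma tr_add (A S T : Matrix (Fin n) (Fin n) ℝ) : tr A (S + T) = tr A S + tr A T := by
  simp only [tr, ← Finset.sum_add_distrib, Matrix.add_apply, mul_add]

lemma tr_smul (A T : Matrix (Fin n) (Fin n) ℝ) (c : ℝ) : tr A (c • T) = c * tr A T := by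
  simp only [tr, Finset.mul_sum, Matrix.smul_apply, smul_eq_mul]
  exact Finset.sum_congr rfl fun i _ => Finset.sum_congr rfl fun j _ => by ring

lemma tr_self {A : Matrix (Fin n) (Fin n) ℝ} (hA : A * A⁻¹ = 1) (hs : ∀ i j, A⁻¹ i j = A⁻¹ j i) :
    tr A A = n := by
  have : ∀ i, ∑ j, A⁻¹ i j * A i j = 1 := fun i => by
    have := congrFun (congrFun hA i) i
    rw [Matrix.mul_apply, Matrix.one_apply_eq] at this
    rw [← this]
    exact Finset.sum_congr rfl fun j _ => by rw [hs i j]; ring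
  simp [tr, this]

lemma ipT_self_right {A : Matrix (Fin n) (Fin n) ℝ} (hA : A⁻¹ * A = 1)
    (hs : ∀ i j, A⁻¹ i j = A⁻¹ j i) (T : Matrix (Fin n) (Fin n) ℝ) :
    ipT A T A = tr A T := by
  simp only [ipT, tr]
  refine Finset.sum_congr rfl fun i _ => Finset.sum_congr rfl fun j _ => ?_
  have h1 : ∀ b, ∑ a, A⁻¹ i a * A a b = if i = b then 1 else 0 := fun b => by
    rw [← Matrix.mul_apply, hA, Matrix.one_apply]
  rw [Finset.sum_comm]
  have h2 : ∀ b, ∑ a, A⁻¹ i a * A⁻¹ j b * T i j * A a b =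
      if i = b then A⁻¹ j b * T i j else 0 := fun b => by
    have : ∑ a, A⁻¹ i a * A⁻¹ j b * T i j * A a b =
        (∑ a, A⁻¹ i a * A a b) * (A⁻¹ j b * T i j) := by
      rw [Finset.sum_mul]
      exact Finset.sum_congr rfl fun a _ => by ring
    rw [this, h1, ite_mul, one_mul, zero_mul]
  simp only [h2, Finset.sum_ite_eq, Finset.mem_univ, if_true]
  rw [hs]

/-- The covariant 2-tensor `p ⊗ q + q ⊗ p`. -/
def symProd (p q : Fin n → ℝ) : Matrix (Fin n) (Fin n) ℝ :=
  Matrix.of fun i j => p i * q j + p j * q i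

/-- Raising the index of a covector. -/
def raise (A : Matrix (Fin n) (Fin n) ℝ) (p : Fin n → ℝ) : Fin n → ℝ := fun i => ∑ j, A⁻¹ i j * p j

lemma tr_symProd {A : Matrix (Fin n) (Fin n) ℝ} (hs : ∀ i j, A⁻¹ i j = A⁻¹ j i) (p q : Fin n → ℝ) :
    tr A (symProd p q) = 2 * ∑ i, p i * raise A q i := by
  have h1 : ∑ i, p i * raise A q i = ∑ i, ∑ j, A⁻¹ i j * (p i * q j) := by
    simp only [raise, Finset.mul_sum]
    exact Finset.sum_congr rfl fun i _ => Finset.sum_congr rfl fun j _ => by ring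
  have h2 : ∑ i, p i * raise A q i = ∑ i, ∑ j, A⁻¹ i j * (p j * q i) := by
    rw [h1, Finset.sum_comm]
    exact Finset.sum_congr rfl fun i _ => Finset.sum_congr rfl fun j _ => by rw [hs]
  have h3 : tr A (symProd p q) =
      ∑ i, ∑ j, A⁻¹ i j * (p i * q j) + ∑ i, ∑ j, A⁻¹ i j * (p j * q i) := by
    simp only [tr, symProd, Matrix.of_apply, mul_add, Finset.sum_add_distrib]
  rw [h3, ← h1, ← h2]
  ring

/-- Symmetry of T makes the contributions of p ⊗ q and q ⊗ p equal. -/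
lemma ipT_symProd_right (A T : Matrix (Fin n) (Fin n) ℝ)
    (hT : ∀ i j, T i j = T j i) (p q : Fin n → ℝ) :
    ipT A T (symProd p q) = 2 * eval₂ T (raise A p) (raise A q) := by
  have h1 : ∑ i, ∑ j, ∑ a, ∑ b, A⁻¹ i a * A⁻¹ j b * T i j * (p a * q b) =
      eval₂ T (raise A p) (raise A q) := by
    simp only [eval₂, raise, Finset.mul_sum, Finset.sum_mul]
    refine Finset.sum_congr rfl fun i _ => Finset.sum_congr rfl fun j _ => ?_
    rw [Finset.sum_comm]
    exact Finset.sum_congr rfl fun a _ => Finset.sum_congr rfl fun b _ => by ring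
  have h2 : ∑ i, ∑ j, ∑ a, ∑ b, A⁻¹ i a * A⁻¹ j b * T i j * (p b * q a) =
      eval₂ T (raise A p) (raise A q) := by
    rw [← h1, Finset.sum_comm]
    refine Finset.sum_congr rfl fun i _ => Finset.sum_congr rfl fun j _ => ?_
    rw [Finset.sum_comm]
    exact Finset.sum_congr rfl fun a _ => Finset.sum_congr rfl fun b _ => by rw [hT j i]; ring
  have h3 : ipT A T (symProd p q) = ∑ i, ∑ j, ∑ a, ∑ b, A⁻¹ i a * A⁻¹ j b * T i j * (p a * q b) +
      ∑ i, ∑ j, ∑ a, ∑ b, A⁻¹ i a * A⁻¹ j b * T i j * (p b * q a) := by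
    simp only [ipT, symProd, Matrix.of_apply, mul_add, Finset.sum_add_distrib]
  rw [h3, h1, h2]
  ring

lemma normSq_eq_trace (A T : Matrix (Fin n) (Fin n) ℝ) :
    normSq A T = (A⁻¹.transpose * T * A⁻¹ * T.transpose).trace := by
  simp only [normSq, Matrix.trace, Matrix.diag_apply, Matrix.mul_apply, Matrix.transpose_apply]
  rw [sum_comm_pairs]
  refine Finset.sum_congr rfl fun a _ => Finset.sum_congr rfl fun b _ => ?_
  simp only [Finset.sum_mul]
  rw [Finset.sum_comm]
  exact Finset.sum_congr rfl fun i _ => Finset.sum_congr rfl fun j _ => by ring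

-- Writing A⁻¹ = Bᵀ B, the quadruple sum is the trace of C Cᵀ with C = B T Bᵀ.
open scoped MatrixOrder Matrix.Norms.L2Operator in
lemma normSq_nonneg {A : Matrix (Fin n) (Fin n) ℝ} (hA : A.PosDef)
    (T : Matrix (Fin n) (Fin n) ℝ) : 0 ≤ normSq A T := by
  obtain ⟨B, hB⟩ := CStarAlgebra.nonneg_iff_eq_star_mul_self.mp hA.inv.posSemidef.nonneg
  rw [Matrix.star_eq_conjTranspose, Matrix.conjTranspose_eq_transpose_of_trivial] at hB
  have h := (Matrix.posSemidef_self_mul_conjTranspose (B * T * B.transpose)).trace_nonneg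
  rw [Matrix.conjTranspose_eq_transpose_of_trivial] at h
  rw [normSq_eq_trace, hB]
  simp only [Matrix.transpose_mul, Matrix.transpose_transpose] at h ⊢
  simp only [Matrix.mul_assoc] at h ⊢
  rw [Matrix.trace_mul_comm]
  simpa only [Matrix.mul_assoc] using h

/-- Cauchy-Schwarz against the unit tensor X♭ ⊗ X♭, in the form that T - T(X,X) X♭ ⊗ X♭ has
nonnegative squared norm. -/
lemma sq_eval₂_le_normSq {A : Matrix (Fin n) (Fin n) ℝ} (hA : A.PosDef)
    (T : Matrix (Fin n) (Fin n) ℝ) {X : Fin n → ℝ} (hX : ip A X X = 1) :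
    (eval₂ T X X) ^ 2 ≤ normSq A T := by
  have hs : ∀ i j, A⁻¹ i j = A⁻¹ j i := fun i j => by
    simpa using hA.isHermitian.inv.apply j i
  have hinv : A⁻¹ * A = 1 := Matrix.nonsing_inv_mul _ hA.det_pos.ne'.isUnit
  set p : Fin n → ℝ := fun i => ∑ j, A i j * X j with hp
  set N : Matrix (Fin n) (Fin n) ℝ := Matrix.of fun i j => p i * p j with hN
  have hraise : ∀ i, ∑ j, A⁻¹ i j * p j = X i := fun i => by
    have : A⁻¹.mulVec (A.mulVec X) = X := by rw [Matrix.mulVec_mulVec, hinv, Matrix.one_mulVec]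
    exact congrFun this i
  have hTN : ∀ S, ipT A S N = eval₂ S X X := fun S => by
    simp only [ipT, eval₂, hN, Matrix.of_apply]
    refine Finset.sum_congr rfl fun i _ => Finset.sum_congr rfl fun j _ => ?_
    have : ∑ a, ∑ b, A⁻¹ i a * A⁻¹ j b * S i j * (p a * p b) =
        S i j * (∑ a, A⁻¹ i a * p a) * (∑ b, A⁻¹ j b * p b) := by
      simp only [Finset.mul_sum, Finset.sum_mul]
      rw [Finset.sum_comm]
      exact Finset.sum_congr rfl fun a _ => Finset.sum_congr rfl fun b _ => by ring
    rw [this, hraise, hraise]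
  have hNN : eval₂ N X X = 1 := by
    have hpX : ∑ i, p i * X i = 1 := by
      rw [← hX]
      simp only [hp, ip, Finset.sum_mul]
      exact Finset.sum_congr rfl fun i _ => Finset.sum_congr rfl fun j _ => by ring
    have : eval₂ N X X = (∑ i, p i * X i) * (∑ j, p j * X j) := by
      simp only [eval₂, hN, Matrix.of_apply, Finset.sum_mul, Finset.mul_sum]
      exact Finset.sum_congr rfl fun i _ => Finset.sum_congr rfl fun j _ => by ring
    rw [this, hpX, one_mul]
  have h0 := normSq_nonneg hA (T + (-(eval₂ T X X)) • N)
  rw [normSq_eq_ipT, ipT_add_left, ipT_smul_left, ipT_comm hs T, ipT_comm hs N, ipT_add_left,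
    ipT_add_left, ipT_smul_left, ipT_smul_left, hTN, ipT_comm hs N T, hTN, hTN, hNN] at h0
  rw [normSq_eq_ipT]
  nlinarith

end LinearAlgebra

/-! ### Gradients, Hessians and the weak Bochner formula. -/

section Functions

variable {m : WithTop ℕ∞} {G : EucSp 3 → Matrix (Fin 3) (Fin 3) ℝ} {Ω : Set (EucSp 3)}
  {y : EucSp 3} {u v : EucSp 3 → ℝ}

lemma gradLen_pos (h0 : gradLen G u y ≠ 0) : 0 < gradLen G u y :=
  lt_of_le_of_ne (Real.sqrt_nonneg _) h0.symm

namespace IsMetricOn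

variable (hG : IsMetricOn m G Ω)
include hG

lemma ip_grad (hy : y ∈ Ω) (u : EucSp 3 → ℝ) (X : Fin 3 → ℝ) :
    ip (G y) (grad G u y) X = ∑ i, pd i u y * X i := by
  have h : ∀ j, ∑ i, G y i j * grad G u y i = pd j u y := fun j => by
    have h1 : (G y).mulVec ((G y)⁻¹.mulVec fun i => pd i u y) = fun i => pd i u y := by
      rw [Matrix.mulVec_mulVec, hG.mul_inv hy, Matrix.one_mulVec]
    rw [← congrFun h1 j]
    simp only [Matrix.mulVec, dotProduct, grad]
    exact Finset.sum_congr rfl fun i _ => by rw [hG.symm hy i j]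
  simp only [ip]
  rw [Finset.sum_comm]
  simp only [← Finset.sum_mul, h]

lemma ip_nonneg (hy : y ∈ Ω) (X : Fin 3 → ℝ) : 0 ≤ ip (G y) X X := by
  have h := (hG.posDef y hy).posSemidef.dotProduct_mulVec_nonneg X
  refine h.trans_eq ?_
  simp only [ip, dotProduct, Matrix.mulVec, Finset.mul_sum, star_trivial]
  exact Finset.sum_congr rfl fun i _ => Finset.sum_congr rfl fun j _ => by ring

lemma gradLen_sq (hy : y ∈ Ω) (u : EucSp 3 → ℝ) :
    gradLen G u y ^ 2 = ∑ i, pd i u y * grad G u y i := by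
  rw [← hG.ip_grad hy, gradLen, len, Real.sq_sqrt (hG.ip_nonneg hy _)]

lemma contDiffOn_grad (hm : 1 ≤ m) (hu : ContDiffOn ℝ 2 u Ω) (i : Fin 3) :
    ContDiffOn ℝ 1 (fun z => grad G u z i) Ω :=
  ContDiffOn.sum fun j _ => ((hG.contDiffOn_inv i j).of_le hm).mul
    (contDiffOn_pd j hG.isOpen hu (by norm_num))

lemma hess_symm (hu : ContDiffOn ℝ 2 u Ω) (hy : y ∈ Ω) (i j : Fin 3) :
    hess G u y i j = hess G u y j i := by
  simp only [hess, Matrix.of_apply]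
  rw [pd_pd_comm i j (hu.contDiffAt (hG.isOpen.mem_nhds hy))]
  simp only [hG.christoffel_symm hy _ i j]

/-- Raising an index commutes with covariant differentiation, by `pd_inv`. -/
lemma covDeriv_grad (hm : 1 ≤ m) (hu : ContDiffOn ℝ 2 u Ω) (hy : y ∈ Ω) (i j : Fin 3) :
    covDeriv G (grad G u) i j y = ∑ k, (G y)⁻¹ j k * hess G u y i k := by
  have hA : ∀ a b, DifferentiableAt ℝ (fun z => (G z)⁻¹ a b) y := fun a b =>
    differentiableAt_of_contDiffOn hG.isOpen (hG.contDiffOn_inv a b) hm hy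
  have hp : ∀ a, DifferentiableAt ℝ (pd a u) y := fun a =>
    differentiableAt_of_contDiffOn hG.isOpen (contDiffOn_pd a hG.isOpen hu (m := 1) (by norm_num))
      le_rfl hy
  have h1 : pd i (fun z => grad G u z j) y = ∑ k, (pd i (fun z => (G z)⁻¹ j k) y * pd k u y +
      (G y)⁻¹ j k * pd i (pd k u) y) := by
    simp only [grad]
    rw [pd_sum _ _ fun k _ => (hA j k).fun_mul (hp k)]
    exact Finset.sum_congr rfl fun k _ => pd_mul _ (hA j k) (hp k)
  rw [covDeriv, h1]
  simp only [hG.pd_inv hm hy, hess, Matrix.of_apply, grad, Fin.sum_univ_three]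
  ring

lemma gradLen_eqOn (u : EucSp 3 → ℝ) :
    Set.EqOn (gradLen G u) (fun z => √(∑ i, pd i u z * grad G u z i)) Ω := fun z hz => by
  rw [gradLen, len, hG.ip_grad hz]

lemma contDiffOn_gradLen (hm : 1 ≤ m) (hu : ContDiffOn ℝ 2 u Ω) (h0 : ∀ z ∈ Ω, gradLen G u z ≠ 0) :
    ContDiffOn ℝ 1 (gradLen G u) Ω := by
  refine ContDiffOn.congr ?_ (hG.gradLen_eqOn u)
  refine (ContDiffOn.sum fun i _ => (contDiffOn_pd i hG.isOpen hu (by norm_num)).mul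
    (hG.contDiffOn_grad hm hu i)).sqrt fun z hz => ?_
  rw [← hG.gradLen_sq hz]
  exact pow_ne_zero 2 (h0 z hz)

lemma contDiffOn_unitNormal (hm : 1 ≤ m) (hu : ContDiffOn ℝ 2 u Ω)
    (h0 : ∀ z ∈ Ω, gradLen G u z ≠ 0) (i : Fin 3) :
    ContDiffOn ℝ 1 (fun z => unitNormal G u z i) Ω :=
  (hG.contDiffOn_grad hm hu i).div (hG.contDiffOn_gradLen hm hu h0) h0

lemma ip_unitNormal (hy : y ∈ Ω) (h0 : gradLen G u y ≠ 0) :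
    ip (G y) (unitNormal G u y) (unitNormal G u y) = 1 := by
  have h := hG.gradLen_sq hy u
  rw [← hG.ip_grad hy] at h
  have : ip (G y) (unitNormal G u y) (unitNormal G u y) =
      ip (G y) (grad G u y) (grad G u y) / gradLen G u y ^ 2 := by
    simp only [ip, unitNormal, Finset.sum_div]
    exact Finset.sum_congr rfl fun i _ => Finset.sum_congr rfl fun j _ => by field_simp
  rw [this, ← h, div_self (pow_ne_zero 2 h0)]

/-- Differentiate |∇u|² = ∂_j u ∇^j u. Both factors contribute the Hessian, and their Christoffel
terms cancel. The nonvanishing gradient makes the square root differentiable. -/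
lemma pd_gradLen (hm : 1 ≤ m) (hu : ContDiffOn ℝ 2 u Ω) (h0 : ∀ z ∈ Ω, gradLen G u z ≠ 0)
    (hy : y ∈ Ω) (i : Fin 3) :
    pd i (gradLen G u) y = ∑ j, hess G u y i j * unitNormal G u y j := by
  have hp : ∀ a, DifferentiableAt ℝ (pd a u) y := fun a =>
    differentiableAt_of_contDiffOn hG.isOpen (contDiffOn_pd a hG.isOpen hu (m := 1) (by norm_num))
      le_rfl hy
  have hg : ∀ a, DifferentiableAt ℝ (fun z => grad G u z a) y := fun a =>
    differentiableAt_of_contDiffOn hG.isOpen (hG.contDiffOn_grad hm hu a) le_rfl hy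
  have hne := h0 y hy
  have hpos := gradLen_pos hne
  have hsq := hG.gradLen_sq hy u
  have hcov : ∀ a, pd i (fun z => grad G u z a) y = ∑ k, (G y)⁻¹ a k * hess G u y i k -
      ∑ k, christoffel G a i k y * grad G u y k := fun a => by
    rw [← hG.covDeriv_grad hm hu hy, covDeriv]
    ring
  have hhess : ∀ a, pd i (pd a u) y = hess G u y i a + ∑ k, christoffel G k i a y * pd k u y :=
    fun a => by simp only [hess, Matrix.of_apply]; ring
  rw [pd_congr_of_eqOn hG.isOpen hy (hG.gradLen_eqOn u), pd_sqrt,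
    pd_sum _ _ fun k _ => (hp k).fun_mul (hg k)]
  · rw [← hsq, Real.sqrt_sq hpos.le]
    simp only [fun k => pd_mul i (hp k) (hg k), hcov, hhess, unitNormal]
    rw [div_eq_iff (by positivity)]
    have : ∀ j, hess G u y i j * (grad G u y j / gradLen G u y) =
      (hess G u y i j * grad G u y j) / gradLen G u y := fun j => by ring
    simp only [this, ← Finset.sum_div]
    rw [div_mul_eq_mul_div, eq_div_iff hne]
    have hinv : ∀ a b, (G y)⁻¹ a b = (G y)⁻¹ b a := hG.inv_symm hy
    simp only [grad, Fin.sum_univ_three]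
    rw [hinv 1 0, hinv 2 0, hinv 2 1]
    ring
  · exact DifferentiableAt.fun_sum fun k _ => (hp k).fun_mul (hg k)
  · rw [← hsq]
    exact pow_ne_zero 2 hne

lemma covDeriv_unitNormal (hm : 1 ≤ m) (hu : ContDiffOn ℝ 2 u Ω)
    (h0 : ∀ z ∈ Ω, gradLen G u z ≠ 0) (hy : y ∈ Ω) (i j : Fin 3) :
    covDeriv G (unitNormal G u) i j y = (covDeriv G (grad G u) i j y -
      unitNormal G u y j * pd i (gradLen G u) y) / gradLen G u y := by
  have hg : DifferentiableAt ℝ (fun z => grad G u z j) y :=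
    differentiableAt_of_contDiffOn hG.isOpen (hG.contDiffOn_grad hm hu j) le_rfl hy
  have hl : DifferentiableAt ℝ (gradLen G u) y :=
    differentiableAt_of_contDiffOn hG.isOpen (hG.contDiffOn_gradLen hm hu h0) le_rfl hy
  have hne := h0 y hy
  simp only [covDeriv, unitNormal]
  rw [pd_div i hg hl hne]
  simp only [Fin.sum_univ_three]
  field_simp
  ring

lemma lap_eq_sum_covDeriv (hm : 1 ≤ m) (hu : ContDiffOn ℝ 2 u Ω) (hy : y ∈ Ω) :
    lap G u y = ∑ i, covDeriv G (grad G u) i i y := by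
  simp only [hG.covDeriv_grad hm hu hy, lap, tr]

/-- By symmetry of the Hessian, its squared norm is the trace of the square of the endomorphism ∇∇u.
This is the form in which it appears in the Weitzenböck identity. -/
lemma normSq_hess (hm : 1 ≤ m) (hu : ContDiffOn ℝ 2 u Ω) (hy : y ∈ Ω) :
    normSq (G y) (hess G u y) =
      ∑ i, ∑ j, covDeriv G (grad G u) i j y * covDeriv G (grad G u) j i y := by
  simp only [hG.covDeriv_grad hm hu hy, normSq]
  refine Finset.sum_congr rfl fun i _ => ?_
  have : ∀ j, (∑ k, (G y)⁻¹ j k * hess G u y i k) * ∑ k, (G y)⁻¹ i k * hess G u y j k =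
      ∑ a, ∑ b, (G y)⁻¹ i a * (G y)⁻¹ j b * hess G u y i b * hess G u y j a := fun j => by
    rw [Finset.sum_mul_sum, Finset.sum_comm]
    exact Finset.sum_congr rfl fun a _ => Finset.sum_congr rfl fun b _ => by ring
  simp only [this]
  have hsw : ∀ F : Fin 3 → Fin 3 → Fin 3 → ℝ,
      ∑ j, ∑ a, ∑ b, F j a b = ∑ b, ∑ a, ∑ j, F j a b := fun F => by
    have h1 : ∀ j, ∑ a, ∑ b, F j a b = ∑ b, ∑ a, F j a b := fun j => Finset.sum_comm
    simp only [h1]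
    rw [Finset.sum_comm]
    exact Finset.sum_congr rfl fun b _ => Finset.sum_comm
  rw [hsw]
  refine Finset.sum_congr rfl fun j _ => Finset.sum_congr rfl fun a _ =>
    Finset.sum_congr rfl fun b _ => ?_
  rw [hG.inv_symm hy j b, hG.hess_symm hu hy a j]

lemma continuousOn_covDeriv (hm : 1 ≤ m) {V : EucSp 3 → Fin 3 → ℝ}
    (hV : ∀ i, ContDiffOn ℝ 1 (fun z => V z i) Ω) (i j : Fin 3) :
    ContinuousOn (covDeriv G V i j) Ω := by
  unfold covDeriv
  exact (continuousOn_pd hG.isOpen (hV j) i).add (continuousOn_finsetSum _ fun k _ =>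
    ((hG.contDiffOn_christoffel (k := 0) (by simpa using hm) j i k).continuousOn).mul
      (hV k).continuousOn)

lemma continuousOn_ricci (hm : 2 ≤ m) (i j : Fin 3) :
    ContinuousOn (fun z => ricci G z i j) Ω := by
  have hΓ : ∀ i j k, ContDiffOn ℝ 1 (christoffel G i j k) Ω := fun i j k =>
    hG.contDiffOn_christoffel (k := 1) (by norm_num; exact hm) i j k
  have hΓp : ∀ l i j k, ContinuousOn (pd l (christoffel G i j k)) Ω := fun l i j k =>
    continuousOn_pd hG.isOpen (hΓ i j k) l
  simp only [ricci, Matrix.of_apply]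
  exact (continuousOn_finsetSum _ fun a _ => (hΓp _ _ _ _).sub (hΓp _ _ _ _)).add
    (continuousOn_finsetSum _ fun a _ => continuousOn_finsetSum _ fun b _ =>
      ((hΓ _ _ _).continuousOn.mul (hΓ _ _ _).continuousOn).sub
        ((hΓ _ _ _).continuousOn.mul (hΓ _ _ _).continuousOn))

lemma continuousOn_scalarCurv (hm : 2 ≤ m) : ContinuousOn (scalarCurv G) Ω := by
  unfold scalarCurv tr
  exact continuousOn_finsetSum _ fun i _ => continuousOn_finsetSum _ fun j _ =>
    (hG.contDiffOn_inv i j).continuousOn.mul (hG.continuousOn_ricci hm i j)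

end IsMetricOn

/-- The Gaussian curvature of the level sets of `u`, given by the Gauss equation
`K = R/2 - Ric(ν,ν) + (H² - |A|²)/2`, where `H = div ν` and `|A|² = ∇_i ν^j ∇_j ν^i`. -/
def levelCurv (G : EucSp 3 → Matrix (Fin 3) (Fin 3) ℝ) (u : EucSp 3 → ℝ) (y : EucSp 3) : ℝ :=
  1 / 2 * scalarCurv G y - eval₂ (ricci G y) (unitNormal G u y) (unitNormal G u y) +
    1 / 2 * ∑ i, ∑ j, (covDeriv G (unitNormal G u) i i y * covDeriv G (unitNormal G u) j j y -
      covDeriv G (unitNormal G u) i j y * covDeriv G (unitNormal G u) j i y)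

lemma IsMetricOn.continuousOn_levelCurv (hG : IsMetricOn m G Ω) (hm : 2 ≤ m)
    (hu : ContDiffOn ℝ 2 u Ω) (h0 : ∀ z ∈ Ω, gradLen G u z ≠ 0) :
    ContinuousOn (levelCurv G u) Ω := by
  have hm1 : (1 : WithTop ℕ∞) ≤ m := le_trans (by norm_num) hm
  have hν := hG.contDiffOn_unitNormal hm1 hu h0
  have hc := hG.continuousOn_covDeriv hm1 hν
  unfold levelCurv eval₂
  refine ((continuousOn_const.mul (hG.continuousOn_scalarCurv hm)).sub
    (continuousOn_finsetSum _ fun i _ => continuousOn_finsetSum _ fun j _ =>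
      ((hG.continuousOn_ricci hm i j).mul (hν i).continuousOn).mul (hν j).continuousOn)).add
    (continuousOn_const.mul (continuousOn_finsetSum _ fun i _ => continuousOn_finsetSum _ fun j _ =>
      ((hc i i).mul (hc j j)).sub ((hc i j).mul (hc j i))))

/-- The weak Bochner formula: the divergence of `∇|∇u| - Δu ν` in terms of the curvature of the
level sets. -/
lemma IsMetricOn.isWeakDivergenceOn_bochner (hG : IsMetricOn m G Ω) (hm : 2 ≤ m)
    (hu : ContDiffOn ℝ 2 u Ω) (h0 : ∀ z ∈ Ω, gradLen G u z ≠ 0) :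
    IsWeakDivergenceOn G Ω
      (fun y i => grad G (gradLen G u) y i - lap G u y * unitNormal G u y i)
      (fun y => -levelCurv G u y * gradLen G u y + 1 / 2 * scalarCurv G y * gradLen G u y +
        (normSq (G y) (hess G u y) - lap G u y ^ 2) / (2 * gradLen G u y)) := by
  have hm1 : (1 : WithTop ℕ∞) ≤ m := le_trans (by norm_num) hm
  have hν := hG.contDiffOn_unitNormal hm1 hu h0
  -- The Weitzenböck identity with U = ∇u; the term ∇_ν U is ∇|∇u|, by `pd_gradLen` and symmetry of
  -- the Hessian.
  refine (hG.isWeakDivergenceOn_covDeriv hm hν (hG.contDiffOn_grad hm1 hu)).congr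
    (fun y hy => ?_) (fun y hy => ?_)
  · funext i
    have hH : ∀ i j, hess G u y i j = hess G u y j i := hG.hess_symm hu hy
    have e1 : grad G (gradLen G u) y i = ∑ j, unitNormal G u y j * covDeriv G (grad G u) j i y := by
      simp only [grad, hG.pd_gradLen hm1 hu h0 hy, hG.covDeriv_grad hm1 hu hy, Finset.mul_sum]
      rw [Finset.sum_comm]
      exact Finset.sum_congr rfl fun j _ => Finset.sum_congr rfl fun k _ => by
        rw [hH k j]; ring
    rw [e1, hG.lap_eq_sum_covDeriv hm1 hu hy, Finset.sum_mul, ← Finset.sum_sub_distrib]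
    exact Finset.sum_congr rfl fun j _ => by ring
  · have hne := h0 y hy
    have hgrad : ∀ i, grad G u y i = unitNormal G u y i * gradLen G u y := fun i => by
      rw [unitNormal, div_mul_cancel₀ _ hne]
    -- Here the derivative of |∇u| may remain an unknown covector: the terms quadratic in it cancel
    -- in H² - |A|², and those linear in it agree on both sides.
    simp only [levelCurv, hG.lap_eq_sum_covDeriv hm1 hu hy, hG.normSq_hess hm1 hu hy,
      hG.covDeriv_unitNormal hm1 hu h0 hy, hgrad, eval₂, Fin.sum_univ_three]
    field_simp
    ring

end Functions

/-! ### Classical divergences of the C¹ terms, and the algebra of the spacetime Hessians. -/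

section DivergenceIdentity

variable {m : WithTop ℕ∞} {G k : EucSp 3 → Matrix (Fin 3) (Fin 3) ℝ} {Ω : Set (EucSp 3)}
  {y : EucSp 3} {u v : EucSp 3 → ℝ}

lemma divergence_eq_sum_covDeriv (G : EucSp 3 → Matrix (Fin 3) (Fin 3) ℝ)
    (V : EucSp 3 → Fin 3 → ℝ) (y : EucSp 3) : divergence G V y = ∑ i, covDeriv G V i i y := rfl

lemma divergence_add {V W : EucSp 3 → Fin 3 → ℝ}
    (hV : ∀ i, DifferentiableAt ℝ (fun z => V z i) y)
    (hW : ∀ i, DifferentiableAt ℝ (fun z => W z i) y) :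
    divergence G (fun z i => V z i + W z i) y = divergence G V y + divergence G W y := by
  simp only [divergence, fun i => pd_add i (hV i) (hW i), Fin.sum_univ_three]
  ring

lemma divergence_mul {a : EucSp 3 → ℝ} {V : EucSp 3 → Fin 3 → ℝ} (ha : DifferentiableAt ℝ a y)
    (hV : ∀ i, DifferentiableAt ℝ (fun z => V z i) y) :
    divergence G (fun z i => a z * V z i) y =
      ∑ i, pd i a y * V y i + a y * divergence G V y := by
  simp only [divergence, fun i => pd_mul i ha (hV i), Fin.sum_univ_three]
  ring

namespace IsMetricOn

variable (hG : IsMetricOn m G Ω)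
include hG

lemma divergence_grad (hm : 1 ≤ m) (hu : ContDiffOn ℝ 2 u Ω) (hy : y ∈ Ω) :
    divergence G (grad G u) y = lap G u y := by
  rw [divergence_eq_sum_covDeriv, hG.lap_eq_sum_covDeriv hm hu hy]

lemma contDiffOn_tr (hm : 1 ≤ m) (hk : ∀ i j, ContDiffOn ℝ 1 (fun z => k z i j) Ω) :
    ContDiffOn ℝ 1 (fun z => tr (G z) (k z)) Ω :=
  ContDiffOn.sum fun i _ => ContDiffOn.sum fun j _ =>
    ((hG.contDiffOn_inv i j).of_le hm).mul (hk i j)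

/-- Since ∇g = 0, the trace part (tr k) g contributes only the differential of tr k. -/
lemma momentumDensity_eq (hm : 1 ≤ m) (hk : ∀ i j, ContDiffOn ℝ 1 (fun z => k z i j) Ω)
    (hy : y ∈ Ω) (j : Fin 3) :
    momentumDensity G k y j = ∑ l, ∑ i, (G y)⁻¹ l i * covDeriv₂ G k l i j y -
      pd j (fun z => tr (G z) (k z)) y := by
  have hGd : ∀ a b, DifferentiableAt ℝ (fun z => G z a b) y := fun a b =>
    differentiableAt_of_contDiffOn hG.isOpen (hG.contDiffOn a b) hm hy
  have hkd : ∀ a b, DifferentiableAt ℝ (fun z => k z a b) y := fun a b =>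
    differentiableAt_of_contDiffOn hG.isOpen (hk a b) le_rfl hy
  have hτ := differentiableAt_of_contDiffOn hG.isOpen (hG.contDiffOn_tr hm hk) le_rfl hy
  set τ : EucSp 3 → ℝ := fun z => tr (G z) (k z) with hτdef
  have hcov : ∀ l i, covDeriv₂ G (fun z => k z - tr (G z) (k z) • G z) l i j y =
      covDeriv₂ G k l i j y - pd l τ y * G y i j := fun l i => by
    have h1 : pd l (fun z => (k z - tr (G z) (k z) • G z) i j) y =
        pd l (fun z => k z i j) y - (pd l τ y * G y i j + τ y * pd l (fun z => G z i j) y) := by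
      rw [← pd_mul l hτ (hGd i j), ← pd_sub l (hkd i j) (hτ.fun_mul (hGd i j))]
      rfl
    simp only [covDeriv₂]
    rw [h1, hG.pd_metric hy]
    simp only [Matrix.sub_apply, Matrix.smul_apply, smul_eq_mul, Fin.sum_univ_three]
    ring
  have hinv : ∀ l, ∑ i, (G y)⁻¹ l i * G y i j = if l = j then 1 else 0 := fun l => by
    rw [← Matrix.mul_apply, hG.inv_mul hy, Matrix.one_apply]
  simp only [momentumDensity, hcov, mul_sub, Finset.sum_sub_distrib]
  congr 1
  have : ∀ l, ∑ i, (G y)⁻¹ l i * (pd l τ y * G y i j) = if l = j then pd l τ y else 0 := fun l => by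
    have : ∑ i, (G y)⁻¹ l i * (pd l τ y * G y i j) = pd l τ y * ∑ i, (G y)⁻¹ l i * G y i j := by
      rw [Finset.mul_sum]
      exact Finset.sum_congr rfl fun i _ => by ring
    rw [this, hinv, mul_ite, mul_one, mul_zero]
  simp [this]

lemma contDiffOn_contract (hm : 1 ≤ m) (hk : ∀ i j, ContDiffOn ℝ 1 (fun z => k z i j) Ω)
    {W : EucSp 3 → Fin 3 → ℝ} (hW : ∀ i, ContDiffOn ℝ 1 (fun z => W z i) Ω) (i : Fin 3) :
    ContDiffOn ℝ 1 (fun z => contract (G z) (k z) (W z) i) Ω :=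
  ContDiffOn.sum fun j _ => ContDiffOn.sum fun l _ =>
    (((hG.contDiffOn_inv i j).of_le hm).mul (hk j l)).mul (hW l)

/-- The product rule. The Christoffel symbols coming from the derivative of g⁻¹ and from the
divergence combine with those of ∇k and ∇W. -/
lemma divergence_contract (hm : 1 ≤ m) (hk : ∀ i j, ContDiffOn ℝ 1 (fun z => k z i j) Ω)
    {W : EucSp 3 → Fin 3 → ℝ} (hW : ∀ i, ContDiffOn ℝ 1 (fun z => W z i) Ω) (hy : y ∈ Ω) :
    divergence G (fun z i => contract (G z) (k z) (W z) i) y =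
      ∑ i, ∑ j, ∑ l, (G y)⁻¹ i j * (covDeriv₂ G k i j l y * W y l + k y j l * covDeriv G W i l y) := by
  have hA : ∀ a b, DifferentiableAt ℝ (fun z => (G z)⁻¹ a b) y := fun a b =>
    differentiableAt_of_contDiffOn hG.isOpen (hG.contDiffOn_inv a b) hm hy
  have hkd : ∀ a b, DifferentiableAt ℝ (fun z => k z a b) y := fun a b =>
    differentiableAt_of_contDiffOn hG.isOpen (hk a b) le_rfl hy
  have hWd : ∀ a, DifferentiableAt ℝ (fun z => W z a) y := fun a =>
    differentiableAt_of_contDiffOn hG.isOpen (hW a) le_rfl hy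
  have hpd : ∀ i, pd i (fun z => contract (G z) (k z) (W z) i) y = ∑ j, ∑ l,
      ((pd i (fun z => (G z)⁻¹ i j) y * k y j l + (G y)⁻¹ i j * pd i (fun z => k z j l) y) * W y l +
      (G y)⁻¹ i j * k y j l * pd i (fun z => W z l) y) := fun i => by
    simp only [contract]
    rw [pd_sum _ _ fun j _ => DifferentiableAt.fun_sum fun l _ =>
      ((hA i j).fun_mul (hkd j l)).fun_mul (hWd l)]
    refine Finset.sum_congr rfl fun j _ => ?_
    rw [pd_sum _ _ fun l _ => ((hA i j).fun_mul (hkd j l)).fun_mul (hWd l)]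
    refine Finset.sum_congr rfl fun l _ => ?_
    rw [pd_mul i ((hA i j).fun_mul (hkd j l)) (hWd l), pd_mul i (hA i j) (hkd j l)]
  have hs : ∀ a (i j : Fin 3), christoffel G a i j y = christoffel G a j i y :=
    fun a i j => hG.christoffel_symm hy a i j
  simp only [divergence, hpd]
  simp only [hG.pd_inv hm hy, covDeriv₂, covDeriv, contract, Fin.sum_univ_three]
  simp only [hs _ 1 0, hs _ 2 0, hs _ 2 1]
  ring

end IsMetricOn

lemma grad_sub (hu : DifferentiableAt ℝ u y) (hv : DifferentiableAt ℝ v y) (i : Fin 3) :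
    grad G (fun z => u z - v z) y i = grad G u y i - grad G v y i := by
  simp only [grad, fun j => pd_sub j hu hv, mul_sub, Finset.sum_sub_distrib]

lemma grad_add (hu : DifferentiableAt ℝ u y) (hv : DifferentiableAt ℝ v y) (i : Fin 3) :
    grad G (fun z => u z + v z) y i = grad G u y i + grad G v y i := by
  simp only [grad, fun j => pd_add j hu hv, mul_add, Finset.sum_add_distrib]

namespace IsMetricOn

variable (hG : IsMetricOn m G Ω)
include hG

/-- The divergence of `k(∇(u - v), ·) - tr(k) ∇(u - v)`. -/
lemma divergence_momentum (hm : 1 ≤ m) (hk : ∀ i j, ContDiffOn ℝ 1 (fun z => k z i j) Ω)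
    (hu : ContDiffOn ℝ 2 u Ω) (hv : ContDiffOn ℝ 2 v Ω) (hy : y ∈ Ω) :
    divergence G (fun z i => contract (G z) (k z) (fun l => grad G u z l - grad G v z l) i +
        (-tr (G z) (k z)) * (grad G u z i - grad G v z i)) y =
      ∑ j, momentumDensity G k y j * (grad G u y j - grad G v y j) +
      (ipT (G y) (k y) (hess G u y) - ipT (G y) (k y) (hess G v y)) -
      tr (G y) (k y) * (lap G u y - lap G v y) := by
  have hgu := hG.contDiffOn_grad hm hu
  have hgv := hG.contDiffOn_grad hm hv
  have hW : ∀ i, ContDiffOn ℝ 1 (fun z => (fun z l => grad G u z l - grad G v z l) z i) Ω :=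
    fun i => (hgu i).sub (hgv i)
  have hWd : ∀ i, DifferentiableAt ℝ (fun z => grad G u z i - grad G v z i) y := fun i =>
    differentiableAt_of_contDiffOn hG.isOpen (hW i) le_rfl hy
  have hτ := (differentiableAt_of_contDiffOn hG.isOpen (hG.contDiffOn_tr hm hk) le_rfl hy)
  have hcovW : ∀ i l, covDeriv G (fun z l => grad G u z l - grad G v z l) i l y =
      covDeriv G (grad G u) i l y - covDeriv G (grad G v) i l y := fun i l => by
    simp only [covDeriv]
    rw [pd_sub i (differentiableAt_of_contDiffOn hG.isOpen (hgu l) le_rfl hy)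
      (differentiableAt_of_contDiffOn hG.isOpen (hgv l) le_rfl hy)]
    simp only [Fin.sum_univ_three]
    ring
  have hdivW : divergence G (fun z l => grad G u z l - grad G v z l) y =
      lap G u y - lap G v y := by
    rw [divergence_eq_sum_covDeriv, hG.lap_eq_sum_covDeriv hm hu hy,
      hG.lap_eq_sum_covDeriv hm hv hy, ← Finset.sum_sub_distrib]
    exact Finset.sum_congr rfl fun i _ => hcovW i i
  rw [divergence_add (fun i => differentiableAt_of_contDiffOn hG.isOpen
      (hG.contDiffOn_contract hm hk hW i) le_rfl hy) (fun i => hτ.fun_neg.fun_mul (hWd i)),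
    hG.divergence_contract hm hk hW hy, divergence_mul hτ.fun_neg hWd, hdivW]
  -- For a gradient field W = ∇w, the contraction of k with ∇W is the inner product of k with the
  -- Hessian of w.
  have hk2 : ∀ w : EucSp 3 → ℝ, ContDiffOn ℝ 2 w Ω → ipT (G y) (k y) (hess G w y) =
      ∑ i, ∑ j, ∑ l, (G y)⁻¹ i j * (k y j l * covDeriv G (grad G w) i l y) := fun w hw => by
    simp only [hG.covDeriv_grad hm hw hy, ipT]
    rw [Finset.sum_comm]
    have : ∀ j i, ∑ a, ∑ b, (G y)⁻¹ i a * (G y)⁻¹ j b * k y i j * hess G w y a b =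
        ∑ a, ∑ b, (G y)⁻¹ a i * (k y i j * ((G y)⁻¹ j b * hess G w y a b)) := fun j i =>
      Finset.sum_congr rfl fun a _ => Finset.sum_congr rfl fun b _ => by
        rw [hG.inv_symm hy a i]; ring
    simp only [this, Finset.mul_sum]
    rw [Finset.sum_comm]
    have h3 : ∀ F : Fin 3 → Fin 3 → Fin 3 → ℝ,
        ∑ i, ∑ j, ∑ a, F i j a = ∑ a, ∑ i, ∑ j, F i j a := fun F => by
      have h1 : ∀ i, ∑ j, ∑ a, F i j a = ∑ a, ∑ j, F i j a := fun i => Finset.sum_comm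
      simp only [h1]
      exact Finset.sum_comm
    rw [h3]
  rw [hk2 u hu, hk2 v hv]
  simp only [hG.momentumDensity_eq hm hk hy, pd_neg, hcovW, Fin.sum_univ_three]
  ring

/-- The divergence of `(|∇u| ∇v + |∇v| ∇u) / (u + v)`. -/
lemma divergence_coupling (hm : 1 ≤ m) (hu : ContDiffOn ℝ 2 u Ω) (hv : ContDiffOn ℝ 2 v Ω)
    (hu0 : ∀ z ∈ Ω, gradLen G u z ≠ 0) (hv0 : ∀ z ∈ Ω, gradLen G v z ≠ 0)
    (hs : ∀ z ∈ Ω, u z + v z ≠ 0) (hy : y ∈ Ω) :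
    divergence G (fun z i => gradLen G u z / (u z + v z) * grad G v z i +
        gradLen G v z / (u z + v z) * grad G u z i) y =
      (eval₂ (hess G u y) (grad G u y) (grad G v y) / gradLen G u y + gradLen G u y * lap G v y +
        eval₂ (hess G v y) (grad G u y) (grad G v y) / gradLen G v y +
          gradLen G v y * lap G u y) / (u y + v y) -
      (gradLen G u y + gradLen G v y) * (gradLen G u y * gradLen G v y +
        ∑ i, pd i u y * grad G v y i) / (u y + v y) ^ 2 := by
  have hd : ∀ {w : EucSp 3 → ℝ}, ContDiffOn ℝ 2 w Ω → DifferentiableAt ℝ w y := fun hw =>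
    differentiableAt_of_contDiffOn hG.isOpen hw (by norm_num) hy
  have hg : ∀ {w : EucSp 3 → ℝ}, ContDiffOn ℝ 2 w Ω → ∀ i,
      DifferentiableAt ℝ (fun z => grad G w z i) y := fun hw i =>
    differentiableAt_of_contDiffOn hG.isOpen (hG.contDiffOn_grad hm hw i) le_rfl hy
  have hl : ∀ {w : EucSp 3 → ℝ}, ContDiffOn ℝ 2 w Ω → (∀ z ∈ Ω, gradLen G w z ≠ 0) →
      DifferentiableAt ℝ (gradLen G w) y := fun hw hw0 =>
    differentiableAt_of_contDiffOn hG.isOpen (hG.contDiffOn_gradLen hm hw hw0) le_rfl hy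
  have hsd : DifferentiableAt ℝ (fun z => u z + v z) y := (hd hu).fun_add (hd hv)
  have hsy := hs y hy
  have hq : ∀ {f s : EucSp 3 → ℝ}, DifferentiableAt ℝ f y → DifferentiableAt ℝ s y → s y ≠ 0 →
      DifferentiableAt ℝ (fun z => f z / s z) y := fun hf hs h => by
    simpa only [div_eq_mul_inv] using hf.fun_mul (hs.fun_inv h)
  have hq1 := hq (hl hu hu0) hsd hsy
  have hq2 := hq (hl hv hv0) hsd hsy
  have hune := hu0 y hy
  have hvne := hv0 y hy
  rw [divergence_add (fun i => hq1.fun_mul (hg hv i)) (fun i => hq2.fun_mul (hg hu i)),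
    divergence_mul hq1 (hg hv), divergence_mul hq2 (hg hu), hG.divergence_grad hm hu hy,
    hG.divergence_grad hm hv hy]
  simp only [fun i => pd_div i (hl hu hu0) hsd hsy, fun i => pd_div i (hl hv hv0) hsd hsy,
    fun i => pd_add i (hd hu) (hd hv)]
  have e1 : ∑ i, pd i (gradLen G u) y * grad G v y i =
      eval₂ (hess G u y) (grad G u y) (grad G v y) / gradLen G u y := by
    simp only [hG.pd_gradLen hm hu hu0 hy, eval₂, unitNormal, Finset.sum_div, Finset.sum_mul]
    rw [Finset.sum_comm]
    refine Finset.sum_congr rfl fun i _ => Finset.sum_congr rfl fun j _ => ?_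
    rw [hG.hess_symm hu hy j i]
    ring
  have e2 : ∑ i, pd i (gradLen G v) y * grad G u y i =
      eval₂ (hess G v y) (grad G u y) (grad G v y) / gradLen G v y := by
    simp only [hG.pd_gradLen hm hv hv0 hy, eval₂, unitNormal, Finset.sum_div, Finset.sum_mul]
    refine Finset.sum_congr rfl fun i _ => Finset.sum_congr rfl fun j _ => ?_
    ring
  have e3 : ∑ i, pd i v y * grad G u y i = ∑ i, pd i u y * grad G v y i := by
    simp only [grad, Finset.mul_sum]
    rw [Finset.sum_comm]
    refine Finset.sum_congr rfl fun i _ => Finset.sum_congr rfl fun j _ => ?_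
    rw [hG.inv_symm hy]
    ring
  have e4 := hG.gradLen_sq hy u
  have e5 := hG.gradLen_sq hy v
  have hsplit : ∀ (F S W : Fin 3 → ℝ) (a s : ℝ), ∑ i, (F i / s - a * S i / s ^ 2) * W i =
      (∑ i, F i * W i) / s - a * (∑ i, S i * W i) / s ^ 2 := fun F S W a s => by
    simp only [Fin.sum_univ_three]
    ring
  rw [hsplit, hsplit, e1, e2]
  simp only [add_mul, Finset.sum_add_distrib]
  rw [e3, ← e4, ← e5]
  field_simp
  ring

end IsMetricOn

lemma couplingTerm_eq (G : EucSp 3 → Matrix (Fin 3) (Fin 3) ℝ) (u v : EucSp 3 → ℝ) (y : EucSp 3) :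
    couplingTerm G u v y =
      (-((gradLen G u y * gradLen G v y + ip (G y) (grad G u y) (grad G v y)) / (u y + v y))) • G y +
      (1 / (u y + v y)) • symProd (fun i => pd i u y) (fun i => pd i v y) := by
  ext i j
  simp only [couplingTerm, symProd, Matrix.of_apply, Matrix.add_apply, Matrix.smul_apply,
    smul_eq_mul]
  ring

namespace IsMetricOn

variable (hG : IsMetricOn m G Ω)
include hG

/-- The pointwise algebraic part of the divergence identity, where `Q(S) = |S|² - (tr S)²`. -/
lemma normSq_sub_tr_sq (hy : y ∈ Ω) {S : Matrix (Fin 3) (Fin 3) ℝ}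
    {H : Matrix (Fin 3) (Fin 3) ℝ} (hH : ∀ i j, H i j = H j i) (hS : ∀ i j, S i j = S j i)
    (c : ℝ) (u v : EucSp 3 → ℝ) (hs : u y + v y ≠ 0) :
    let f := gradLen G u y
    let h := gradLen G v y
    let w := ∑ i, pd i u y * grad G v y i
    let s := u y + v y
    normSq (G y) (H + c • S + couplingTerm G u v y) -
        tr (G y) (H + c • S + couplingTerm G u v y) ^ 2 =
      (normSq (G y) H - tr (G y) H ^ 2) + c ^ 2 * (normSq (G y) S - tr (G y) S ^ 2) +
      2 * c * (ipT (G y) S H - tr (G y) S * tr (G y) H) +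
      (4 * f * h * tr (G y) H + 4 * eval₂ H (grad G u y) (grad G v y)) / s +
      c * (4 * f * h * tr (G y) S + 4 * eval₂ S (grad G u y) (grad G v y)) / s -
      4 * f * h * (f * h + w) / s ^ 2 := by
  intro f h w s
  have hsym := hG.inv_symm hy
  have hcomm := ipT_comm (A := G y) hsym
  set g : Matrix (Fin 3) (Fin 3) ℝ := G y with hg
  set P : Matrix (Fin 3) (Fin 3) ℝ := symProd (fun i => pd i u y) (fun i => pd i v y) with hP
  have hw : ip g (grad G u y) (grad G v y) = w := hG.ip_grad hy u _
  have htrg : tr g g = 3 := by simpa using tr_self (hG.mul_inv hy) hsym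
  have hTg : ∀ T, ipT g T g = tr g T := fun T => ipT_self_right (hG.inv_mul hy) hsym T
  have hTP : ∀ T : Matrix (Fin 3) (Fin 3) ℝ, (∀ i j, T i j = T j i) →
      ipT g T P = 2 * eval₂ T (grad G u y) (grad G v y) := fun T hT =>
    ipT_symProd_right g T hT _ _
  have htrP : tr g P = 2 * w := tr_symProd hsym _ _
  have hPP : ipT g P P = 2 * (w ^ 2 + f ^ 2 * h ^ 2) := by
    rw [hTP P fun i j => by simp only [hP, symProd, Matrix.of_apply]; ring]
    have e3 : ∑ i, pd i v y * grad G u y i = w := by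
      simp only [w, grad, Finset.mul_sum]
      rw [Finset.sum_comm]
      refine Finset.sum_congr rfl fun i _ => Finset.sum_congr rfl fun j _ => ?_
      rw [hG.inv_symm hy]
      ring
    have : eval₂ P (grad G u y) (grad G v y) =
        (∑ i, pd i u y * grad G u y i) * (∑ i, pd i v y * grad G v y i) +
        (∑ i, pd i v y * grad G u y i) * (∑ i, pd i u y * grad G v y i) := by
      simp only [eval₂, hP, symProd, Matrix.of_apply, Fin.sum_univ_three]
      ring
    rw [this, e3, ← hG.gradLen_sq hy, ← hG.gradLen_sq hy]
    ring
  have hgP : ipT g g P = 2 * w := by rw [hcomm, hTg, htrP]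
  rw [couplingTerm_eq, ← hg, ← hP, hw]
  set μ : ℝ := -((gradLen G u y * gradLen G v y + w) / (u y + v y)) with hμ
  -- Bilinear expansion in H, S, g and the symmetric product P; all pairings among g and P are now
  -- explicit in |∇u|, |∇v| and ⟨∇u,∇v⟩.
  have exp : ∀ T : Matrix (Fin 3) (Fin 3) ℝ,
      ipT g (H + c • S + (μ • g + (1 / (u y + v y)) • P)) T =
      ipT g H T + c * ipT g S T + (μ * ipT g g T + 1 / (u y + v y) * ipT g P T) := fun T => by
    simp only [ipT_add_left, ipT_smul_left]
  have hgH : ipT g g H = tr g H := by rw [hcomm, hTg]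
  have hgS : ipT g g S = tr g S := by rw [hcomm, hTg]
  have hgg : ipT g g g = 3 := by rw [hTg, htrg]
  rw [normSq_eq_ipT, exp, hcomm H, hcomm S, hcomm g, hcomm P, exp, exp, exp, exp]
  simp only [tr_add, tr_smul, htrg, htrP, hPP, hgP, hgH, hgS, hgg, hTg, hTP H hH, hTP S hS,
    hcomm P, hcomm H S, normSq_eq_ipT]
  rw [hμ]
  simp only [f, h, s] at hPP ⊢
  field_simp
  ring

end IsMetricOn

end DivergenceIdentity

/-! ### The divergence identity in a chart. -/

section ChartIdentity

variable {m : WithTop ℕ∞} {G k : EucSp 3 → Matrix (Fin 3) (Fin 3) ℝ} {Ω : Set (EucSp 3)}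
  {y : EucSp 3} {u v : EucSp 3 → ℝ} {a : ℝ}

namespace IsMetricOn

variable (hG : IsMetricOn m G Ω)
include hG

/-- For a unit vector ν one has |T(ν,ν)| ≤ |T|, and a² ≤ 1. -/
lemma hessTerms_nonneg (hy : y ∈ Ω) (ha : a ∈ Set.Icc (0 : ℝ) 1)
    (hu0 : gradLen G u y ≠ 0) (hv0 : gradLen G v y ≠ 0) : 0 ≤ hessTerms G k a u v y := by
  have key : ∀ (T : Matrix (Fin 3) (Fin 3) ℝ) {X : Fin 3 → ℝ}, ip (G y) X X = 1 →
      0 ≤ normSq (G y) T - (a * eval₂ T X X) ^ 2 := fun T X hX => by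
    have h := sq_eval₂_le_normSq (hG.posDef y hy) T hX
    have ha2 : a ^ 2 ≤ 1 := pow_le_one₀ ha.1 ha.2
    nlinarith [sq_nonneg (eval₂ T X X)]
  exact add_nonneg
    (div_nonneg (key _ (hG.ip_unitNormal hy hu0)) (gradLen_pos hu0).le)
    (div_nonneg (key _ (hG.ip_unitNormal hy hv0)) (gradLen_pos hv0).le)

/-- The divergence identity in a chart, in the sense of distributions. -/
lemma isWeakDivergenceOn_fieldY (hm : 2 ≤ m) (hk : ∀ i j, ContDiffOn ℝ 1 (fun z => k z i j) Ω)
    (hks : ∀ z ∈ Ω, ∀ i j, k z i j = k z j i)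
    (hu : ContDiffOn ℝ 2 u Ω) (hv : ContDiffOn ℝ 2 v Ω)
    (hu0 : ∀ z ∈ Ω, gradLen G u z ≠ 0) (hv0 : ∀ z ∈ Ω, gradLen G v z ≠ 0)
    (hs : ∀ z ∈ Ω, u z + v z ≠ 0)
    (hsu : ∀ z ∈ Ω, tr (G z) (hessPlus G k u v z) = a * hessPlusNormal G k u v z)
    (hsv : ∀ z ∈ Ω, tr (G z) (hessMinus G k u v z) = a * hessMinusNormal G k u v z) :
    IsWeakDivergenceOn G Ω (fieldY G k u v)
      (divRhs G k a u v (levelCurv G u) (levelCurv G v)) := by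
  have hm1 : (1 : WithTop ℕ∞) ≤ m := le_trans (by norm_num) hm
  have hρ := hG.contDiffOn_volDensity.continuousOn
  have hgu := hG.contDiffOn_grad hm1 hu
  have hgv := hG.contDiffOn_grad hm1 hv
  have hlu := hG.contDiffOn_gradLen hm1 hu hu0
  have hlv := hG.contDiffOn_gradLen hm1 hv hv0
  have hsc : ContDiffOn ℝ 1 (fun z => u z + v z) Ω :=
    (hu.of_le (by norm_num)).add (hv.of_le (by norm_num))
  have hmom := hG.isWeakDivergenceOn_divergence hm1
    (V := fun z i => contract (G z) (k z) (fun l => grad G u z l - grad G v z l) i +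
        (-tr (G z) (k z)) * (grad G u z i - grad G v z i))
    (fun i => (hG.contDiffOn_contract hm1 hk (fun l => (hgu l).sub (hgv l)) i).add
      ((hG.contDiffOn_tr hm1 hk).neg.mul ((hgu i).sub (hgv i))))
  have hcoup := hG.isWeakDivergenceOn_divergence hm1
    (V := fun z i => gradLen G u z / (u z + v z) * grad G v z i +
        gradLen G v z / (u z + v z) * grad G u z i)
    (fun i => ((hlu.div hsc hs).mul (hgv i)).add ((hlv.div hsc hs).mul (hgu i)))
  -- Y is twice the sum of the two Bochner fields and the momentum field, plus four times the
  -- coupling field.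
  have hsum := ((((hG.isWeakDivergenceOn_bochner hm hu hu0).const_mul 2).add hG.isOpen hρ
    ((hG.isWeakDivergenceOn_bochner hm hv hv0).const_mul 2)).add hG.isOpen hρ
    (hmom.const_mul 2)).add hG.isOpen hρ (hcoup.const_mul 4)
  refine hsum.congr (fun y hy => ?_) (fun y hy => ?_)
  · funext i
    have hd : ∀ {f : EucSp 3 → ℝ}, ContDiffOn ℝ 1 f Ω → DifferentiableAt ℝ f y := fun hf =>
      differentiableAt_of_contDiffOn hG.isOpen hf le_rfl hy
    have hsub := grad_sub (G := G) (hd (hu.of_le (by norm_num))) (hd (hv.of_le (by norm_num)))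
    have hsub' : grad G (fun z => u z - v z) y = fun l => grad G u y l - grad G v y l :=
      funext hsub
    simp only [fieldY, grad_add (hd hlu) (hd hlv), hsub', unitNormal]
    ring
  · have hf := hu0 y hy
    have hh := hv0 y hy
    have hsy := hs y hy
    have hQu := hG.normSq_sub_tr_sq hy (hG.hess_symm hu hy) (hks y hy) (gradLen G u y) u v hsy
    -- The opposite sign of k in ∇̄²₋ is the choice c = -|∇v|; the coupling term is the same for
    -- both Hessians.
    have hQv := hG.normSq_sub_tr_sq hy (hG.hess_symm hv hy) (hks y hy) (-gradLen G v y) u v hsy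
    have hminus : hess G v y + -gradLen G v y • k y + couplingTerm G u v y =
        hessMinus G k u v y := by
      rw [hessMinus, neg_smul, sub_eq_add_neg]
    have hplus : hess G u y + gradLen G u y • k y + couplingTerm G u v y = hessPlus G k u v y := rfl
    simp only [hplus, hminus] at hQu hQv
    -- This is the only use of the equations: each squared trace becomes the squared normal
    -- component times a².
    rw [hsu y hy] at hQu
    rw [hsv y hy] at hQv
    simp only [divRhs, hessTerms, hQu, hQv, matterTerms, energyDensity,
      hG.divergence_momentum hm1 hk hu hv hy, hG.divergence_coupling hm1 hu hv hu0 hv0 hs hy]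
    have hlap : ∀ w, tr (G y) (hess G w y) = lap G w y := fun _ => rfl
    simp only [hlap]
    field_simp
    ring

/-- The divergence identity in a chart, pointwise where the vector field is `C¹`. -/
lemma divergence_fieldY (hm : 2 ≤ m) {Y : EucSp 3 → Fin 3 → ℝ} {f : EucSp 3 → ℝ}
    (h : IsWeakDivergenceOn G Ω Y f) {Ω' : Set (EucSp 3)} (hΩ' : Ω' ⊆ Ω) (ho : IsOpen Ω')
    (hY : ContDiffOn ℝ 1 Y Ω') (hy : y ∈ Ω') : divergence G Y y = f y := by
  have hm1 : (1 : WithTop ℕ∞) ≤ m := le_trans (by norm_num) hm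
  have hG' := hG.mono hΩ' ho
  -- On Ω' the classical divergence is a weak divergence as well, and weak divergences are unique.
  exact h.unique (hG'.isWeakDivergenceOn_divergence hm1 fun i => contDiffOn_pi.1 hY i) hΩ' ho
    hG'.contDiffOn_volDensity.continuousOn (fun y hy => hG'.volDensity_pos hy) hy

end IsMetricOn

end ChartIdentity

/-! ### Adapted orthogonal frames. -/

section Frame

/-- An orthogonal frame `(e₁, e₂, e₃)` with `|e₁|² = λ`, `|e₂|² = 1/λ`, `|e₃| = 1`. -/
structure IsAdaptedFrame (A : Matrix (Fin 3) (Fin 3) ℝ) (lam : ℝ) (E Z N : Fin 3 → ℝ) : Prop where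
  pos : 0 < lam
  EE : ip A E E = lam
  ZZ : ip A Z Z = 1 / lam
  NN : ip A N N = 1
  ZE : ip A Z E = 0
  NE : ip A N E = 0
  NZ : ip A N Z = 0

variable {A : Matrix (Fin 3) (Fin 3) ℝ} {lam : ℝ} {E Z N : Fin 3 → ℝ}

lemma ip_comm (hA : ∀ i j, A i j = A j i) (X Y : Fin 3 → ℝ) : ip A X Y = ip A Y X := by
  simp only [ip]
  rw [Finset.sum_comm]
  exact Finset.sum_congr rfl fun i _ => Finset.sum_congr rfl fun j _ => by rw [hA j i]; ring

/-- Orthogonality says that the dual frame is a left inverse of the matrix with columns E, Z, N. For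
square matrices it is then a right inverse too. This resolution of the identity gives the formulas
below for traces, for the inverse metric and for components of vectors. -/
lemma IsAdaptedFrame.completeness (h : IsAdaptedFrame A lam E Z N) (hA : ∀ i j, A i j = A j i)
    (c e : Fin 3) :
    ∑ a, (E c * E a / lam + lam * (Z c * Z a) + N c * N a) * A a e = if c = e then 1 else 0 := by
  have hl := h.pos.ne'
  have EZ : ip A E Z = 0 := by rw [ip_comm hA, h.ZE]
  have EN : ip A E N = 0 := by rw [ip_comm hA, h.NE]
  have ZN : ip A Z N = 0 := by rw [ip_comm hA, h.NZ]
  set P : Matrix (Fin 3) (Fin 3) ℝ := Matrix.of fun a k => (![E, Z, N] k) a with hP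
  set Q : Matrix (Fin 3) (Fin 3) ℝ :=
    -- The weights are the reciprocal squared lengths of E, Z and N.
    Matrix.of fun k e => ![1 / lam, lam, 1] k * ∑ a, (![E, Z, N] k) a * A a e with hQ
  have hQP : Q * P = 1 := by
    have entry : ∀ k l, (Q * P) k l = ![1 / lam, lam, 1] k * ip A (![E, Z, N] k) (![E, Z, N] l) := by
      intro k l
      simp only [Matrix.mul_apply, hQ, hP, Matrix.of_apply, ip, Fin.sum_univ_three]
      ring
    ext k l
    rw [entry]
    fin_cases k <;> fin_cases l <;>
      simp [h.EE, h.ZZ, h.NN, h.ZE, h.NE, h.NZ, EZ, EN, ZN, hl]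
  have hPQ1 : P * Q = 1 := mul_eq_one_comm.mp hQP
  have hPQ := congrFun (congrFun hPQ1 c) e
  rw [Matrix.one_apply] at hPQ
  rw [← hPQ]
  simp only [Matrix.mul_apply, hQ, hP, Matrix.of_apply, Fin.sum_univ_three, Matrix.cons_val]
  field_simp
  ring

lemma IsAdaptedFrame.trace_eq (h : IsAdaptedFrame A lam E Z N) (hA : ∀ i j, A i j = A j i)
    (T : Fin 3 → Fin 3 → ℝ) :
    ∑ i, T i i = ip A E (fun e => ∑ c, T e c * E c) / lam +
      lam * ip A Z (fun e => ∑ c, T e c * Z c) + ip A N (fun e => ∑ c, T e c * N c) := by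
  have hC := h.completeness hA
  have h1 : ∑ i, T i i = ∑ e, ∑ c, T e c * (if c = e then 1 else 0) := by simp
  rw [h1]
  simp only [← hC, ip, Fin.sum_univ_three]
  ring

lemma IsAdaptedFrame.inv_eq (h : IsAdaptedFrame A lam E Z N) (hA : ∀ i j, A i j = A j i)
    (hA1 : A * A⁻¹ = 1) (i j : Fin 3) :
    A⁻¹ i j = E i * E j / lam + lam * (Z i * Z j) + N i * N j := by
  set B : Matrix (Fin 3) (Fin 3) ℝ :=
    Matrix.of fun i j => E i * E j / lam + lam * (Z i * Z j) + N i * N j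
  have hB : B * A = 1 := by
    ext c e
    rw [Matrix.mul_apply, Matrix.one_apply, ← h.completeness hA c e]
    rfl
  have : A⁻¹ = B := by
    calc A⁻¹ = B * A * A⁻¹ := by rw [hB, Matrix.one_mul]
      _ = B := by rw [Matrix.mul_assoc, hA1, Matrix.mul_one]
  rw [this]
  rfl

lemma IsAdaptedFrame.expand (h : IsAdaptedFrame A lam E Z N) (hA : ∀ i j, A i j = A j i)
    (X : Fin 3 → ℝ) (c : Fin 3) :
    X c = ip A E X / lam * E c + lam * ip A Z X * Z c + ip A N X * N c := by
  have h1 : X c = ∑ e, X e * (if c = e then 1 else 0) := by simp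
  rw [h1]
  simp only [← h.completeness hA, ip, Fin.sum_univ_three]
  ring

lemma ip_linear_combination (V : Fin 3 → ℝ) {a b c : ℝ} {p q r s : Fin 3 → ℝ}
    (hs : ∀ e, s e = a * p e + b * q e + c * r e) :
    ip A V s = a * ip A V p + b * ip A V q + c * ip A V r := by
  simp only [ip, hs, Fin.sum_univ_three]
  ring

lemma IsAdaptedFrame.parseval (h : IsAdaptedFrame A lam E Z N) (hA : ∀ i j, A i j = A j i)
    (X Y : Fin 3 → ℝ) :
    ip A X Y = ip A X E * ip A Y E / lam + lam * (ip A X Z * ip A Y Z) + ip A X N * ip A Y N := by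
  rw [ip_linear_combination X (h.expand hA Y), ip_comm hA Y E, ip_comm hA Y Z, ip_comm hA Y N]
  ring

/-- The second elementary symmetric function of an endomorphism with image orthogonal to `N`. -/
lemma IsAdaptedFrame.sigma_two (h : IsAdaptedFrame A lam E Z N) (hA : ∀ i j, A i j = A j i)
    (W : Fin 3 → Fin 3 → ℝ)
    (hN : ∀ X : Fin 3 → ℝ, ip A N (fun e => ∑ c, W c e * X c) = 0) :
    1 / 2 * ∑ i, ∑ j, (W i i * W j j - W i j * W j i) =
      ip A E (fun e => ∑ c, W c e * E c) * ip A Z (fun e => ∑ c, W c e * Z c) -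
      ip A E (fun e => ∑ c, W c e * Z c) * ip A Z (fun e => ∑ c, W c e * E c) := by
  have hl := h.pos.ne'
  have t1 := h.trace_eq hA (fun e c => W c e)
  have t2 := h.trace_eq hA (fun e c => ∑ b, W b e * W c b)
  simp only [hN, add_zero] at t1
  set S : (Fin 3 → ℝ) → (Fin 3 → ℝ) := fun X e => ∑ c, W c e * X c with hS
  have hSS : ∀ X : Fin 3 → ℝ, (fun e => ∑ c, (∑ b, W b e * W c b) * X c) = S (S X) := fun X => by
    funext e
    simp only [hS, Fin.sum_univ_three]
    ring
  have hadd : ∀ (V X : Fin 3 → ℝ), ip A V (S X) =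
      ip A E X / lam * ip A V (S E) + lam * ip A Z X * ip A V (S Z) + ip A N X * ip A V (S N) := by
    intro V X
    have hSX : ∀ e, S X e =
        ip A E X / lam * S E e + lam * ip A Z X * S Z e + ip A N X * S N e := fun e => by
      simp only [hS, Finset.mul_sum, ← Finset.sum_add_distrib]
      refine Finset.sum_congr rfl fun c _ => ?_
      conv_lhs => rw [h.expand hA X c]
      ring
    exact ip_linear_combination V hSX
  have hNS : ∀ X, ip A N (S X) = 0 := hN
  simp only [hSS, hNS, add_zero, hadd E (S E), hadd Z (S Z)] at t2
  have e1 : ∑ i, ∑ j, (W i i * W j j - W i j * W j i) =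
      (∑ i, W i i) ^ 2 - ∑ i, ∑ b, W b i * W i b := by
    simp only [Fin.sum_univ_three]
    ring
  rw [e1, t1, t2]
  change 1 / 2 * ((ip A E (S E) / lam + lam * ip A Z (S Z)) ^ 2 - _) =
    ip A E (S E) * ip A Z (S Z) - ip A E (S Z) * ip A Z (S E)
  field_simp
  ring

end Frame

/-! ### The Riemann tensor in an adapted frame. -/

section Curvature

variable {m : WithTop ℕ∞} {G : EucSp 3 → Matrix (Fin 3) (Fin 3) ℝ} {Ω : Set (EucSp 3)}
  {y : EucSp 3}

/-- The Riemann tensor as a quadrilinear form. -/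
def riemannForm (G : EucSp 3 → Matrix (Fin 3) (Fin 3) ℝ) (y : EucSp 3)
    (P Q R S : Fin 3 → ℝ) : ℝ :=
  ip (G y) P (fun e => ∑ b, ∑ c, ∑ d, riemann G e b c d y * Q b * R c * S d)

lemma riemannForm_swap_right (P Q R S : Fin 3 → ℝ) :
    riemannForm G y P Q R S = -riemannForm G y P Q S R := by
  have h : ∀ e, ∑ b, ∑ c, ∑ d, riemann G e b c d y * Q b * R c * S d =
      -∑ b, ∑ c, ∑ d, riemann G e b c d y * Q b * S c * R d := fun e => by
    simp only [← Finset.sum_neg_distrib]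
    refine Finset.sum_congr rfl fun b _ => ?_
    rw [Finset.sum_comm]
    exact Finset.sum_congr rfl fun c _ => Finset.sum_congr rfl fun d _ => by
      rw [riemann_antisymm_right G y e b d c]; ring
  simp only [riemannForm, h, ip, mul_neg, Finset.sum_neg_distrib]

lemma IsMetricOn.riemannForm_swap_left (hG : IsMetricOn m G Ω) (hm : 2 ≤ m) (hy : y ∈ Ω)
    (P Q R S : Fin 3 → ℝ) : riemannForm G y P Q R S = -riemannForm G y Q P R S := by
  have h : ∀ P Q, riemannForm G y P Q R S =
      ∑ a, ∑ b, ∑ c, ∑ d, (∑ e, G y a e * riemann G e b c d y) * (P a * Q b * R c * S d) :=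
    fun P Q => by
      simp only [riemannForm, ip]
      refine Finset.sum_congr rfl fun a _ => ?_
      have h1 : ∀ e, G y a e * P a * ∑ b, ∑ c, ∑ d, riemann G e b c d y * Q b * R c * S d =
          ∑ b, ∑ c, ∑ d, G y a e * riemann G e b c d y * (P a * Q b * R c * S d) := fun e => by
        simp only [Finset.mul_sum]
        exact Finset.sum_congr rfl fun b _ => Finset.sum_congr rfl fun c _ =>
          Finset.sum_congr rfl fun d _ => by ring
      simp only [h1, Finset.sum_mul]
      rw [Finset.sum_comm]
      refine Finset.sum_congr rfl fun b _ => ?_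
      rw [Finset.sum_comm]
      exact Finset.sum_congr rfl fun c _ => Finset.sum_comm
  rw [h, h, Finset.sum_comm]
  simp only [← Finset.sum_neg_distrib]
  refine Finset.sum_congr rfl fun a _ => Finset.sum_congr rfl fun b _ =>
    Finset.sum_congr rfl fun c _ => Finset.sum_congr rfl fun d _ => ?_
  rw [hG.riemann_antisymm_left hm hy b a c d]
  ring

lemma eval₂_ricci_eq (hG : IsMetricOn m G Ω) (hy : y ∈ Ω) {lam : ℝ} {E Z N : Fin 3 → ℝ}
    (h : IsAdaptedFrame (G y) lam E Z N) (V : Fin 3 → ℝ) :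
    eval₂ (ricci G y) V V = riemannForm G y E V E V / lam + lam * riemannForm G y Z V Z V +
      riemannForm G y N V N V := by
  have t := h.trace_eq (hG.symm hy) (fun e c => ∑ b, ∑ d, riemann G e b c d y * V b * V d)
  have e1 : eval₂ (ricci G y) V V = ∑ i, ∑ b, ∑ d, riemann G i b i d y * V b * V d := by
    simp only [eval₂, ricci_eq_sum_riemann, Fin.sum_univ_three]
    ring
  have e2 : ∀ F : Fin 3 → ℝ, (fun e => ∑ c, (∑ b, ∑ d, riemann G e b c d y * V b * V d) * F c) =
      fun e => ∑ b, ∑ c, ∑ d, riemann G e b c d y * V b * F c * V d := fun F => by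
    funext e
    simp only [Fin.sum_univ_three]
    ring
  rw [e1, t]
  simp only [e2, riemannForm]

/-- R/2 is the sum of the sectional curvatures of the three frame planes, and Ric(N,N) is the sum of
the two whose plane contains N. Since |E| |Z| = 1, the remaining one needs no normalizing factor. -/
lemma IsMetricOn.sectional_eq (hG : IsMetricOn m G Ω) (hm : 2 ≤ m) (hy : y ∈ Ω) {lam : ℝ}
    {E Z N : Fin 3 → ℝ} (h : IsAdaptedFrame (G y) lam E Z N) :
    1 / 2 * scalarCurv G y - eval₂ (ricci G y) N N = riemannForm G y Z E Z E := by
  have hR : scalarCurv G y = eval₂ (ricci G y) E E / lam + lam * eval₂ (ricci G y) Z Z +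
      eval₂ (ricci G y) N N := by
    simp only [scalarCurv, tr, h.inv_eq (hG.symm hy) (hG.mul_inv hy), eval₂, Fin.sum_univ_three]
    ring
  have hl := h.pos.ne'
  have hdiag : ∀ V R S, riemannForm G y V V R S = 0 := fun V R S => by
    have := hG.riemannForm_swap_left hm hy V V R S
    linarith
  have hsw : ∀ V W, riemannForm G y V W V W = riemannForm G y W V W V := fun V W => by
    rw [hG.riemannForm_swap_left hm hy V W V W, riemannForm_swap_right W V V W, neg_neg]
  rw [hR]
  simp only [eval₂_ricci_eq hG hy h, hdiag]
  rw [hsw E Z, hsw E N, hsw Z N]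
  field_simp
  ring

end Curvature

/-! ### Parametrized surfaces: induced metric and connection form. -/

section AlongMap

/-- The components of the vector `∂_i X`. -/
def tang (X : EucSp 2 → EucSp 3) (i : Fin 2) (x : EucSp 2) : Fin 3 → ℝ :=
  fun a => pd i (fun z => X z a) x

/-- The metric induced by `G` via the map `X`. -/
def pullback (G : EucSp 3 → Matrix (Fin 3) (Fin 3) ℝ) (X : EucSp 2 → EucSp 3) (x : EucSp 2) :
    Matrix (Fin 2) (Fin 2) ℝ :=
  Matrix.of fun i j => ip (G (X x)) (tang X i x) (tang X j x)

/-- The covariant derivative in the direction `∂_b X` of a vector field along `X`. -/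
def covAlong (G : EucSp 3 → Matrix (Fin 3) (Fin 3) ℝ) (X : EucSp 2 → EucSp 3) (b : Fin 2)
    (V : EucSp 2 → Fin 3 → ℝ) (x : EucSp 2) : Fin 3 → ℝ :=
  fun a => pd b (fun z => V z a) x + ∑ c, ∑ d, christoffel G a c d (X x) * tang X b x c * V x d

variable {m : WithTop ℕ∞} {G : EucSp 3 → Matrix (Fin 3) (Fin 3) ℝ} {Ω : Set (EucSp 3)}
  {U : Set (EucSp 2)} {X : EucSp 2 → EucSp 3} {x : EucSp 2}

lemma contDiffOn_coord {k : WithTop ℕ∞} (hX : ContDiffOn ℝ k X U) (a : Fin 3) :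
    ContDiffOn ℝ k (fun z => X z a) U :=
  (contDiffOn_piLp 2).1 hX a

lemma contDiffOn_tang (hU : IsOpen U) (hX : ContDiffOn ℝ 2 X U) (i : Fin 2) (a : Fin 3) :
    ContDiffOn ℝ 1 (fun z => tang X i z a) U :=
  contDiffOn_pd i hU (contDiffOn_coord hX a) (by norm_num)

lemma differentiableAt_map (hU : IsOpen U) (hX : ContDiffOn ℝ 2 X U) (hx : x ∈ U) :
    DifferentiableAt ℝ X x :=
  (hX.contDiffAt (hU.mem_nhds hx)).differentiableAt (by norm_num)

namespace IsMetricOn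

variable (hG : IsMetricOn m G Ω)
include hG

/-- Metric compatibility for fields along a map; used below to differentiate the frame relations. -/
lemma pd_ip (hm : 1 ≤ m) (hXd : DifferentiableAt ℝ X x) (hx : X x ∈ Ω)
    {V W : EucSp 2 → Fin 3 → ℝ} (hV : ∀ a, DifferentiableAt ℝ (fun z => V z a) x)
    (hW : ∀ a, DifferentiableAt ℝ (fun z => W z a) x) (b : Fin 2) :
    pd b (fun z => ip (G (X z)) (V z) (W z)) x =
      ip (G (X x)) (covAlong G X b V x) (W x) + ip (G (X x)) (V x) (covAlong G X b W x) := by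
  have hGd : ∀ i j, DifferentiableAt ℝ (fun z => G z i j) (X x) := fun i j =>
    differentiableAt_of_contDiffOn hG.isOpen (hG.contDiffOn i j) hm hx
  have hGX : ∀ i j, DifferentiableAt ℝ (fun z => G (X z) i j) x := fun i j =>
    (hGd i j).comp x hXd
  have h1 : pd b (fun z => ip (G (X z)) (V z) (W z)) x = ∑ i, ∑ j,
      ((pd b (fun z => G (X z) i j) x * V x i + G (X x) i j * pd b (fun z => V z i) x) * W x j +
        G (X x) i j * V x i * pd b (fun z => W z j) x) := by
    simp only [ip]
    rw [pd_sum _ _ fun i _ => DifferentiableAt.fun_sum fun j _ =>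
      ((hGX i j).fun_mul (hV i)).fun_mul (hW j)]
    refine Finset.sum_congr rfl fun i _ => ?_
    rw [pd_sum _ _ fun j _ => ((hGX i j).fun_mul (hV i)).fun_mul (hW j)]
    refine Finset.sum_congr rfl fun j _ => ?_
    rw [pd_mul b ((hGX i j).fun_mul (hV i)) (hW j), pd_mul b (hGX i j) (hV i)]
  have h2 : ∀ i j, pd b (fun z => G (X z) i j) x = ∑ c, (∑ e,
      (christoffel G e c i (X x) * G (X x) e j + christoffel G e c j (X x) * G (X x) i e)) *
        tang X b x c := fun i j => by
    rw [pd_comp_map b (f := fun z => G z i j) (hGd i j) hXd]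
    refine Finset.sum_congr rfl fun c _ => ?_
    rw [hG.pd_metric hx]
    rfl
  rw [h1]
  simp only [h2, ip, covAlong, Fin.sum_univ_three]
  ring

/-- Torsion-freeness: the second derivatives of X and the Christoffel symbols are both symmetric. -/
lemma covAlong_tang_comm (hU : IsOpen U) (hX : ContDiffOn ℝ 2 X U) (hx : x ∈ U)
    (hxΩ : X x ∈ Ω) (i j : Fin 2) :
    covAlong G X i (tang X j) x = covAlong G X j (tang X i) x := by
  funext a
  have h1 : pd i (fun z => tang X j z a) x = pd j (fun z => tang X i z a) x :=
    pd_pd_comm i j ((contDiffOn_coord hX a).contDiffAt (hU.mem_nhds hx))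
  simp only [covAlong, h1]
  congr 1
  rw [Finset.sum_comm]
  refine Finset.sum_congr rfl fun c _ => Finset.sum_congr rfl fun d _ => ?_
  rw [hG.christoffel_symm hxΩ]
  ring

lemma ip_pos (hy : x ∈ U) (hmap : Set.MapsTo X U Ω) {V : Fin 3 → ℝ} (hV : V ≠ 0) :
    0 < ip (G (X x)) V V := by
  have h := (hG.posDef (X x) (hmap hy)).dotProduct_mulVec_pos hV
  refine h.trans_eq ?_
  simp only [ip, dotProduct, Matrix.mulVec, Finset.mul_sum, star_trivial]
  exact Finset.sum_congr rfl fun i _ => Finset.sum_congr rfl fun j _ => by ring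

/-- Injectivity of dX gives positive definiteness. The tangent vectors of a C² map are C¹, which is
the regularity left for the induced metric. -/
lemma pullback_isMetricOn (hm : 1 ≤ m) (hU : IsOpen U) (hX : ContDiffOn ℝ 2 X U)
    (hmap : Set.MapsTo X U Ω) (hinj : ∀ z ∈ U, Function.Injective (fderiv ℝ X z)) :
    IsMetricOn 1 (pullback G X) U := by
  refine ⟨hU, fun i j => ?_, fun z hz => ?_⟩
  · simp only [pullback, Matrix.of_apply, ip]
    exact ContDiffOn.sum fun a _ => ContDiffOn.sum fun b _ =>
      ((((hG.contDiffOn a b).of_le hm).comp (hX.of_le (by norm_num)) hmap).mul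
        (contDiffOn_tang hU hX i a)).mul (contDiffOn_tang hU hX j b)
  · refine Matrix.PosDef.of_dotProduct_mulVec_pos ?_ fun c hc => ?_
    · ext i j
      simp only [Matrix.conjTranspose_apply, pullback, Matrix.of_apply, star_trivial]
      exact ip_comm (hG.symm (hmap hz)) _ _
    · set w : EucSp 2 := WithLp.toLp 2 c with hw
      have hne : (fun a => ∑ i, c i * tang X i z a) ≠ 0 := by
        intro h0
        have hd : fderiv ℝ X z w = 0 := by
          ext a
          have h1 : (fderiv ℝ X z w) a = fderiv ℝ (fun z => X z a) z w := by
            have : HasFDerivAt (fun z => X z a) ((EuclideanSpace.proj a).comp (fderiv ℝ X z)) z :=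
              (EuclideanSpace.proj (𝕜 := ℝ) a).hasFDerivAt.comp z
                (differentiableAt_map hU hX hz).hasFDerivAt
            rw [this.fderiv]
            rfl
          rw [h1, fderiv_apply_eq_sum_pd]
          have := congrFun h0 a
          simp only [Pi.zero_apply] at this
          rw [PiLp.zero_apply, ← this]
          exact Finset.sum_congr rfl fun i _ => mul_comm _ _
        have : w = 0 := hinj z hz (by rw [hd, map_zero])
        apply hc
        have h2 := congrArg WithLp.ofLp this
        simpa [hw] using h2
      refine (hG.ip_pos hz hmap hne).trans_eq ?_
      simp only [ip, dotProduct, Matrix.mulVec, pullback, Matrix.of_apply, star_trivial,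
        Fin.sum_univ_two, Fin.sum_univ_three]
      ring

/-- The Christoffel symbols of the induced metric. -/
lemma sum_mul_christoffel_pullback (hm : 1 ≤ m) (hU : IsOpen U) (hX : ContDiffOn ℝ 2 X U)
    (hmap : Set.MapsTo X U Ω) (hinj : ∀ z ∈ U, Function.Injective (fderiv ℝ X z)) (hx : x ∈ U)
    (l i j : Fin 2) :
    ∑ e, pullback G X x l e * christoffel (pullback G X) e i j x =
      ip (G (X x)) (covAlong G X i (tang X j) x) (tang X l x) := by
  have hP := hG.pullback_isMetricOn hm hU hX hmap hinj
  have hxΩ := hmap hx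
  have hs := ip_comm (hG.symm hxΩ)
  have hd : ∀ i a, DifferentiableAt ℝ (fun z => tang X i z a) x := fun i a =>
    differentiableAt_of_contDiffOn hU (contDiffOn_tang hU hX i a) le_rfl hx
  have hpd : ∀ l i j, pd l (fun z => pullback G X z i j) x =
      ip (G (X x)) (covAlong G X l (tang X i) x) (tang X j x) +
        ip (G (X x)) (tang X i x) (covAlong G X l (tang X j) x) := fun l i j =>
    hG.pd_ip hm (differentiableAt_map hU hX hx) hxΩ (hd i) (hd j) l
  have hc := hG.covAlong_tang_comm hU hX hx hxΩ
  rw [hP.sum_mul_christoffel hx, hpd, hpd, hpd, hc l i, hc l j, hc j i, hs (tang X j x),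
    hs (tang X i x)]
  ring

end IsMetricOn

/-- The vector field along `X` obtained from `∂_0 X, ∂_1 X` by the Gram-Schmidt process, normalized
such that `|∂_0 X| |Z| = 1`. -/
def gramSchmidt (G : EucSp 3 → Matrix (Fin 3) (Fin 3) ℝ) (X : EucSp 2 → EucSp 3) (x : EucSp 2) :
    Fin 3 → ℝ :=
  fun a => (tang X 1 x a - pullback G X x 0 1 / pullback G X x 0 0 * tang X 0 x a) /
    volDensity (pullback G X) x

namespace IsMetricOn

variable (hG : IsMetricOn m G Ω)
include hG

/-- The connection form of the frame of the surface. -/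
lemma connectionForm_eq (hm : 1 ≤ m) (hU : IsOpen U) (hX : ContDiffOn ℝ 2 X U)
    (hmap : Set.MapsTo X U Ω) (hinj : ∀ z ∈ U, Function.Injective (fderiv ℝ X z)) (hx : x ∈ U)
    (b : Fin 2) :
    volDensity (pullback G X) x / pullback G X x 0 0 * christoffel (pullback G X) 1 0 b x =
      ip (G (X x)) (covAlong G X b (tang X 0) x) (gramSchmidt G X x) := by
  have hP := hG.pullback_isMetricOn hm hU hX hmap hinj
  have h0 := hG.sum_mul_christoffel_pullback hm hU hX hmap hinj hx 0 b 0
  have h1 := hG.sum_mul_christoffel_pullback hm hU hX hmap hinj hx 1 b 0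
  have h00 : 0 < pullback G X x 0 0 := (hP.posDef x hx).diag_pos
  have hρ := hP.volDensity_pos hx
  have hdet := hP.volDensity_sq hx
  rw [Matrix.det_fin_two, hP.symm hx 1 0] at hdet
  rw [Fin.sum_univ_two] at h0 h1
  rw [hP.christoffel_symm hx 1 0 b]
  have hlin : ip (G (X x)) (covAlong G X b (tang X 0) x) (gramSchmidt G X x) =
      (ip (G (X x)) (covAlong G X b (tang X 0) x) (tang X 1 x) -
        pullback G X x 0 1 / pullback G X x 0 0 *
          ip (G (X x)) (covAlong G X b (tang X 0) x) (tang X 0 x)) /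
      volDensity (pullback G X) x := by
    simp only [ip, gramSchmidt, Fin.sum_univ_three]
    ring
  rw [hlin, ← h0, ← h1, hP.symm hx 1 0]
  field_simp
  -- The relation h_00 h_11 - h_01² = √(det h)² removes the normalizing density of the Gram-Schmidt
  -- vector.
  linear_combination christoffel (pullback G X) 1 b 0 x * hdet

lemma contDiffOn_gramSchmidt (hm : 1 ≤ m) (hU : IsOpen U) (hX : ContDiffOn ℝ 2 X U)
    (hmap : Set.MapsTo X U Ω) (hinj : ∀ z ∈ U, Function.Injective (fderiv ℝ X z)) (a : Fin 3) :
    ContDiffOn ℝ 1 (fun z => gramSchmidt G X z a) U := by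
  have hP := hG.pullback_isMetricOn hm hU hX hmap hinj
  exact ((contDiffOn_tang hU hX 1 a).sub (((hP.contDiffOn 0 1).div (hP.contDiffOn 0 0)
    fun z hz => (hP.posDef z hz).diag_pos.ne').mul (contDiffOn_tang hU hX 0 a))).div
    hP.contDiffOn_volDensity fun z hz => (hP.volDensity_pos hz).ne'

/-- The adapted frame of a surface in a level set of `u`. -/
lemma isAdaptedFrame (hm : 1 ≤ m) (hU : IsOpen U) (hX : ContDiffOn ℝ 2 X U)
    (hmap : Set.MapsTo X U Ω) (hinj : ∀ z ∈ U, Function.Injective (fderiv ℝ X z)) (hx : x ∈ U)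
    {N : Fin 3 → ℝ} (hN : ip (G (X x)) N N = 1) (hNX : ∀ i, ip (G (X x)) N (tang X i x) = 0) :
    IsAdaptedFrame (G (X x)) (pullback G X x 0 0) (tang X 0 x) (gramSchmidt G X x) N := by
  have hP := hG.pullback_isMetricOn hm hU hX hmap hinj
  have h00 : 0 < pullback G X x 0 0 := (hP.posDef x hx).diag_pos
  have hρ := hP.volDensity_pos hx
  have hdet := hP.volDensity_sq hx
  rw [Matrix.det_fin_two, hP.symm hx 1 0] at hdet
  have hZ : ∀ V, ip (G (X x)) V (gramSchmidt G X x) = (ip (G (X x)) V (tang X 1 x) -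
      pullback G X x 0 1 / pullback G X x 0 0 * ip (G (X x)) V (tang X 0 x)) /
      volDensity (pullback G X) x := fun V => by
    simp only [ip, gramSchmidt, Fin.sum_univ_three]
    ring
  have hs := ip_comm (hG.symm (hmap hx))
  have hp : ∀ i j, ip (G (X x)) (tang X i x) (tang X j x) = pullback G X x i j := fun _ _ => rfl
  refine ⟨h00, rfl, ?_, hN, ?_, hNX 0, ?_⟩
  · rw [hZ, hs (gramSchmidt G X x), hs (gramSchmidt G X x), hZ, hZ]
    simp only [hp]
    rw [hP.symm hx 1 0]
    field_simp
    linear_combination (-1) * hdet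
  · rw [hs, hZ]
    simp only [hp]
    field_simp
    ring
  · rw [hZ, hNX, hNX]
    ring

end IsMetricOn

end AlongMap

/-! ### The structure equation for fields along a map. -/

section GaussEquation

variable {m : WithTop ℕ∞} {G : EucSp 3 → Matrix (Fin 3) (Fin 3) ℝ} {Ω : Set (EucSp 3)}
  {U : Set (EucSp 2)} {X : EucSp 2 → EucSp 3} {x : EucSp 2}

/-- The covector field `⟨Z, ·⟩` along `X`. -/
def lowerAlong (G : EucSp 3 → Matrix (Fin 3) (Fin 3) ℝ) (X : EucSp 2 → EucSp 3)
    (Z : EucSp 2 → Fin 3 → ℝ) (a : Fin 3) (x : EucSp 2) : ℝ :=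
  ∑ e, G (X x) a e * Z x e

/-- The coefficients of `dX` in the connection form `⟨∇E, Z⟩`. -/
def connectionAlong (G : EucSp 3 → Matrix (Fin 3) (Fin 3) ℝ) (X : EucSp 2 → EucSp 3)
    (E Z : EucSp 2 → Fin 3 → ℝ) (c : Fin 3) (x : EucSp 2) : ℝ :=
  ∑ e, ∑ d, lowerAlong G X Z e x * christoffel G e c d (X x) * E x d

/-- This splits the connection form as p_a dE^a + q_c dX^c. For C¹ fields E and Z the coefficients
are C¹, so by `integral_mul_wedge` its weak exterior derivative is dp_a ∧ dE^a + dq_c ∧ dX^c,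
without second derivatives of E. -/
lemma ip_covAlong_eq (hs : ∀ i j, G (X x) i j = G (X x) j i) (E Z : EucSp 2 → Fin 3 → ℝ)
    (b : Fin 2) :
    ip (G (X x)) (covAlong G X b E x) (Z x) =
      ∑ a, lowerAlong G X Z a x * pd b (fun z => E z a) x +
        ∑ c, connectionAlong G X E Z c x * pd b (fun z => X z c) x := by
  simp only [ip, covAlong, lowerAlong, connectionAlong, tang, Fin.sum_univ_three, hs 1 0, hs 2 0,
    hs 2 1]
  ring

namespace IsMetricOn

variable (hG : IsMetricOn m G Ω)
include hG

lemma contDiffOn_lowerAlong (hm : 1 ≤ m) (hX : ContDiffOn ℝ 1 X U) (hmap : Set.MapsTo X U Ω)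
    {Z : EucSp 2 → Fin 3 → ℝ} (hZ : ∀ a, ContDiffOn ℝ 1 (fun z => Z z a) U) (a : Fin 3) :
    ContDiffOn ℝ 1 (lowerAlong G X Z a) U :=
  ContDiffOn.sum fun e _ => (((hG.contDiffOn a e).of_le hm).comp hX hmap).mul (hZ e)

lemma contDiffOn_connectionAlong (hm : 2 ≤ m) (hX : ContDiffOn ℝ 1 X U) (hmap : Set.MapsTo X U Ω)
    {E Z : EucSp 2 → Fin 3 → ℝ} (hE : ∀ a, ContDiffOn ℝ 1 (fun z => E z a) U)
    (hZ : ∀ a, ContDiffOn ℝ 1 (fun z => Z z a) U) (c : Fin 3) :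
    ContDiffOn ℝ 1 (connectionAlong G X E Z c) U :=
  ContDiffOn.sum fun e _ => ContDiffOn.sum fun d _ =>
    ((hG.contDiffOn_lowerAlong (le_trans (by norm_num) hm) hX hmap hZ e).mul
      ((hG.contDiffOn_christoffel (k := 1) (by norm_num; exact hm) e c d).comp hX hmap)).mul (hE d)

/-- Lowering an index commutes with covariant differentiation; the Christoffel term is the
difference between the ordinary and the covariant derivative of a covector. -/
lemma pd_lowerAlong (hm : 1 ≤ m) (hXd : DifferentiableAt ℝ X x) (hx : X x ∈ Ω)
    {Z : EucSp 2 → Fin 3 → ℝ} (hZ : ∀ a, DifferentiableAt ℝ (fun z => Z z a) x) (b : Fin 2)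
    (a : Fin 3) :
    pd b (lowerAlong G X Z a) x = ∑ e, G (X x) a e * covAlong G X b Z x e +
      ∑ e, ∑ c, lowerAlong G X Z e x * christoffel G e c a (X x) * tang X b x c := by
  have hGd : ∀ i j, DifferentiableAt ℝ (fun z => G z i j) (X x) := fun i j =>
    differentiableAt_of_contDiffOn hG.isOpen (hG.contDiffOn i j) hm hx
  have hGX : ∀ i j, DifferentiableAt ℝ (fun z => G (X z) i j) x := fun i j =>
    (hGd i j).comp x hXd
  have h2 : ∀ i j, pd b (fun z => G (X z) i j) x = ∑ c, (∑ e,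
      (christoffel G e c i (X x) * G (X x) e j + christoffel G e c j (X x) * G (X x) i e)) *
        tang X b x c := fun i j => by
    rw [pd_comp_map b (f := fun z => G z i j) (hGd i j) hXd]
    refine Finset.sum_congr rfl fun c _ => ?_
    rw [hG.pd_metric hx]
    rfl
  have h1 : pd b (lowerAlong G X Z a) x = ∑ e, (pd b (fun z => G (X z) a e) x * Z x e +
      G (X x) a e * pd b (fun z => Z z e) x) := by
    unfold lowerAlong
    rw [pd_sum _ _ fun e _ => (hGX a e).fun_mul (hZ e)]
    exact Finset.sum_congr rfl fun e _ => pd_mul b (hGX a e) (hZ e)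
  rw [h1]
  simp only [h2, covAlong, lowerAlong, Fin.sum_univ_three]
  ring

set_option maxRecDepth 4000 in
set_option maxHeartbeats 1600000 in
/-- The exterior derivative of the connection form `⟨∇E, Z⟩`: the structure equation, in which no
second derivatives of `E` and `Z` occur. -/
lemma structure_equation (hm : 2 ≤ m) (hXd : DifferentiableAt ℝ X x) (hx : X x ∈ Ω)
    {E Z : EucSp 2 → Fin 3 → ℝ} (hE : ∀ a, DifferentiableAt ℝ (fun z => E z a) x)
    (hZ : ∀ a, DifferentiableAt ℝ (fun z => Z z a) x) :
    ∑ a, (pd 1 (fun z => E z a) x * pd 0 (lowerAlong G X Z a) x -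
        pd 0 (fun z => E z a) x * pd 1 (lowerAlong G X Z a) x) +
      ∑ c, (pd 1 (fun z => X z c) x * pd 0 (connectionAlong G X E Z c) x -
        pd 0 (fun z => X z c) x * pd 1 (connectionAlong G X E Z c) x) =
      ip (G (X x)) (covAlong G X 1 E x) (covAlong G X 0 Z x) -
      ip (G (X x)) (covAlong G X 0 E x) (covAlong G X 1 Z x) -
      riemannForm G (X x) (Z x) (E x) (tang X 1 x) (tang X 0 x) := by
  have hm1 : (1 : WithTop ℕ∞) ≤ m := le_trans (by norm_num) hm
  have hΓd : ∀ e c d, DifferentiableAt ℝ (christoffel G e c d) (X x) := fun e c d =>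
    differentiableAt_of_contDiffOn hG.isOpen
      (hG.contDiffOn_christoffel (k := 1) (by norm_num; exact hm) e c d) le_rfl hx
  have hΓX : ∀ e c d, DifferentiableAt ℝ (fun z => christoffel G e c d (X z)) x := fun e c d =>
    (hΓd e c d).comp x hXd
  have hGX : ∀ i j, DifferentiableAt ℝ (fun z => G (X z) i j) x := fun i j =>
    (differentiableAt_of_contDiffOn hG.isOpen (hG.contDiffOn i j) hm1 hx).comp x hXd
  have hp : ∀ a, DifferentiableAt ℝ (lowerAlong G X Z a) x := fun a =>
    DifferentiableAt.fun_sum fun e _ => (hGX a e).fun_mul (hZ e)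
  have hpdp := hG.pd_lowerAlong hm1 hXd hx hZ
  have hpdq : ∀ b c, pd b (connectionAlong G X E Z c) x = ∑ e, ∑ d,
      ((pd b (lowerAlong G X Z e) x * christoffel G e c d (X x) + lowerAlong G X Z e x *
        ∑ f, pd f (christoffel G e c d) (X x) * tang X b x f) * E x d +
        lowerAlong G X Z e x * christoffel G e c d (X x) * pd b (fun z => E z d) x) := fun b c => by
    unfold connectionAlong
    rw [pd_sum _ _ fun e _ => DifferentiableAt.fun_sum fun d _ =>
      ((hp e).fun_mul (hΓX e c d)).fun_mul (hE d)]
    refine Finset.sum_congr rfl fun e _ => ?_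
    rw [pd_sum _ _ fun d _ => ((hp e).fun_mul (hΓX e c d)).fun_mul (hE d)]
    refine Finset.sum_congr rfl fun d _ => ?_
    rw [pd_mul b ((hp e).fun_mul (hΓX e c d)) (hE d), pd_mul b (hp e) (hΓX e c d),
      pd_comp_map b (hΓd e c d) hXd]
    rfl
  -- Ordinary derivatives of E are traded for covariant ones. The products of Christoffel symbols
  -- that remain combine with ∂Γ to the Riemann tensor.
  have hpd0 : ∀ b a, pd b (fun z => E z a) x = covAlong G X b E x a -
      ∑ c, ∑ d, christoffel G a c d (X x) * tang X b x c * E x d := fun b a => by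
    simp only [covAlong]
    ring
  set DZ : Fin 2 → Fin 3 → ℝ := fun b a => ∑ e, G (X x) a e * covAlong G X b Z x e with hDZ
  set p : Fin 3 → ℝ := fun a => lowerAlong G X Z a x with hpdef
  have hip : ∀ b c, ip (G (X x)) (covAlong G X b E x) (covAlong G X c Z x) =
      ∑ a, covAlong G X b E x a * DZ c a := fun b c => by
    simp only [ip, hDZ, Finset.mul_sum]
    exact Finset.sum_congr rfl fun i _ => Finset.sum_congr rfl fun j _ => by ring
  have hriem : riemannForm G (X x) (Z x) (E x) (tang X 1 x) (tang X 0 x) = ∑ e, p e *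
      ∑ b, ∑ c, ∑ d, riemann G e b c d (X x) * E x b * tang X 1 x c * tang X 0 x d := by
    simp only [riemannForm, ip, hpdef, lowerAlong, Finset.sum_mul]
    rw [Finset.sum_comm]
    exact Finset.sum_congr rfl fun i _ => Finset.sum_congr rfl fun j _ => by
      rw [hG.symm hx i j]
  have hpdp' : ∀ b a, pd b (lowerAlong G X Z a) x = DZ b a +
      ∑ e, ∑ c, p e * christoffel G e c a (X x) * tang X b x c := hpdp
  have hpx : ∀ a, lowerAlong G X Z a x = p a := fun _ => rfl
  have hXt : ∀ b c, pd b (fun z => X z c) x = tang X b x c := fun _ _ => rfl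
  have hs : ∀ a (i j : Fin 3), christoffel G a i j (X x) = christoffel G a j i (X x) :=
    fun a i j => hG.christoffel_symm hx a i j
  have hsp : ∀ l a (i j : Fin 3), pd l (christoffel G a i j) (X x) =
      pd l (christoffel G a j i) (X x) := fun l a i j =>
    pd_congr_of_eqOn hG.isOpen hx fun z hz => hG.christoffel_symm hz a i j
  rw [hriem]
  simp only [hpdq, hip]
  simp only [hpdp', hpd0, hpx, hXt]
  -- With the covariant derivatives opaque, the claim is a polynomial identity of manageable size.
  generalize covAlong G X 0 E x = E0
  generalize covAlong G X 1 E x = E1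
  clear_value DZ p
  simp only [riemann, Fin.sum_univ_three]
  simp only [hs _ 1 0, hs _ 2 0, hs _ 2 1, hsp _ _ 1 0, hsp _ _ 2 0, hsp _ _ 2 1]
  ring

end IsMetricOn

end GaussEquation

/-! ### The Gauss equation for level sets. -/

section GaussEquation

variable {m : WithTop ℕ∞} {G : EucSp 3 → Matrix (Fin 3) (Fin 3) ℝ} {Ω : Set (EucSp 3)}
  {U : Set (EucSp 2)} {X : EucSp 2 → EucSp 3} {x : EucSp 2} {u : EucSp 3 → ℝ} {c : ℝ}

namespace IsMetricOn

variable (hG : IsMetricOn m G Ω)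
include hG

/-- The derivative of the unit normal is tangential. -/
lemma ip_unitNormal_covDeriv (hm : 1 ≤ m) (hu : ContDiffOn ℝ 2 u Ω)
    (h0 : ∀ z ∈ Ω, gradLen G u z ≠ 0) {y : EucSp 3} (hy : y ∈ Ω) (l : Fin 3) :
    ip (G y) (unitNormal G u y) (fun e => covDeriv G (unitNormal G u) l e y) = 0 := by
  have hV : ∀ a, DifferentiableAt ℝ (fun z => unitNormal G u z a) y := fun a =>
    differentiableAt_of_contDiffOn hG.isOpen (hG.contDiffOn_unitNormal hm hu h0 a) le_rfl hy
  have hGd : ∀ i j, DifferentiableAt ℝ (fun z => G z i j) y := fun i j =>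
    differentiableAt_of_contDiffOn hG.isOpen (hG.contDiffOn i j) hm hy
  have h1 : pd l (fun z => ip (G z) (unitNormal G u z) (unitNormal G u z)) y = 0 := by
    rw [pd_congr_of_eqOn hG.isOpen hy (g := fun _ => 1) fun z hz => hG.ip_unitNormal hz (h0 z hz),
      pd_const]
  have h2 : pd l (fun z => ip (G z) (unitNormal G u z) (unitNormal G u z)) y = ∑ i, ∑ j,
      ((pd l (fun z => G z i j) y * unitNormal G u y i +
        G y i j * pd l (fun z => unitNormal G u z i) y) * unitNormal G u y j +
        G y i j * unitNormal G u y i * pd l (fun z => unitNormal G u z j) y) := by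
    simp only [ip]
    rw [pd_sum _ _ fun i _ => DifferentiableAt.fun_sum fun j _ =>
      ((hGd i j).fun_mul (hV i)).fun_mul (hV j)]
    refine Finset.sum_congr rfl fun i _ => ?_
    rw [pd_sum _ _ fun j _ => ((hGd i j).fun_mul (hV i)).fun_mul (hV j)]
    refine Finset.sum_congr rfl fun j _ => ?_
    rw [pd_mul l ((hGd i j).fun_mul (hV i)) (hV j), pd_mul l (hGd i j) (hV i)]
  have hs := hG.symm hy
  rw [h2] at h1
  simp only [hG.pd_metric hy, Fin.sum_univ_three, hs 1 0, hs 2 0, hs 2 1] at h1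
  simp only [ip, covDeriv, Fin.sum_univ_three, hs 1 0, hs 2 0, hs 2 1]
  linear_combination 1 / 2 * h1

lemma covAlong_unitNormal (hm : 1 ≤ m) (hu : ContDiffOn ℝ 2 u Ω)
    (h0 : ∀ z ∈ Ω, gradLen G u z ≠ 0) (hXd : DifferentiableAt ℝ X x) (hx : X x ∈ Ω) (b : Fin 2) :
    covAlong G X b (fun z => unitNormal G u (X z)) x =
      fun e => ∑ c, covDeriv G (unitNormal G u) c e (X x) * tang X b x c := by
  funext e
  have hV : DifferentiableAt ℝ (fun z => unitNormal G u z e) (X x) :=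
    differentiableAt_of_contDiffOn hG.isOpen (hG.contDiffOn_unitNormal hm hu h0 e) le_rfl hx
  simp only [covAlong]
  rw [pd_comp_map b hV hXd]
  simp only [covDeriv, tang, Fin.sum_univ_three]
  ring

/-- A surface in a level set of `u` is orthogonal to the gradient of `u`. -/
lemma ip_unitNormal_tang (hu : ContDiffOn ℝ 2 u Ω) (hU : IsOpen U)
    (hX : ContDiffOn ℝ 2 X U) (hmap : Set.MapsTo X U Ω) (hc : ∀ z ∈ U, u (X z) = c) (hx : x ∈ U)
    (i : Fin 2) : ip (G (X x)) (unitNormal G u (X x)) (tang X i x) = 0 := by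
  have hxΩ := hmap hx
  have h1 : pd i (fun z => u (X z)) x = 0 := by
    rw [pd_congr_of_eqOn hU hx (g := fun _ => c) hc, pd_const]
  rw [pd_comp_map i (differentiableAt_of_contDiffOn hG.isOpen hu (by norm_num) hxΩ)
    (differentiableAt_map hU hX hx)] at h1
  have h2 := hG.ip_grad hxΩ u (tang X i x)
  have h3 : ip (G (X x)) (unitNormal G u (X x)) (tang X i x) =
      ip (G (X x)) (grad G u (X x)) (tang X i x) / gradLen G u (X x) := by
    simp only [ip, unitNormal, Fin.sum_univ_three]
    ring
  rw [h3, h2]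
  simp only [tang, h1, zero_div]

/-- The Gauss equation, for the classical expression of the exterior derivative of the connection
form of the surface. -/
lemma gauss_equation (hm : 2 ≤ m) (hu : ContDiffOn ℝ 2 u Ω) (h0 : ∀ z ∈ Ω, gradLen G u z ≠ 0)
    (hU : IsOpen U) (hX : ContDiffOn ℝ 2 X U) (hmap : Set.MapsTo X U Ω)
    (hinj : ∀ z ∈ U, Function.Injective (fderiv ℝ X z)) (hc : ∀ z ∈ U, u (X z) = c)
    (hx : x ∈ U) :
    ip (G (X x)) (covAlong G X 1 (tang X 0) x) (covAlong G X 0 (gramSchmidt G X) x) -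
      ip (G (X x)) (covAlong G X 0 (tang X 0) x) (covAlong G X 1 (gramSchmidt G X) x) -
      riemannForm G (X x) (gramSchmidt G X x) (tang X 0 x) (tang X 1 x) (tang X 0 x) =
      -(levelCurv G u (X x) * volDensity (pullback G X) x) := by
  have hm1 : (1 : WithTop ℕ∞) ≤ m := le_trans (by norm_num) hm
  have hP := hG.pullback_isMetricOn hm1 hU hX hmap hinj
  have hxΩ := hmap hx
  have hXd := differentiableAt_map hU hX hx
  have hA := hG.symm hxΩ
  set N : EucSp 2 → Fin 3 → ℝ := fun z => unitNormal G u (X z) with hNdef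
  -- The frame relations are stated on all of U because they are differentiated below.
  have hframe : ∀ z ∈ U, IsAdaptedFrame (G (X z)) (pullback G X z 0 0) (tang X 0 z)
      (gramSchmidt G X z) (N z) := fun z hz =>
    hG.isAdaptedFrame hm1 hU hX hmap hinj hz (hG.ip_unitNormal (hmap hz) (h0 _ (hmap hz)))
      (hG.ip_unitNormal_tang hu hU hX hmap hc hz)
  have hf := hframe x hx
  have hρ := hP.volDensity_pos hx
  have hEd : ∀ a, DifferentiableAt ℝ (fun z => tang X 0 z a) x := fun a =>
    differentiableAt_of_contDiffOn hU (contDiffOn_tang hU hX 0 a) le_rfl hx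
  have hZd : ∀ a, DifferentiableAt ℝ (fun z => gramSchmidt G X z a) x := fun a =>
    differentiableAt_of_contDiffOn hU (hG.contDiffOn_gramSchmidt hm1 hU hX hmap hinj a) le_rfl hx
  have hNd : ∀ a, DifferentiableAt ℝ (fun z => N z a) x := fun a =>
    (differentiableAt_of_contDiffOn hG.isOpen (hG.contDiffOn_unitNormal hm1 hu h0 a) le_rfl
      hxΩ).comp x hXd
  have dEE := fun b => hG.pd_ip hm1 hXd hxΩ hEd hEd b
  have dZZ := fun b => hG.pd_ip hm1 hXd hxΩ hZd hZd b
  have dZE := fun b => hG.pd_ip hm1 hXd hxΩ hZd hEd b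
  have dNE := fun b => hG.pd_ip hm1 hXd hxΩ hNd hEd b
  have dNZ := fun b => hG.pd_ip hm1 hXd hxΩ hNd hZd b
  have hl : DifferentiableAt ℝ (fun z => pullback G X z 0 0) x :=
    differentiableAt_of_contDiffOn hU (hP.contDiffOn 0 0) le_rfl hx
  have hl0 := hf.pos
  have cZZ : ∀ b, pd b (fun z => ip (G (X z)) (gramSchmidt G X z) (gramSchmidt G X z)) x =
      -pd b (fun z => pullback G X z 0 0) x / pullback G X x 0 0 ^ 2 := fun b => by
    rw [pd_congr_of_eqOn hU hx (g := fun z => (pullback G X z 0 0)⁻¹) fun z hz => by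
      simp only [(hframe z hz).ZZ, one_div], SpacetimeIMCF.pd_inv b hl hl0.ne']
  have cZE : ∀ b, pd b (fun z => ip (G (X z)) (gramSchmidt G X z) (tang X 0 z)) x = 0 := fun b => by
    rw [pd_congr_of_eqOn hU hx (g := fun _ => 0) fun z hz => (hframe z hz).ZE, pd_const]
  have cNE : ∀ b, pd b (fun z => ip (G (X z)) (N z) (tang X 0 z)) x = 0 := fun b => by
    rw [pd_congr_of_eqOn hU hx (g := fun _ => 0) fun z hz => (hframe z hz).NE, pd_const]
  have cNZ : ∀ b, pd b (fun z => ip (G (X z)) (N z) (gramSchmidt G X z)) x = 0 := fun b => by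
    rw [pd_congr_of_eqOn hU hx (g := fun _ => 0) fun z hz => (hframe z hz).NZ, pd_const]
  have hcomm := ip_comm hA
  set W : Fin 3 → Fin 3 → ℝ := fun c e => covDeriv G (unitNormal G u) c e (X x) with hW
  have hDN : ∀ b, covAlong G X b N x = fun e => ∑ c, W c e * tang X b x c := fun b =>
    hG.covAlong_unitNormal hm1 hu h0 hXd hxΩ b
  have hNW : ∀ V : Fin 3 → ℝ, ip (G (X x)) (N x) (fun e => ∑ c, W c e * V c) = 0 := fun V => by
    have h1 := fun l => hG.ip_unitNormal_covDeriv hm1 hu h0 hxΩ l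
    have h2 : ip (G (X x)) (N x) (fun e => ∑ c, W c e * V c) =
        ∑ c, V c * ip (G (X x)) (N x) (W c) := by
      simp only [ip, Fin.sum_univ_three]
      ring
    rw [h2]
    exact Finset.sum_eq_zero fun c _ => by rw [hNdef, hW, h1, mul_zero]
  have hσ := hf.sigma_two hA W hNW
  have hsec := hG.sectional_eq hm hxΩ hf
  set E := tang X 0 x with hE
  set Z := gramSchmidt G X x with hZ
  set lam := pullback G X x 0 0 with hlam
  set ρ := volDensity (pullback G X) x with hρdef
  set t := pullback G X x 0 1 / lam with ht
  -- The Gram-Schmidt process, inverted.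
  have hX1 : ∀ a, tang X 1 x a = ρ * Z a + t * E a := fun a => by
    have h1 : Z a = (tang X 1 x a - t * E a) / ρ := rfl
    rw [h1]
    field_simp
    ring
  -- The E-part of ∂_1 X drops out by antisymmetry in the last two slots.
  have hriem : riemannForm G (X x) Z E (tang X 1 x) E = ρ * riemannForm G (X x) Z E Z E := by
    have h1 : riemannForm G (X x) Z E (tang X 1 x) E =
        ρ * riemannForm G (X x) Z E Z E + t * riemannForm G (X x) Z E E E := by
      simp only [riemannForm, ip, hX1, Fin.sum_univ_three]
      ring
    have h2 : riemannForm G (X x) Z E E E = 0 := by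
      have := riemannForm_swap_right (G := G) (y := X x) Z E E E
      linarith
    rw [h1, h2]
    ring
  have hWX1 : ∀ V, ip (G (X x)) V (fun e => ∑ c, W c e * tang X 1 x c) =
      ρ * ip (G (X x)) V (fun e => ∑ c, W c e * Z c) +
        t * ip (G (X x)) V (fun e => ∑ c, W c e * E c) := fun V => by
    simp only [ip, hX1, Fin.sum_univ_three]
    ring
  have hlevel : levelCurv G u (X x) = riemannForm G (X x) Z E Z E +
      (ip (G (X x)) E (fun e => ∑ c, W c e * E c) * ip (G (X x)) Z (fun e => ∑ c, W c e * Z c) -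
      ip (G (X x)) E (fun e => ∑ c, W c e * Z c) * ip (G (X x)) Z (fun e => ∑ c, W c e * E c)) := by
    rw [← hσ, ← hsec]
    rfl
  -- By `key`, the tangential parts of the two inner products are symmetric under exchange of the
  -- directions 0 and 1 and cancel. The normal parts give the determinant of the second fundamental
  -- form.
  rw [hlevel, hriem, hf.parseval hA (covAlong G X 1 (tang X 0) x),
    hf.parseval hA (covAlong G X 0 (tang X 0) x)]
  -- Differentiating ⟨Z,E⟩ = 0, |Z|² = 1/|E|², ⟨N,Z⟩ = 0 and ⟨N,E⟩ = 0 expresses everything by the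
  -- tangential components of ∇E and the derivative of the normal.
  have key : ∀ b, ip (G (X x)) (covAlong G X b (gramSchmidt G X) x) E =
        -ip (G (X x)) (covAlong G X b (tang X 0) x) Z ∧
      ip (G (X x)) (covAlong G X b (gramSchmidt G X) x) Z =
        -ip (G (X x)) (covAlong G X b (tang X 0) x) E / lam ^ 2 ∧
      ip (G (X x)) (covAlong G X b (gramSchmidt G X) x) (N x) =
        -ip (G (X x)) Z (fun e => ∑ c, W c e * tang X b x c) ∧
      ip (G (X x)) (covAlong G X b (tang X 0) x) (N x) =
        -ip (G (X x)) E (fun e => ∑ c, W c e * tang X b x c) := fun b => by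
    have e1 := (dZE b).symm.trans (cZE b)
    have e2 := (dZZ b).symm.trans (cZZ b)
    have e3 := (dNZ b).symm.trans (cNZ b)
    have e4 := (dNE b).symm.trans (cNE b)
    have e5 : pd b (fun z => pullback G X z 0 0) x = _ := dEE b
    rw [e5] at e2
    rw [hcomm Z] at e1 e2
    rw [hcomm E] at e2
    rw [hDN, hcomm _ Z, hcomm (N x)] at e3
    rw [hDN, hcomm _ E, hcomm (N x)] at e4
    refine ⟨?_, ?_, ?_, ?_⟩
    · rw [hcomm _ Z] at e1 ⊢
      linarith
    · have := e2
      field_simp at this ⊢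
      linarith
    · linarith
    · linarith
  obtain ⟨k1, k2, k3, k4⟩ := key 0
  obtain ⟨l1, l2, l3, l4⟩ := key 1
  rw [k1, k2, k3, k4, l1, l2, l3, l4, hWX1, hWX1]
  field_simp
  ring

/-- The Gauss equation: the level sets of `u` have the Gaussian curvature `levelCurv G u`. -/
lemma isGaussCurvatureOn_levelCurv (hm : 2 ≤ m) (hu : ContDiffOn ℝ 2 u Ω)
    (h0 : ∀ z ∈ Ω, gradLen G u z ≠ 0) (hU : IsOpen U) (hX : ContDiffOn ℝ 2 X U)
    (hmap : Set.MapsTo X U Ω) (hinj : ∀ z ∈ U, Function.Injective (fderiv ℝ X z))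
    (hc : ∀ z ∈ U, u (X z) = c) :
    IsGaussCurvatureOn (pullback G X) U (fun x => levelCurv G u (X x)) := by
  have hm1 : (1 : WithTop ℕ∞) ≤ m := le_trans (by norm_num) hm
  have hX1 : ContDiffOn ℝ 1 X U := hX.of_le (by norm_num)
  refine ⟨(hG.continuousOn_levelCurv hm hu h0).comp hX.continuousOn hmap, fun φ hφ hcs hs => ?_⟩
  set E := tang X 0
  set Z := gramSchmidt G X
  have hEc : ∀ a, ContDiffOn ℝ 1 (fun z => E z a) U := contDiffOn_tang hU hX 0
  have hZc : ∀ a, ContDiffOn ℝ 1 (fun z => Z z a) U :=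
    hG.contDiffOn_gramSchmidt hm1 hU hX hmap hinj
  have hXc : ∀ a, ContDiffOn ℝ 1 (fun z => X z a) U := contDiffOn_coord hX1
  have hp := hG.contDiffOn_lowerAlong hm1 hX1 hmap hZc
  have hq := hG.contDiffOn_connectionAlong hm hX1 hmap hEc hZc
  have hφc : ∀ i, Continuous (pd i φ) := fun i =>
    (contDiff_pd i hφ (m := 0) (by simp)).continuous
  have hwedge : ∀ p f : EucSp 2 → ℝ, ContDiffOn ℝ 1 p U → ContDiffOn ℝ 1 f U →
      Integrable (fun x => p x * (pd 1 f x * pd 0 φ x - pd 0 f x * pd 1 φ x)) ∧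
      Integrable (fun x => (pd 1 f x * pd 0 p x - pd 0 f x * pd 1 p x) * φ x) := fun p f hp hf => by
    have hf' : ∀ i, ContinuousOn (pd i f) U := fun i =>
      contDiffOn_zero.1 (contDiffOn_pd i hU hf (by simp))
    have hp' : ∀ i, ContinuousOn (pd i p) U := fun i =>
      contDiffOn_zero.1 (contDiffOn_pd i hU hp (by simp))
    have hφs : ∀ i, tsupport (pd i φ) ⊆ U := fun i => (tsupport_pd_subset i φ).trans hs
    have hφcs : ∀ i, HasCompactSupport (pd i φ) := fun i =>
      hcs.of_isClosed_subset (isClosed_tsupport _) (tsupport_pd_subset i φ)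
    constructor
    · have h1 := integrable_mul_of_tsupport_subset hU (hp.continuousOn.mul (hf' 1)) (hφc 0)
        (hφcs 0) (hφs 0)
      have h2 := integrable_mul_of_tsupport_subset hU (hp.continuousOn.mul (hf' 0)) (hφc 1)
        (hφcs 1) (hφs 1)
      refine (h1.sub h2).congr (Filter.Eventually.of_forall fun x => ?_)
      simp only [Pi.sub_apply, Pi.mul_apply]
      ring
    · exact integrable_mul_of_tsupport_subset hU (((hf' 1).mul (hp' 0)).sub ((hf' 0).mul (hp' 1)))
        hφ.continuous hcs hs
  have hL : ∀ x, volDensity (pullback G X) x / pullback G X x 0 0 *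
        (christoffel (pullback G X) 1 0 1 x * pd 0 φ x -
          christoffel (pullback G X) 1 0 0 x * pd 1 φ x) =
      ∑ a, lowerAlong G X Z a x *
          (pd 1 (fun z => E z a) x * pd 0 φ x - pd 0 (fun z => E z a) x * pd 1 φ x) +
        ∑ a, connectionAlong G X E Z a x *
          (pd 1 (fun z => X z a) x * pd 0 φ x - pd 0 (fun z => X z a) x * pd 1 φ x) := fun x => by
    by_cases hx : x ∈ tsupport φ
    · have hxU := hs hx
      have e := fun b => (hG.connectionForm_eq hm1 hU hX hmap hinj hxU b).trans
        (ip_covAlong_eq (hG.symm (hmap hxU)) E Z b)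
      have e0 := e 0
      have e1 := e 1
      simp only [Fin.sum_univ_three] at e0 e1 ⊢
      linear_combination pd 0 φ x * e1 - pd 1 φ x * e0
    · have h0 : ∀ i, pd i φ x = 0 := fun i =>
        image_eq_zero_of_notMem_tsupport fun h => hx (tsupport_pd_subset i φ h)
      simp [h0]
  -- On the support of φ this combines the structure equation with the Gauss equation; elsewhere
  -- both sides vanish.
  have hR : ∀ x, levelCurv G u (X x) * φ x * volDensity (pullback G X) x =
      -(∑ a, (pd 1 (fun z => E z a) x * pd 0 (lowerAlong G X Z a) x -
          pd 0 (fun z => E z a) x * pd 1 (lowerAlong G X Z a) x) * φ x +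
        ∑ a, (pd 1 (fun z => X z a) x * pd 0 (connectionAlong G X E Z a) x -
          pd 0 (fun z => X z a) x * pd 1 (connectionAlong G X E Z a) x) * φ x) := fun x => by
    by_cases hx : x ∈ tsupport φ
    · have hxU := hs hx
      have hd : ∀ {f : EucSp 2 → ℝ}, ContDiffOn ℝ 1 f U → DifferentiableAt ℝ f x := fun hf =>
        differentiableAt_of_contDiffOn hU hf le_rfl hxU
      have e1 := hG.structure_equation hm (differentiableAt_map hU hX hxU) (hmap hxU)
        (fun a => hd (hEc a)) (fun a => hd (hZc a))
      have e2 := hG.gauss_equation hm hu h0 hU hX hmap hinj hc hxU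
      rw [← Finset.sum_mul, ← Finset.sum_mul, ← add_mul, e1, e2]
      ring
    · simp [image_eq_zero_of_notMem_tsupport hx]
  simp only [hL, hR]
  rw [integral_neg, integral_add (integrable_finsetSum _ fun a _ => (hwedge _ _ (hp a) (hEc a)).2)
      (integrable_finsetSum _ fun a _ => (hwedge _ _ (hq a) (hXc a)).2),
    integral_add (integrable_finsetSum _ fun a _ => (hwedge _ _ (hp a) (hEc a)).1)
      (integrable_finsetSum _ fun a _ => (hwedge _ _ (hq a) (hXc a)).1),
    integral_finsetSum _ fun a _ => (hwedge _ _ (hp a) (hEc a)).2,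
    integral_finsetSum _ fun a _ => (hwedge _ _ (hq a) (hXc a)).2,
    integral_finsetSum _ fun a _ => (hwedge _ _ (hp a) (hEc a)).1,
    integral_finsetSum _ fun a _ => (hwedge _ _ (hq a) (hXc a)).1]
  simp only [fun a => integral_mul_wedge 0 1 hU (hp a) (hEc a) hφ hcs hs,
    fun a => integral_mul_wedge 0 1 hU (hq a) (hXc a) hφ hcs hs, Finset.sum_neg_distrib]
  ring

end IsMetricOn

end GaussEquation

/-! ### Weak Gaussian curvature: uniqueness and locality. -/

section GaussCurvature

variable {h h' : EucSp 2 → Matrix (Fin 2) (Fin 2) ℝ} {U V : Set (EucSp 2)} {K K' : EucSp 2 → ℝ}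

/-- The right-hand side of the weak formula does not involve K, so the fundamental lemma determines
K times the positive density. -/
lemma IsMetricOn.isGaussCurvatureOn_unique (hh : IsMetricOn 1 h U) (hK : IsGaussCurvatureOn h U K)
    (hK' : IsGaussCurvatureOn h U K') : Set.EqOn K K' U := by
  have hρ := hh.contDiffOn_volDensity.continuousOn
  have heq : Set.EqOn (fun x => K x * volDensity h x) (fun x => K' x * volDensity h x) U := by
    refine eqOn_of_integral_mul_eq hh.isOpen (hK.1.mul hρ) (hK'.1.mul hρ) fun φ hφ hc hs => ?_
    have h1 := (hK.2 φ hφ hc hs).trans (hK'.2 φ hφ hc hs).symm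
    simpa only [mul_right_comm] using h1
  intro x hx
  exact mul_right_cancel₀ (hh.volDensity_pos hx).ne' (heq hx)

lemma IsGaussCurvatureOn.congr (hU : IsOpen U) (hK : IsGaussCurvatureOn h U K)
    (hh : Set.EqOn h' h U) (hKK' : Set.EqOn K' K U) : IsGaussCurvatureOn h' U K' := by
  refine ⟨hK.1.congr hKK', fun φ hφ hc hs => ?_⟩
  have hv : ∀ x ∈ U, volDensity h' x = volDensity h x := fun x hx => by
    simp only [volDensity, hh hx]
  have hΓ : ∀ a i j, ∀ x ∈ U, christoffel h' a i j x = christoffel h a i j x :=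
    fun a i j x hx => by
      have hp : ∀ l b c, pd l (fun z => h' z b c) x = pd l (fun z => h z b c) x := fun l b c =>
        pd_congr_of_eqOn hU hx fun z hz => by simp only [hh hz]
      simp only [christoffel, hh hx, hp]
  refine Eq.trans (integral_congr_ae (Filter.Eventually.of_forall fun x => ?_))
    ((hK.2 φ hφ hc hs).trans (integral_congr_ae (Filter.Eventually.of_forall fun x => ?_)))
  · by_cases hx : x ∈ tsupport φ
    · simp only [hKK' (hs hx), hv x (hs hx)]
    · simp [image_eq_zero_of_notMem_tsupport hx]
  · by_cases hx : x ∈ tsupport φ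
    · simp only [hΓ _ _ _ x (hs hx), hv x (hs hx), hh (hs hx)]
    · have h0 : ∀ i, pd i φ x = 0 := fun i =>
        image_eq_zero_of_notMem_tsupport fun h => hx (tsupport_pd_subset i φ h)
      simp [h0]

/-- Being the Gaussian curvature is a local property. -/
lemma IsMetricOn.isGaussCurvatureOn_of_locally (hh : IsMetricOn 1 h U)
    (hloc : ∀ x ∈ U, ∃ V, IsOpen V ∧ x ∈ V ∧ V ⊆ U ∧ IsGaussCurvatureOn h V K) :
    IsGaussCurvatureOn h U K := by
  have hKc : ContinuousOn K U := fun x hx => by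
    obtain ⟨V, hV, hxV, -, hK⟩ := hloc x hx
    exact (hK.1.continuousAt (hV.mem_nhds hxV)).continuousWithinAt
  refine ⟨hKc, fun φ hφ hc hs => ?_⟩
  choose V hV hxV hVU hVK using hloc
  -- A partition of unity on the support of φ, subordinate to the local domains. By compactness,
  -- finitely many of the functions f i φ are enough, and each is a test function on one local
  -- domain.
  obtain ⟨f, hf⟩ := SmoothPartitionOfUnity.exists_isSubordinate 𝓘(ℝ, EucSp 2)
    (isClosed_tsupport φ) (fun x : U => V x x.2) (fun x => hV x x.2)
    (fun x hx => Set.mem_iUnion.2 ⟨⟨x, hs hx⟩, hxV x (hs hx)⟩)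
  have hfin := f.locallyFinite.finite_nonempty_inter_compact hc
  have hfs : ∀ i, ContDiff ℝ ∞ (f i) := fun i => (f i).contMDiff.contDiff
  set F := hfin.toFinset
  have hsum : ∀ x, φ x = ∑ i ∈ F, f i x * φ x := fun x => by
    by_cases hx : x ∈ tsupport φ
    · have h1 : ∑ᶠ i, f i x = ∑ i ∈ F, f i x := by
        refine finsum_eq_sum_of_support_subset _ fun i hi => ?_
        simp only [F, Set.Finite.coe_toFinset, Set.mem_ofPred_eq]
        exact ⟨x, hi, hx⟩
      rw [← Finset.sum_mul, ← h1, f.sum_eq_one hx, one_mul]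
    · simp [image_eq_zero_of_notMem_tsupport hx]
  have hψs : ∀ i, ContDiff ℝ ∞ (fun x => f i x * φ x) := fun i => (hfs i).mul hφ
  have hψc : ∀ i, HasCompactSupport (fun x => f i x * φ x) := fun i => hc.mul_left
  have hψU : ∀ i, tsupport (fun x => f i x * φ x) ⊆ U := fun i =>
    (tsupport_mul_subset_right).trans hs
  have hpd : ∀ j x, pd j φ x = ∑ i ∈ F, pd j (fun x => f i x * φ x) x := fun j x => by
    rw [← pd_sum _ _ fun i _ => (hψs i).differentiable (by simp) x]
    congr 1
    exact funext hsum
  have hρ := hh.contDiffOn_volDensity.continuousOn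
  have hΓ : ∀ a i j, ContinuousOn (christoffel h a i j) U := fun a i j =>
    (hh.contDiffOn_christoffel (k := 0) (by norm_num) a i j).continuousOn
  have hint1 : ∀ i, Integrable (fun x => K x * (f i x * φ x) * volDensity h x) := fun i =>
    (integrable_mul_of_tsupport_subset hh.isOpen (hKc.mul hρ) (hψs i).continuous (hψc i)
      (hψU i)).congr (Filter.Eventually.of_forall fun x => by simp only [Pi.mul_apply]; ring)
  have hint2 : ∀ i, Integrable (fun x => volDensity h x / h x 0 0 *
      (christoffel h 1 0 1 x * pd 0 (fun x => f i x * φ x) x -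
        christoffel h 1 0 0 x * pd 1 (fun x => f i x * φ x) x)) := fun i => by
    have hq : ContinuousOn (fun x => volDensity h x / h x 0 0) U :=
      hρ.div (hh.contDiffOn 0 0).continuousOn fun x hx => (hh.posDef x hx).diag_pos.ne'
    have hI : ∀ a j, Integrable (fun x => (volDensity h x / h x 0 0 * christoffel h 1 0 a x) *
        pd j (fun x => f i x * φ x) x) := fun a j =>
      integrable_mul_of_tsupport_subset hh.isOpen (hq.mul (hΓ 1 0 a))
        (contDiff_pd j (hψs i) (m := 0) (by simp)).continuous
        ((hψc i).of_isClosed_subset (isClosed_tsupport _) (tsupport_pd_subset j _))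
        ((tsupport_pd_subset j _).trans (hψU i))
    refine ((hI 1 0).sub (hI 0 1)).congr (Filter.Eventually.of_forall fun x => ?_)
    simp only [Pi.sub_apply]
    ring
  have h1 : ∀ x, K x * φ x * volDensity h x =
      ∑ i ∈ F, K x * (f i x * φ x) * volDensity h x := fun x => by
    rw [← Finset.sum_mul, ← Finset.mul_sum, ← hsum]
  have h2 : ∀ x, volDensity h x / h x 0 0 *
      (christoffel h 1 0 1 x * pd 0 φ x - christoffel h 1 0 0 x * pd 1 φ x) =
      ∑ i ∈ F, volDensity h x / h x 0 0 *
        (christoffel h 1 0 1 x * pd 0 (fun x => f i x * φ x) x -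
          christoffel h 1 0 0 x * pd 1 (fun x => f i x * φ x) x) := fun x => by
    rw [← Finset.mul_sum, Finset.sum_sub_distrib, ← Finset.mul_sum, ← Finset.mul_sum, ← hpd, ← hpd]
  simp only [h1, h2]
  rw [integral_finsetSum _ fun i _ => hint1 i, integral_finsetSum _ fun i _ => hint2 i]
  exact Finset.sum_congr rfl fun i _ => (hVK i i.2).2 _ (hψs i) (hψc i)
    ((tsupport_mul_subset_left).trans (hf i))

end GaussCurvature

/-! ### Local parametrization of level sets. -/

/-- Near a point at which the derivative of `u` does not vanish, the level set of `u` is a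
parametrized surface. -/
lemma exists_levelSet_parametrization {u : EucSp 3 → ℝ} {Ω : Set (EucSp 3)} (hΩ : IsOpen Ω)
    (hu : ContDiffOn ℝ 2 u Ω) {y : EucSp 3} (hy : y ∈ Ω) {i : Fin 3} (hi : pd i u y ≠ 0) :
    ∃ (U : Set (EucSp 2)) (X : EucSp 2 → EucSp 3) (x : EucSp 2), IsOpen U ∧ x ∈ U ∧ X x = y ∧
      ContDiffOn ℝ 2 X U ∧ Set.MapsTo X U Ω ∧ (∀ z ∈ U, Function.Injective (fderiv ℝ X z)) ∧
      ∀ z ∈ U, u (X z) = u y := by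
  set e : EucSp 3 := EuclideanSpace.single i 1 with he
  -- Φ replaces the i-th coordinate by u and so straightens the level sets. It is locally invertible
  -- at y because ∂_i u ≠ 0 there.
  set Φ : EucSp 3 → EucSp 3 := fun z => z + (u z - z i) • e with hΦ
  have hΦc : ContDiffOn ℝ 2 Φ Ω := by
    refine contDiffOn_id.add ((hu.sub ?_).smul contDiffOn_const)
    exact (EuclideanSpace.proj (𝕜 := ℝ) i).contDiff.contDiffOn
  have hΦat : ContDiffAt ℝ 2 Φ y := hΦc.contDiffAt (hΩ.mem_nhds hy)
  have hud : HasFDerivAt u (fderiv ℝ u y) y :=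
    (differentiableAt_of_contDiffOn hΩ hu (by norm_num) hy).hasFDerivAt
  have hΦd : HasFDerivAt Φ (ContinuousLinearMap.id ℝ (EucSp 3) +
      (fderiv ℝ u y - EuclideanSpace.proj i).smulRight e) y :=
    (hasFDerivAt_id y).add ((hud.sub (EuclideanSpace.proj (𝕜 := ℝ) i).hasFDerivAt).smul_const e)
  set L : EucSp 3 →L[ℝ] EucSp 3 := ContinuousLinearMap.id ℝ (EucSp 3) +
      (fderiv ℝ u y - EuclideanSpace.proj i).smulRight e with hL
  have hei : e i = 1 := by simp [he]
  have hej : ∀ j, e (i.succAbove j) = 0 := fun j => by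
    simp [he, Fin.succAbove_ne]
  -- A kernel vector is a multiple of e that is annihilated by du, while du(e) = ∂_i u.
  have hLinj : Function.Injective L := by
    rw [injective_iff_map_eq_zero]
    intro v hv
    have h0 : v + (fderiv ℝ u y v - v i) • e = 0 := hv
    have h1 : ∀ a, v a + (fderiv ℝ u y v - v i) * e a = 0 := fun a => by
      simpa using congrArg (fun w : EucSp 3 => w a) h0
    have h2 : fderiv ℝ u y v = 0 := by
      have := h1 i
      rw [hei] at this
      linarith
    have h3 : v = v i • e := by
      rw [h2, zero_sub, neg_smul, add_neg_eq_zero] at h0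
      exact h0
    have h4 : v i * pd i u y = 0 := by
      rw [h3, map_smul, smul_eq_mul] at h2
      exact h2
    rw [h3, (mul_eq_zero.1 h4).resolve_right hi, zero_smul]
  set Le : EucSp 3 ≃L[ℝ] EucSp 3 :=
    (LinearEquiv.ofInjectiveEndo (L : EucSp 3 →ₗ[ℝ] EucSp 3) hLinj).toContinuousLinearEquiv
  have hLe : HasFDerivAt Φ (Le : EucSp 3 →L[ℝ] EucSp 3) y := hΦd
  set H := hΦat.toOpenPartialHomeomorph Φ hLe (by norm_num) with hH
  have hHc : ContDiffAt ℝ 2 H.symm (Φ y) := hΦat.to_localInverse hLe (by norm_num)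
  have hyH : y ∈ H.source := hΦat.mem_toOpenPartialHomeomorph_source hLe (by norm_num)
  have hHΦ : ∀ z, H z = Φ z := fun z => rfl
  -- Being C² at Φ y, the local inverse is C² at all points of a neighbourhood T.
  obtain ⟨T, hT, hTo, hyT⟩ := mem_nhds_iff.1 (hHc.eventually (by simp))
  set O : Set (EucSp 3) := T ∩ (H.target ∩ H.symm ⁻¹' Ω) with hO
  have hOo : IsOpen O := hTo.inter (H.symm.isOpen_inter_preimage hΩ)
  set J : EucSp 2 →L[ℝ] EucSp 3 := ∑ j : Fin 2,
    (EuclideanSpace.proj (𝕜 := ℝ) j).smulRight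
      (EuclideanSpace.single (i.succAbove j) (1 : ℝ) : EucSp 3) with hJ
  have hJa : ∀ x a, J x a = ∑ j : Fin 2, x j *
      (EuclideanSpace.single (i.succAbove j) (1 : ℝ) : EucSp 3) a := fun x a => by
    simp [hJ]
  have hJi : ∀ x, J x i = 0 := fun x => by
    rw [hJa]
    exact Finset.sum_eq_zero fun j _ => by simp [(Fin.succAbove_ne i j).symm]
  have hJj : ∀ x j, J x (i.succAbove j) = x j := fun x j => by
    rw [hJa]
    simp
  have hJinj : ∀ x, J x = 0 → x = 0 := fun x hx => by
    ext j
    rw [← hJj, hx]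
    rfl
  -- The affine plane on which the i-th coordinate equals u y; its preimage under Φ is the level
  -- set.
  set ι : EucSp 2 → EucSp 3 := fun x => u y • e + J x with hι
  have hιd : ∀ x, HasFDerivAt ι J x := fun x => J.hasFDerivAt.const_add _
  have hιc : ContDiff ℝ 2 ι := contDiff_const.add J.contDiff
  set x₀ : EucSp 2 := WithLp.toLp 2 fun j => y (i.succAbove j)
  have hιx : ι x₀ = Φ y := by
    ext a
    rcases Fin.eq_self_or_eq_succAbove i a with rfl | ⟨j, rfl⟩
    · simp [hι, hΦ, hJi, hei]
    · simp [hι, hΦ, hJj, hej, x₀]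
  have hright : ∀ z ∈ ι ⁻¹' O, Φ (H.symm (ι z)) = ι z := fun z hz => by
    rw [← hHΦ]
    exact H.right_inv hz.2.1
  have hUo : IsOpen (ι ⁻¹' O) := hOo.preimage hιc.continuous
  have hXc : ContDiffOn ℝ 2 (fun z => H.symm (ι z)) (ι ⁻¹' O) := fun z hz =>
    (ContDiffAt.comp z (show ContDiffAt ℝ 2 H.symm (ι z) from hT hz.1)
      hιc.contDiffAt).contDiffWithinAt
  have hHy : H.symm (Φ y) = y := H.left_inv hyH
  refine ⟨ι ⁻¹' O, fun z => H.symm (ι z), x₀, hUo, ?_, ?_, hXc, fun z hz => hz.2.2, fun z hz => ?_,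
    fun z hz => ?_⟩
  · rw [Set.mem_preimage, hιx]
    refine ⟨hyT, H.map_source hyH, ?_⟩
    rw [Set.mem_preimage, hHy]
    exact hy
  · simp only [hιx, hHy]
  · have hXd : HasFDerivAt (fun z => H.symm (ι z)) (fderiv ℝ (fun z => H.symm (ι z)) z) z :=
      ((hXc.contDiffAt (hUo.mem_nhds hz)).differentiableAt (by norm_num)).hasFDerivAt
    have hΦz : HasFDerivAt Φ (fderiv ℝ Φ (H.symm (ι z))) (H.symm (ι z)) :=
      ((hΦc.contDiffAt (hΩ.mem_nhds hz.2.2)).differentiableAt (by norm_num)).hasFDerivAt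
    have hιe : ι =ᶠ[nhds z] Φ ∘ fun z => H.symm (ι z) :=
      Filter.eventuallyEq_of_mem (hUo.mem_nhds hz) fun w hw => (hright w hw).symm
    -- Φ ∘ X = ι near z, so DΦ ∘ DX is the injective map J.
    have hJeq := (hιd z).unique ((hΦz.comp z hXd).congr_of_eventuallyEq hιe)
    rw [injective_iff_map_eq_zero]
    intro v hv
    refine hJinj v ?_
    rw [hJeq, ContinuousLinearMap.comp_apply, hv, map_zero]
  · have h1 := congrArg (fun w : EucSp 3 => w i) (hright z hz)
    simpa [hΦ, hι, hJi, hei] using h1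

/-! ### From charts to the manifold. -/

section InitialData

variable {M : Type*} [TopologicalSpace M] [ChartedSpace (EucSp 3) M] {n : ℕ}

lemma components_apply (b : ∀ p : M, TSp p →L[ℝ] TSp p →L[ℝ] ℝ) (F : EucSp n → M)
    (x : EucSp n) (i j : Fin n) : components b F x i j = b (F x) (coordVec F x i) (coordVec F x j) :=
  rfl

/-- Maps with the same germ have the same value and derivative. The tangent spaces at F x and F' x
are different types on paper, so the comparison is made in the model space underlying both. -/
lemma components_congr (b : ∀ p : M, TSp p →L[ℝ] TSp p →L[ℝ] ℝ) {F F' : EucSp n → M}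
    {x : EucSp n} (h : F =ᶠ[nhds x] F') : components b F x = components b F' x := by
  have h1 : mfderiv 𝓘(ℝ, EucSp n) 𝓘(ℝ, EucSp 3) F x = mfderiv 𝓘(ℝ, EucSp n) 𝓘(ℝ, EucSp 3) F' x :=
    h.mfderiv_eq
  have key : ∀ B : M → EucSp 3 →L[ℝ] EucSp 3 →L[ℝ] ℝ, ∀ v w : EucSp 3,
    B (F x) v w = B (F' x) v w := fun B v w => by rw [h.eq_of_nhds]
  ext i j
  rw [components_apply, components_apply]
  have hc : ∀ i, (coordVec F x i : EucSp 3) = coordVec F' x i := fun i => by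
    unfold coordVec
    exact congrArg (fun (T : EucSp n →L[ℝ] EucSp 3) => T (EuclideanSpace.single i 1)) h1
  refine (key b (coordVec F x i) (coordVec F x j)).trans ?_
  exact congrArg₂ (fun v w : EucSp 3 => b (F' x) v w) (hc i) (hc j)

lemma mfderiv_apply_eq_sum (F : EucSp 3 → M) (y : EucSp 3) (v : EucSp 3) :
    mfderiv 𝓘(ℝ, EucSp 3) 𝓘(ℝ, EucSp 3) F y v = ∑ i, v i • coordVec F y i := by
  have : v = ∑ i, v i • (EuclideanSpace.single i (1 : ℝ) : EucSp 3) := by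
    ext a
    simp [Pi.single_apply]
  conv_lhs => rw [this]
  exact map_sum _ _ _ |>.trans (Finset.sum_congr rfl fun i _ => map_smul _ _ _)

lemma coordVec_comp (F : EucSp 3 → M) (Y : EucSp 2 → EucSp 3) {x : EucSp 2}
    (hF : MDifferentiableAt 𝓘(ℝ, EucSp 3) 𝓘(ℝ, EucSp 3) F (Y x)) (hY : DifferentiableAt ℝ Y x)
    (i : Fin 2) : coordVec (F ∘ Y) x i = ∑ a, tang Y i x a • coordVec F (Y x) a := by
  have h1 : coordVec (F ∘ Y) x i = mfderiv 𝓘(ℝ, EucSp 3) 𝓘(ℝ, EucSp 3) F (Y x)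
      (fderiv ℝ Y x (EuclideanSpace.single i 1)) := by
    unfold coordVec
    rw [mfderiv_comp x hF hY.mdifferentiableAt, mfderiv_eq_fderiv]
    rfl
  rw [h1, mfderiv_apply_eq_sum]
  refine Finset.sum_congr rfl fun a _ => ?_
  congr 1
  have : HasFDerivAt (fun z => Y z a) ((EuclideanSpace.proj a).comp (fderiv ℝ Y x)) x :=
    (EuclideanSpace.proj (𝕜 := ℝ) a).hasFDerivAt.comp x hY.hasFDerivAt
  simp only [tang, pd]
  rw [this.fderiv]
  rfl

lemma components_comp (b : ∀ p : M, TSp p →L[ℝ] TSp p →L[ℝ] ℝ) (F : EucSp 3 → M)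
    (Y : EucSp 2 → EucSp 3) {x : EucSp 2}
    (hF : MDifferentiableAt 𝓘(ℝ, EucSp 3) 𝓘(ℝ, EucSp 3) F (Y x)) (hY : DifferentiableAt ℝ Y x) :
    components b (F ∘ Y) x = pullback (components b F) Y x := by
  ext i j
  rw [components_apply, coordVec_comp F Y hF hY, coordVec_comp F Y hF hY]
  simp only [pullback, ip, Matrix.of_apply, components_apply, Function.comp_apply, map_sum,
    map_smul, sum_apply, smul_apply, smul_eq_mul,
    Finset.mul_sum]
  rw [Finset.sum_comm]
  exact Finset.sum_congr rfl fun a _ => Finset.sum_congr rfl fun c _ => by ring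

variable [IsManifold 𝓘(ℝ, EucSp 3) ∞ M]

/-- The coordinate fields are smooth along F, being the tangent map of F applied to constant vector
fields. The smooth tensor is then evaluated on them in the bundle. -/
lemma contDiffOn_components {b : ∀ p : M, TSp p →L[ℝ] TSp p →L[ℝ] ℝ}
    (hb : ContMDiff 𝓘(ℝ, EucSp 3) (𝓘(ℝ, EucSp 3).prod 𝓘(ℝ, EucSp 3 →L[ℝ] EucSp 3 →L[ℝ] ℝ)) ∞
      (fun p : M => Bundle.TotalSpace.mk' (EucSp 3 →L[ℝ] EucSp 3 →L[ℝ] ℝ)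
        (E := fun p : M => TSp p →L[ℝ] TSp p →L[ℝ] ℝ) p (b p)))
    {F : EucSp 3 → M} {Ω : Set (EucSp 3)} (hΩ : IsOpen Ω)
    (hF : ContMDiffOn 𝓘(ℝ, EucSp 3) 𝓘(ℝ, EucSp 3) ∞ F Ω) (i j : Fin 3) :
    ContDiffOn ℝ ∞ (fun y => components b F y i j) Ω := by
  have hv : ∀ i, ContMDiffOn 𝓘(ℝ, EucSp 3) (𝓘(ℝ, EucSp 3).prod 𝓘(ℝ, EucSp 3)) ∞
      (fun y => Bundle.TotalSpace.mk' (EucSp 3) (E := fun p : M => TSp p) (F y) (coordVec F y i))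
      Ω := fun i => by
    have h1 := hF.contMDiffOn_tangentMapWithin (m := ∞) (by simp) hΩ.uniqueMDiffOn
    have h2 : ContMDiff 𝓘(ℝ, EucSp 3) (𝓘(ℝ, EucSp 3).prod 𝓘(ℝ, EucSp 3)) ∞
        (fun y : EucSp 3 => (⟨y, EuclideanSpace.single i (1 : ℝ)⟩ :
          TangentBundle 𝓘(ℝ, EucSp 3) (EucSp 3))) :=
      contMDiff_vectorSpace_iff_contDiff.2 contDiff_const
    refine (h1.comp h2.contMDiffOn fun y hy => hy).congr fun y hy => ?_
    simp only [Function.comp_apply, tangentMapWithin, coordVec, mfderivWithin_of_isOpen hΩ hy]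
  have h3 := (hb.comp_contMDiffOn hF).clm_bundle_apply₂ (hv i) (hv j) (E₃ := fun _ : M => ℝ) (F₃ := ℝ)
  exact fun y hy => contMDiffWithinAt_iff_contDiffWithinAt.1
    (Bundle.contMDiffWithinAt_totalSpace.1 (h3 y hy)).2

variable {D : InitialDataSet M} {e e' : OpenPartialHomeomorph M (EucSp 3)} {u : M → ℝ}
  {U : Set (EucSp 2)} {X : EucSp 2 → M} {c : ℝ}

omit [IsManifold 𝓘(ℝ, EucSp 3) ∞ M] in
lemma mdifferentiable_of_mem_maximalAtlas (he : e ∈ IsManifold.maximalAtlas 𝓘(ℝ, EucSp 3) ∞ M) :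
    e.MDifferentiable 𝓘(ℝ, EucSp 3) 𝓘(ℝ, EucSp 3) :=
  ⟨(contMDiffOn_of_mem_maximalAtlas he).mdifferentiableOn (by simp),
    (contMDiffOn_symm_of_mem_maximalAtlas he).mdifferentiableOn (by simp)⟩

/-- Positive definiteness carries over because the differential of an inverse chart is injective. -/
lemma InitialDataSet.isMetricOn_gIn (D : InitialDataSet M)
    (he : e ∈ IsManifold.maximalAtlas 𝓘(ℝ, EucSp 3) ∞ M) : IsMetricOn ∞ (D.gIn e) e.target := by
  refine ⟨e.open_target, contDiffOn_components D.g.contMDiff e.open_target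
    (contMDiffOn_symm_of_mem_maximalAtlas he), fun y hy => ?_⟩
  refine Matrix.PosDef.of_dotProduct_mulVec_pos ?_ fun c hc => ?_
  · ext i j
    simp only [Matrix.conjTranspose_apply, InitialDataSet.gIn, components_apply, star_trivial]
    exact D.g.symm _ _ _
  · set w : EucSp 3 := WithLp.toLp 2 c with hw
    have hw0 : w ≠ 0 := fun h => hc (by simpa [hw] using congrArg WithLp.ofLp h)
    have hinj := (mdifferentiable_of_mem_maximalAtlas he).symm.mfderiv_injective hy
    have hne : mfderiv 𝓘(ℝ, EucSp 3) 𝓘(ℝ, EucSp 3) e.symm y w ≠ 0 := fun h =>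
      hw0 (hinj (h.trans (map_zero _).symm))
    have hpos := D.g.pos _ _ hne
    rw [mfderiv_apply_eq_sum] at hpos
    refine hpos.trans_eq ?_
    simp only [dotProduct, Matrix.mulVec, star_trivial, InitialDataSet.gIn, components_apply,
      map_sum, map_smul, sum_apply, smul_apply, smul_eq_mul, Finset.mul_sum, hw]
    rw [Finset.sum_comm]
    exact Finset.sum_congr rfl fun a _ => Finset.sum_congr rfl fun c _ => by ring

omit [IsManifold 𝓘(ℝ, EucSp 3) ∞ M] in
lemma contDiffOn_comp_symm (hu : ContMDiff 𝓘(ℝ, EucSp 3) 𝓘(ℝ, ℝ) 2 u)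
    (he : e ∈ IsManifold.maximalAtlas 𝓘(ℝ, EucSp 3) ∞ M) :
    ContDiffOn ℝ 2 (u ∘ e.symm) e.target :=
  (hu.comp_contMDiffOn ((contMDiffOn_symm_of_mem_maximalAtlas he).of_le
    (WithTop.coe_le_coe.2 le_top))).contDiffOn

section ChartOfSurface

variable (he : e ∈ IsManifold.maximalAtlas 𝓘(ℝ, EucSp 3) ∞ M) (hU : IsOpen U)
  (hX : ContMDiffOn 𝓘(ℝ, EucSp 2) 𝓘(ℝ, EucSp 3) 2 X U) (hmap : Set.MapsTo X U e.source)
include he hX hmap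

omit [IsManifold 𝓘(ℝ, EucSp 3) ∞ M] in
lemma contDiffOn_chart_comp : ContDiffOn ℝ 2 (e ∘ X) U :=
  (((contMDiffOn_of_mem_maximalAtlas he).of_le (WithTop.coe_le_coe.2 le_top)).comp hX hmap).contDiffOn

include hU

lemma components_eq_pullback :
    Set.EqOn (components D.g.inner X) (pullback (D.gIn e) (e ∘ X)) U := fun x hx => by
  have h1 : X =ᶠ[nhds x] e.symm ∘ (e ∘ X) :=
    Filter.eventuallyEq_of_mem (hU.mem_nhds hx) fun z hz => (e.left_inv (hmap hz)).symm
  have hY := contDiffOn_chart_comp he hX hmap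
  rw [components_congr _ h1, components_comp]
  · rfl
  · exact (mdifferentiable_of_mem_maximalAtlas he).mdifferentiableAt_symm (e.map_source (hmap hx))
  · exact (hY.contDiffAt (hU.mem_nhds hx)).differentiableAt (by norm_num)

omit [IsManifold 𝓘(ℝ, EucSp 3) ∞ M] in
lemma injective_fderiv_chart_comp
    (hinj : ∀ x ∈ U, Function.Injective (mfderiv 𝓘(ℝ, EucSp 2) 𝓘(ℝ, EucSp 3) X x)) :
    ∀ x ∈ U, Function.Injective (fderiv ℝ (e ∘ X) x) := fun x hx => by
  have hd := mdifferentiable_of_mem_maximalAtlas he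
  have hXd : MDifferentiableAt 𝓘(ℝ, EucSp 2) 𝓘(ℝ, EucSp 3) X x :=
    (hX.contMDiffAt (hU.mem_nhds hx)).mdifferentiableAt (by norm_num)
  rw [← mfderiv_eq_fderiv, mfderiv_comp x (hd.mdifferentiableAt (hmap hx)) hXd]
  exact (hd.mfderiv_injective (hmap hx)).comp (hinj x hx)

lemma isMetricOn_components
    (hinj : ∀ x ∈ U, Function.Injective (mfderiv 𝓘(ℝ, EucSp 2) 𝓘(ℝ, EucSp 3) X x)) :
    IsMetricOn 1 (components D.g.inner X) U := by
  have hP := (D.isMetricOn_gIn he).pullback_isMetricOn (by simp) hU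
    (contDiffOn_chart_comp he hX hmap) (fun x hx => e.map_source (hmap hx))
    (injective_fderiv_chart_comp he hU hX hmap hinj)
  have heq := components_eq_pullback (D := D) he hU hX hmap
  refine ⟨hU, fun i j => (hP.contDiffOn i j).congr fun x hx => by rw [heq hx], fun x hx => ?_⟩
  rw [heq hx]
  exact hP.posDef x hx

lemma isGaussCurvatureOn_chart (hu : ContMDiff 𝓘(ℝ, EucSp 3) 𝓘(ℝ, ℝ) 2 u)
    (hgrad : HasNonvanishingGradient D u)
    (hinj : ∀ x ∈ U, Function.Injective (mfderiv 𝓘(ℝ, EucSp 2) 𝓘(ℝ, EucSp 3) X x))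
    (hc : ∀ x ∈ U, u (X x) = c) :
    IsGaussCurvatureOn (components D.g.inner X) U
      (fun x => levelCurv (D.gIn e) (u ∘ e.symm) (e (X x))) := by
  refine ((D.isMetricOn_gIn he).isGaussCurvatureOn_levelCurv (c := c)
    (WithTop.coe_le_coe.2 le_top) (contDiffOn_comp_symm hu he)
    (hgrad e he) hU (contDiffOn_chart_comp he hX hmap) (fun x hx => e.map_source (hmap hx))
    (injective_fderiv_chart_comp he hU hX hmap hinj) fun x hx => ?_).congr hU
    (components_eq_pullback he hU hX hmap) fun x hx => rfl
  simp only [Function.comp_apply, e.left_inv (hmap hx), hc x hx]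

end ChartOfSurface

lemma exists_pd_ne_zero {G : EucSp 3 → Matrix (Fin 3) (Fin 3) ℝ} {f : EucSp 3 → ℝ} {y : EucSp 3}
    (h : gradLen G f y ≠ 0) : ∃ i, pd i f y ≠ 0 := by
  by_contra! h0
  exact h (by simp [gradLen, len, ip, grad, h0])

/-- The expression `levelCurv` does not depend on the chart. -/
lemma levelCurv_eq_of_charts (hu : ContMDiff 𝓘(ℝ, EucSp 3) 𝓘(ℝ, ℝ) 2 u)
    (hgrad : HasNonvanishingGradient D u) (he : e ∈ IsManifold.maximalAtlas 𝓘(ℝ, EucSp 3) ∞ M)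
    (he' : e' ∈ IsManifold.maximalAtlas 𝓘(ℝ, EucSp 3) ∞ M) {p : M} (hp : p ∈ e.source)
    (hp' : p ∈ e'.source) :
    levelCurv (D.gIn e) (u ∘ e.symm) (e p) = levelCurv (D.gIn e') (u ∘ e'.symm) (e' p) := by
  obtain ⟨i, hi⟩ := exists_pd_ne_zero (hgrad e he (e p) (e.map_source hp))
  have hΩ : IsOpen (e.target ∩ e.symm ⁻¹' e'.source) :=
    e.symm.isOpen_inter_preimage e'.open_source
  -- A piece of the level set through p, small enough to lie in both chart domains.
  obtain ⟨U, Y, x, hU, hx, hYx, hY, hYΩ, hYinj, hYc⟩ := exists_levelSet_parametrization hΩ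
    ((contDiffOn_comp_symm hu he).mono Set.inter_subset_left)
    ⟨e.map_source hp, by rwa [Set.mem_preimage, e.left_inv hp]⟩ hi
  have hd := mdifferentiable_of_mem_maximalAtlas he
  have hX : ContMDiffOn 𝓘(ℝ, EucSp 2) 𝓘(ℝ, EucSp 3) 2 (e.symm ∘ Y) U :=
    ((contMDiffOn_symm_of_mem_maximalAtlas he).of_le (WithTop.coe_le_coe.2 le_top)).comp
      hY.contMDiffOn fun z hz => (hYΩ hz).1
  have hm : Set.MapsTo (e.symm ∘ Y) U e.source := fun z hz => e.map_target (hYΩ hz).1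
  have hm' : Set.MapsTo (e.symm ∘ Y) U e'.source := fun z hz => (hYΩ hz).2
  have hinj : ∀ z ∈ U, Function.Injective
      (mfderiv 𝓘(ℝ, EucSp 2) 𝓘(ℝ, EucSp 3) (e.symm ∘ Y) z) := fun z hz => by
    have hYd : DifferentiableAt ℝ Y z :=
      (hY.contDiffAt (hU.mem_nhds hz)).differentiableAt (by norm_num)
    rw [mfderiv_comp z (hd.mdifferentiableAt_symm (hYΩ hz).1) hYd.mdifferentiableAt]
    refine (hd.symm.mfderiv_injective (hYΩ hz).1).comp ?_
    rw [mfderiv_eq_fderiv]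
    exact hYinj z hz
  have h1 := isGaussCurvatureOn_chart he hU hX hm hu hgrad hinj hYc
  have h2 := isGaussCurvatureOn_chart he' hU hX hm' hu hgrad hinj hYc
  -- The two chart expressions are weak Gaussian curvatures of one and the same induced metric.
  have h3 := (isMetricOn_components he hU hX hm hinj).isGaussCurvatureOn_unique h1 h2 hx
  simpa only [Function.comp_apply, hYx, e.left_inv hp] using h3

/-- The Gaussian curvature of the level sets of `u`. -/
def levelSetCurv (D : InitialDataSet M) (u : M → ℝ) (p : M) : ℝ :=
  levelCurv (D.gIn (chartAt (EucSp 3) p)) (u ∘ (chartAt (EucSp 3) p).symm) (chartAt (EucSp 3) p p)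

section LevelSets

variable (hu : ContMDiff 𝓘(ℝ, EucSp 3) 𝓘(ℝ, ℝ) 2 u) (hgrad : HasNonvanishingGradient D u)
include hu hgrad

/-- Frees the definition from the preferred chart at p, so that continuity and the chart formulas
can be checked in any one chart. -/
lemma levelSetCurv_eq (he : e ∈ IsManifold.maximalAtlas 𝓘(ℝ, EucSp 3) ∞ M) {p : M}
    (hp : p ∈ e.source) :
    levelSetCurv D u p = levelCurv (D.gIn e) (u ∘ e.symm) (e p) :=
  levelCurv_eq_of_charts hu hgrad (IsManifold.chart_mem_maximalAtlas p) he
    (mem_chart_source _ p) hp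

lemma levelSetCurv_comp_symm (he : e ∈ IsManifold.maximalAtlas 𝓘(ℝ, EucSp 3) ∞ M) :
    Set.EqOn (levelSetCurv D u ∘ e.symm) (levelCurv (D.gIn e) (u ∘ e.symm)) e.target :=
  fun y hy => by
    rw [Function.comp_apply, levelSetCurv_eq hu hgrad he (e.map_target hy), e.right_inv hy]

lemma continuous_levelSetCurv : Continuous (levelSetCurv D u) := by
  refine continuous_iff_continuousAt.2 fun p => ?_
  set e := chartAt (EucSp 3) p
  have he : e ∈ IsManifold.maximalAtlas 𝓘(ℝ, EucSp 3) ∞ M := IsManifold.chart_mem_maximalAtlas p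
  have hc := (D.isMetricOn_gIn he).continuousOn_levelCurv (WithTop.coe_le_coe.2 le_top)
    (contDiffOn_comp_symm hu he) (hgrad e he)
  have hc' := hc.comp e.continuousOn fun q hq => e.map_source hq
  exact (hc'.congr fun q hq => levelSetCurv_eq hu hgrad he hq).continuousAt
    (e.open_source.mem_nhds (mem_chart_source _ p))

/-- A parametrized surface need not stay in one chart. Its domain is covered by open sets mapped
into single charts, where the chart version applies, and the results are glued by
`isGaussCurvatureOn_of_locally`. -/
lemma isLevelSetGaussCurvature_levelSetCurv :
    IsLevelSetGaussCurvature D u (levelSetCurv D u) := by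
  refine ⟨continuous_levelSetCurv hu hgrad, fun U X c hU hX hinj hc => ?_⟩
  have hV : ∀ x : EucSp 2, IsOpen (U ∩ X ⁻¹' (chartAt (EucSp 3) (X x)).source) := fun x =>
    hX.continuousOn.isOpen_inter_preimage hU (chartAt (EucSp 3) (X x)).open_source
  have hch : ∀ x : EucSp 2, chartAt (EucSp 3) (X x) ∈ IsManifold.maximalAtlas 𝓘(ℝ, EucSp 3) ∞ M :=
    fun x => IsManifold.chart_mem_maximalAtlas _
  have hmet : ∀ x, IsMetricOn 1 (components D.g.inner X)
      (U ∩ X ⁻¹' (chartAt (EucSp 3) (X x)).source) := fun x =>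
    isMetricOn_components (hch x) (hV x) (hX.mono Set.inter_subset_left) (fun z hz => hz.2)
      fun z hz => hinj z hz.1
  have hmem : ∀ x ∈ U, x ∈ U ∩ X ⁻¹' (chartAt (EucSp 3) (X x)).source := fun x hx =>
    ⟨hx, mem_chart_source _ _⟩
  have hh : IsMetricOn 1 (components D.g.inner X) U :=
    ⟨hU, fun i j x hx => (((hmet x).contDiffOn i j).contDiffAt
      ((hV x).mem_nhds (hmem x hx))).contDiffWithinAt, fun x hx => (hmet x).posDef x (hmem x hx)⟩
  refine hh.isGaussCurvatureOn_of_locally fun x hx => ⟨_, hV x, hmem x hx, Set.inter_subset_left, ?_⟩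
  refine (isGaussCurvatureOn_chart (hch x) (hV x) (hX.mono Set.inter_subset_left)
    (fun z hz => hz.2) hu hgrad (fun z hz => hinj z hz.1) fun z hz => hc z hz.1).congr (hV x)
    (fun _ _ => rfl) fun z hz => ?_
  exact levelSetCurv_eq hu hgrad (hch x) hz.2

end LevelSets

end InitialData

end SpacetimeIMCF

end

/-! ### The theorem. -/

theorem theorem1p2 {M : Type*} [TopologicalSpace M] [ChartedSpace (SpacetimeIMCF.EucSp 3) M]
    [IsManifold 𝓘(ℝ, SpacetimeIMCF.EucSp 3) ∞ M] (D : SpacetimeIMCF.InitialDataSet M)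
    (a : ℝ) (ha : a ∈ Set.Icc (0 : ℝ) 1) (α : ℝ≥0) (hα₀ : 0 < α) (hα₁ : α < 1) (u v : M → ℝ)
    (hu : SpacetimeIMCF.IsC2Holder α u) (hv : SpacetimeIMCF.IsC2Holder α v)
    (hu_pos : ∀ p, 0 < u p) (hv_pos : ∀ p, 0 < v p)
    (hu_grad : SpacetimeIMCF.HasNonvanishingGradient D u)
    (hv_grad : SpacetimeIMCF.HasNonvanishingGradient D v)
    (hsys : SpacetimeIMCF.SolvesSystem D a u v) :
    ∃ Ku Kv : M → ℝ,
      SpacetimeIMCF.IsLevelSetGaussCurvature D u Ku ∧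
      SpacetimeIMCF.IsLevelSetGaussCurvature D v Kv ∧
      ∀ e ∈ IsManifold.maximalAtlas 𝓘(ℝ, SpacetimeIMCF.EucSp 3) ∞ M,
        (∀ y ∈ e.target,
          0 ≤ SpacetimeIMCF.hessTerms (D.gIn e) (D.kIn e) a (u ∘ e.symm) (v ∘ e.symm) y) ∧
        SpacetimeIMCF.IsWeakDivergenceOn (D.gIn e) e.target
          (SpacetimeIMCF.fieldY (D.gIn e) (D.kIn e) (u ∘ e.symm) (v ∘ e.symm))
          (SpacetimeIMCF.divRhs (D.gIn e) (D.kIn e) a (u ∘ e.symm) (v ∘ e.symm)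
            (Ku ∘ e.symm) (Kv ∘ e.symm)) ∧
        (∀ Ω ⊆ e.target, IsOpen Ω →
          ContDiffOn ℝ 1 (SpacetimeIMCF.fieldY (D.gIn e) (D.kIn e) (u ∘ e.symm) (v ∘ e.symm)) Ω →
          ∀ y ∈ Ω,
            SpacetimeIMCF.divergence (D.gIn e)
              (SpacetimeIMCF.fieldY (D.gIn e) (D.kIn e) (u ∘ e.symm) (v ∘ e.symm)) y
            = SpacetimeIMCF.divRhs (D.gIn e) (D.kIn e) a (u ∘ e.symm) (v ∘ e.symm)
                (Ku ∘ e.symm) (Kv ∘ e.symm) y) := by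
  refine ⟨SpacetimeIMCF.levelSetCurv D u, SpacetimeIMCF.levelSetCurv D v,
    SpacetimeIMCF.isLevelSetGaussCurvature_levelSetCurv hu.1 hu_grad,
    SpacetimeIMCF.isLevelSetGaussCurvature_levelSetCurv hv.1 hv_grad, fun e he => ?_⟩
  have hG := D.isMetricOn_gIn he
  have hm : (2 : WithTop ℕ∞) ≤ ∞ := WithTop.coe_le_coe.2 le_top
  have hk : ∀ i j, ContDiffOn ℝ 1 (fun z => D.kIn e z i j) e.target := fun i j =>
    (SpacetimeIMCF.contDiffOn_components D.k_smooth e.open_target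
      (contMDiffOn_symm_of_mem_maximalAtlas he) i j).of_le (by simp)
  have hweak := hG.isWeakDivergenceOn_fieldY hm hk (fun z _ i j => D.k_symm _ _ _)
    (SpacetimeIMCF.contDiffOn_comp_symm hu.1 he) (SpacetimeIMCF.contDiffOn_comp_symm hv.1 he)
    (hu_grad e he) (hv_grad e he) (fun z _ => (add_pos (hu_pos _) (hv_pos _)).ne')
    (fun z hz => (hsys e he z hz).1) (fun z hz => (hsys e he z hz).2)
  -- The curvature expression of the chart is replaced by the function on M, with which it agrees on
  -- the chart's target.
  have hweak' := hweak.congr (Set.eqOn_refl _ _) fun y hy =>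
    show _ = SpacetimeIMCF.divRhs (D.gIn e) (D.kIn e) a (u ∘ e.symm) (v ∘ e.symm)
      (SpacetimeIMCF.levelSetCurv D u ∘ e.symm) (SpacetimeIMCF.levelSetCurv D v ∘ e.symm) y by
    simp only [SpacetimeIMCF.divRhs, SpacetimeIMCF.levelSetCurv_comp_symm hu.1 hu_grad he hy,
      SpacetimeIMCF.levelSetCurv_comp_symm hv.1 hv_grad he hy]
  exact ⟨fun y hy => hG.hessTerms_nonneg hy ha (hu_grad e he y hy) (hv_grad e he y hy), hweak',
    fun Ω hΩ ho hY y hy => hG.divergence_fieldY hm hweak' hΩ ho hY hy⟩
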